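/- Let $k$ be a field; all tensor products are over $k$, and $\Delta(h)=h_{(1)}\otimes h_{(2)}$, $\delta(m)=m_{(-1)}\otimes m_{(0)}$ denote comultiplications and left coactions. **Braidings.** A braided vector space $(M,c)$ is a vector space $M$ with an automorphism $c$ of $M\otimes M$ satisfying $(\mathrm{id}\otimes c)(c\otimes\mathrm{id})(\mathrm{id}\otimes c)=(c\otimes\mathrm{id})(\mathrm{id}\otimes c)(c\otimes\mathrm{id})$. It is *rigid* if $M$ is finite-dimensional and the map $c^\flat:M^*\otimes M\to M\otimes M^*$, $c^\flat(\varphi\otimes m)=\sum_i(\varphi\otimes\mathrm{id})c(m\otimes m_i)\otimes m^i$ (with $(m_i)$, $(m^i)$ dual bases of $M$ and $M^*$), is bijective. $c$ is *right triangular* if $M$ has a finite totally ordered basis $X$ such that for all $x,y\in X$ $$c(x\otimes y)=\beta_{x,y}\,y\otimes x+\sum_{z>x}w_{x,y,z}\otimes z\qquad\text{with }\beta_{x,y}\in k\setminus\{0\},\ w_{x,y,z}\in M .$$ **Yetter–Drinfeld modules.** A Yetter–Drinfeld module over a bialgebra $H$ is a left $H$-module and left $H$-comodule $M$ with $(h_{(1)}m)_{(-1)}h_{(2)}\otimes(h_{(1)}m)_{(0)}=h_{(1)}m_{(-1)}\otimes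 h_{(2)}m_{(0)}$ for all $h\in H$, $m\in M$; its induced braiding is $m\otimes n\mapsto m_{(-1)}n\otimes m_{(0)}$. **FRT Hopf algebras.** A coquasitriangular structure on a bialgebra $H$ is a convolution invertible form $r\in(H\otimes H)^*$ with $\nabla^{op}=r\star\nabla\star r^{-1}$ ($\nabla$ the multiplication), $r(ab\otimes c)=r(a\otimes c_{(1)})r(b\otimes c_{(2)})$ and $r(a\otimes bc)=r(a_{(2)}\otimes b)r(a_{(1)}\otimes c)$. A left $H$-comodule $M$ then carries the $H$-action $h\cdot m=r(m_{(-1)}\otimes h)m_{(0)}$ and the braiding $m\otimes n\mapsto r(n_{(-1)}\otimes m_{(-1)})\,n_{(0)}\otimes m_{(0)}$. The FRT Hopf algebra $H(c)$ of a rigid $(M,c)$ is a coquasitriangular Hopf algebra with a left coaction on $M$ inducing the braiding $c$, such that for every Hopf algebra $H$ having $M$ as a Yetter–Drinfeld module with induced braiding $c$ there is a unique Hopf algebra map $\psi:H(c)\to H$ with $\delta_H=(\psi\otimes\mathrm{id}_M)\delta_{H(c)}$ and $u\cdot m=\psi(u)\cdot m$ for all $u\in H(c)$, $m\in M$; this determines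 $H(c)$ up to isomorphism. Its right radical is $J=\{h\in H(c)\mid r(H(c)\otimes h)=0\}$, and $H^{red}(c):=H(c)/J$ is the reduced FRT Hopf algebra. Since $J$ annihilates $M$, $H^{red}(c)$ acts on $M$. **Pointedness.** A coalgebra is pointed if its simple subcoalgebras are one-dimensional; its coradical is the sum of its simple subcoalgebras. A pointed Hopf algebra has abelian coradical if the elements of its coradical commute with each other. $G(H)$ is the group of grouplike elements of $H$; it acts diagonally on $M$ if $M=\bigoplus_\chi\{m\in M\mid gm=\chi(g)m\ \forall g\in G(H)\}$, the sum running over the characters $\chi:G(H)\to k$ (multiplicative monoid homomorphisms). **Theorem.** Let $(M,c)$ be a rigid braided vector space. Then $H(c)$ exists, its right radical $J$ is a Hopf ideal (so that $H^{red}(c)$ is a Hopf algebra), and the following are equivalent: 1. $c$ is right triangular. 2. $H^{red}(c)$ is pointed with abelian coradical, and $G(H^{red}(c))$ acts diagonally on $M$. 3. There is a pointed Hopf algebra $H$ with abelian coradical having $M$ as a Yetter–Drinfeld module such that the induced braiding is $c$ and $G(H)$ acts diagonally on $M$. -/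

import Mathlib

open scoped TensorProduct

universe u v w

namespace BraidedHopf

noncomputable section

open TensorProduct Coalgebra Module

/-! ### Braided vector spaces -/

section Braided

variable {k : Type u} [Field k] {M : Type v} [AddCommGroup M] [Module k M]

/-- `c ⊗ id` on `M ⊗ M ⊗ M`. -/
def braidLeft (c : M ⊗[k] M ≃ₗ[k] M ⊗[k] M) :
    (M ⊗[k] M) ⊗[k] M →ₗ[k] (M ⊗[k] M) ⊗[k] M :=
  c.toLinearMap.rTensor M

/-- `id ⊗ c` on `M ⊗ M ⊗ M`. -/
def braidRight (c : M ⊗[k] M ≃ₗ[k] M ⊗[k] M) :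
    (M ⊗[k] M) ⊗[k] M →ₗ[k] (M ⊗[k] M) ⊗[k] M :=
  (TensorProduct.assoc k M M M).symm.toLinearMap ∘ₗ c.toLinearMap.lTensor M ∘ₗ
    (TensorProduct.assoc k M M M).toLinearMap

/-- The braid equation: `(M, c)` is a braided vector space. -/
def IsBraiding (c : M ⊗[k] M ≃ₗ[k] M ⊗[k] M) : Prop :=
  braidRight c ∘ₗ braidLeft c ∘ₗ braidRight c = braidLeft c ∘ₗ braidRight c ∘ₗ braidLeft c

/-- The map `c♭ = (ev ⊗ id)(id ⊗ c ⊗ id)(id ⊗ db) : M* ⊗ M → M ⊗ M*`. -/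
def cFlat [FiniteDimensional k M] (c : M ⊗[k] M ≃ₗ[k] M ⊗[k] M) :
    Dual k M ⊗[k] M →ₗ[k] M ⊗[k] Dual k M :=
  -- `M* ⊗ M → (M* ⊗ M) ⊗ k → (M* ⊗ M) ⊗ (M ⊗ M*) → (M* ⊗ (M ⊗ M)) ⊗ M*`
  -- `→ (M* ⊗ (M ⊗ M)) ⊗ M* → (M* ⊗ M) ⊗ (M ⊗ M*) → k ⊗ (M ⊗ M*) → M ⊗ M*`
  (TensorProduct.lid k (M ⊗[k] Dual k M)).toLinearMap ∘ₗ
    (contractLeft k M).rTensor (M ⊗[k] Dual k M) ∘ₗ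
    (tensorTensorTensorAssoc k (Dual k M) M M (Dual k M)).symm.toLinearMap ∘ₗ
    (c.toLinearMap.lTensor (Dual k M)).rTensor (Dual k M) ∘ₗ
    (tensorTensorTensorAssoc k (Dual k M) M M (Dual k M)).toLinearMap ∘ₗ
    (coevaluation k M).lTensor (Dual k M ⊗[k] M) ∘ₗ
    (TensorProduct.rid k (Dual k M ⊗[k] M)).symm.toLinearMap

/-- A finite-dimensional braided vector space is rigid if `c♭` is an isomorphism. -/
def IsRigid [FiniteDimensional k M] (c : M ⊗[k] M ≃ₗ[k] M ⊗[k] M) : Prop :=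
  Function.Bijective (cFlat c)

/-- `c` is right triangular: for some totally ordered finite basis `b` one has
`c (b x ⊗ b y) = β x y • (b y ⊗ b x) + ∑_{z > x} w x y z ⊗ b z` with all `β x y ≠ 0`. -/
def IsRightTriangular (c : M ⊗[k] M ≃ₗ[k] M ⊗[k] M) : Prop :=
  ∃ (n : ℕ) (b : Basis (Fin n) k M) (β : Fin n → Fin n → k) (w : Fin n → Fin n → Fin n → M),
    (∀ x y, β x y ≠ 0) ∧
    ∀ x y, c (b x ⊗ₜ[k] b y) =
      β x y • (b y ⊗ₜ[k] b x) + ∑ z ∈ Finset.Ioi x, w x y z ⊗ₜ[k] b z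

end Braided

/-! ### Pointed coalgebras, the coradical, diagonal actions -/

section Coradical

variable (k : Type u) [Field k]

section
variable {C : Type v} [AddCommGroup C] [Module k C] [Coalgebra k C]

/-- `D` is a subcoalgebra: `Δ(D) ⊆ D ⊗ D`. -/
def IsSubcoalgebra (D : Submodule k C) : Prop :=
  ∀ x ∈ D, comul (R := k) x ∈ LinearMap.range (TensorProduct.map D.subtype D.subtype)

/-- `D` is a simple subcoalgebra. -/
def IsSimpleSubcoalgebra (D : Submodule k C) : Prop :=
  IsSubcoalgebra k D ∧ D ≠ ⊥ ∧ ∀ E : Submodule k C, IsSubcoalgebra k E → E ≤ D → E = ⊥ ∨ E = D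

variable (C)

/-- A coalgebra is pointed if all its simple subcoalgebras are one-dimensional. -/
def IsPointed : Prop :=
  ∀ D : Submodule k C, IsSimpleSubcoalgebra k D → finrank k D = 1

/-- The coradical: the sum of all simple subcoalgebras. -/
def coradical : Submodule k C :=
  sSup {D : Submodule k C | IsSimpleSubcoalgebra k D}

end

/-- The elements of the coradical of the bialgebra `H` commute with each other. -/
def HasAbelianCoradical (H : Type v) [Ring H] [Bialgebra k H] : Prop :=
  ∀ x ∈ coradical k H, ∀ y ∈ coradical k H, x * y = y * x

variable {k} {M : Type v} [AddCommGroup M] [Module k M]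

/-- The simultaneous eigenspace `{m | ∀ g, g m = χ(g) m}`. -/
def simultaneousEigenspace {G : Type w} [Monoid G] (ρ : G →* Module.End k M) (χ : G →* k) :
    Submodule k M where
  carrier := {m | ∀ g, ρ g m = χ g • m}
  add_mem' ha hb g := by rw [map_add, ha g, hb g, smul_add]
  zero_mem' g := by rw [map_zero, smul_zero]
  smul_mem' a m hm g := by rw [map_smul, hm g, smul_comm]

open Classical in
/-- `G` acts diagonally on `M`: `M` is the direct sum of the simultaneous eigenspaces
belonging to the characters of `G`. -/
def ActsDiagonally {G : Type w} [Monoid G] (ρ : G →* Module.End k M) : Prop :=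
  DirectSum.IsInternal fun χ : G →* k => simultaneousEigenspace ρ χ

end Coradical

/-! ### Comodules and Yetter-Drinfeld modules -/

/-- A left comodule structure on the vector space `M` over the coalgebra `H`. -/
structure LeftComodule (k : Type u) [Field k] (H : Type w) [AddCommGroup H] [Module k H]
    [Coalgebra k H] (M : Type v) [AddCommGroup M] [Module k M] where
  /-- The coaction `δ(m) = m₍₋₁₎ ⊗ m₍₀₎`. -/
  coact : M →ₗ[k] H ⊗[k] M
  coassoc : (TensorProduct.assoc k H H M).toLinearMap ∘ₗ (comul (R := k)).rTensor M ∘ₗ coact =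
    coact.lTensor H ∘ₗ coact
  counit_coact : (TensorProduct.lid k M).toLinearMap ∘ₗ (counit (R := k)).rTensor M ∘ₗ coact =
    LinearMap.id

section Action

variable {k : Type u} [Field k] {H : Type w} [Ring H] {M : Type v} [AddCommGroup M] [Module k M]

/-- The map `H ⊗ M → M`, `h ⊗ m ↦ h m`. -/
def actMap [Algebra k H] (ρ : H →ₐ[k] Module.End k M) : H ⊗[k] M →ₗ[k] M :=
  TensorProduct.lift ρ.toLinearMap

/-- `h ⊗ m ↦ (h₍₁₎ m)₍₋₁₎ h₍₂₎ ⊗ (h₍₁₎ m)₍₀₎`. -/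
def ydLeft [Bialgebra k H] (ρ : H →ₐ[k] Module.End k M) (δ : M →ₗ[k] H ⊗[k] M) :
    H ⊗[k] M →ₗ[k] H ⊗[k] M :=
  -- `h₂ ⊗ ((h₁ m)₋₁ ⊗ (h₁ m)₀) ↦ (h₁ m)₋₁ h₂ ⊗ (h₁ m)₀`
  (LinearMap.mul' k H ∘ₗ (TensorProduct.comm k H H).toLinearMap).rTensor M ∘ₗ
    (TensorProduct.assoc k H H M).symm.toLinearMap ∘ₗ
    -- `h₂ ⊗ (h₁ ⊗ m) ↦ h₂ ⊗ δ (h₁ m)`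
    (δ ∘ₗ actMap ρ).lTensor H ∘ₗ
    -- `h ⊗ m ↦ h₂ ⊗ (h₁ ⊗ m)`
    (TensorProduct.assoc k H H M).toLinearMap ∘ₗ
    ((TensorProduct.comm k H H).toLinearMap ∘ₗ comul (R := k)).rTensor M

/-- `h ⊗ m ↦ h₍₁₎ m₍₋₁₎ ⊗ h₍₂₎ m₍₀₎`. -/
def ydRight [Bialgebra k H] (ρ : H →ₐ[k] Module.End k M) (δ : M →ₗ[k] H ⊗[k] M) :
    H ⊗[k] M →ₗ[k] H ⊗[k] M :=
  TensorProduct.map (LinearMap.mul' k H) (actMap ρ) ∘ₗ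
    (tensorTensorTensorComm k H H H M).toLinearMap ∘ₗ
    TensorProduct.map (comul (R := k)) δ

end Action

/-- A left-left Yetter-Drinfeld module structure on the vector space `M` over the
bialgebra `H`. -/
structure YetterDrinfeld (k : Type u) [Field k] (H : Type w) [Ring H] [Bialgebra k H]
    (M : Type v) [AddCommGroup M] [Module k M] extends LeftComodule k H M where
  /-- The action of `H` on `M`. -/
  act : H →ₐ[k] Module.End k M
  compat : ydLeft act coact = ydRight act coact

/-- The braiding `c(m ⊗ n) = m₍₋₁₎ n ⊗ m₍₀₎` of a Yetter-Drinfeld module. -/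
def YetterDrinfeld.braiding {k : Type u} [Field k] {H : Type w} [Ring H] [Bialgebra k H]
    {M : Type v} [AddCommGroup M] [Module k M] (V : YetterDrinfeld k H M) :
    M ⊗[k] M →ₗ[k] M ⊗[k] M :=
  (actMap V.act).rTensor M ∘ₗ (TensorProduct.rightComm k H M M).toLinearMap ∘ₗ V.coact.rTensor M

/-! ### Coquasitriangular bialgebras and the right radical -/

section Coquasitriangular

variable {k : Type u} [Field k] {H : Type w} [Ring H] [Bialgebra k H]

/-- The linear form `r ∈ (H ⊗ H)*` viewed as an `H`-valued map, so that convolution products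
with the multiplication `∇ : H ⊗ H → H` make sense. -/
def formToHom (r : H ⊗[k] H →ₗ[k] k) : H ⊗[k] H →ₗ[k] H :=
  Algebra.linearMap k H ∘ₗ r

/-- `r` is a coquasitriangular structure on the bialgebra `H`. -/
structure IsCoquasitriangular (r : H ⊗[k] H →ₗ[k] k) : Prop where
  /-- `r` is convolution invertible and `∇ᵒᵖ = r ⋆ ∇ ⋆ r⁻¹`. -/
  exists_inv : ∃ s : H ⊗[k] H →ₗ[k] k,
    WithConv.toConv r * WithConv.toConv s = 1 ∧ WithConv.toConv s * WithConv.toConv r = 1 ∧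
    WithConv.toConv (LinearMap.mul' k H ∘ₗ (TensorProduct.comm k H H).toLinearMap) =
      WithConv.toConv (formToHom r) * WithConv.toConv (LinearMap.mul' k H) *
        WithConv.toConv (formToHom s)
  /-- `r(ab ⊗ c) = r(a ⊗ c₍₁₎) r(b ⊗ c₍₂₎)`. -/
  mul_left : ∀ a b c : H, r ((a * b) ⊗ₜ[k] c) =
    LinearMap.mul' k k (TensorProduct.map (curry r a) (curry r b) (comul c))
  /-- `r(a ⊗ bc) = r(a₍₁₎ ⊗ c) r(a₍₂₎ ⊗ b)`. -/
  mul_right : ∀ a b c : H, r (a ⊗ₜ[k] (b * c)) =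
    LinearMap.mul' k k
      (TensorProduct.map ((curry r).flip c) ((curry r).flip b) (comul a))

/-- `r(a ⊗ 1) = ε(a)`. -/
lemma IsCoquasitriangular.apply_one_right {r : H ⊗[k] H →ₗ[k] k} (hr : IsCoquasitriangular r) :
    (curry r).flip 1 = counit (R := k) (A := H) := by
  obtain ⟨s, hs, -, -⟩ := hr.exists_inv
  have h1 : WithConv.toConv ((curry r).flip 1) * WithConv.toConv ((curry r).flip 1) =
      WithConv.toConv ((curry r).flip 1) := by
    ext a
    have := hr.mul_right a 1 1
    rw [mul_one] at this
    simpa using! this.symm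
  have h2 : WithConv.toConv ((curry r).flip 1) * WithConv.toConv ((curry s).flip 1) = 1 := by
    ext a
    have := congr(($hs) (a ⊗ₜ[k] (1 : H)))
    rw [((ℛ k a).tmul (Coalgebra.Repr.mk {()} (fun _ => (1 : H)) (fun _ => 1)
      (by simp [Algebra.TensorProduct.one_def]))).convMul_apply] at this
    rw [(ℛ k a).convMul_apply]
    simpa using! this
  have h3 := congr($h1 * WithConv.toConv ((curry s).flip 1))
  rw [mul_assoc, h2, mul_one] at h3
  ext a
  simpa using! congr($h3 a)

/-- `r(1 ⊗ a) = ε(a)`. -/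
lemma IsCoquasitriangular.apply_one_left {r : H ⊗[k] H →ₗ[k] k} (hr : IsCoquasitriangular r) :
    curry r 1 = counit (R := k) (A := H) := by
  obtain ⟨s, hs, -, -⟩ := hr.exists_inv
  have h1 : WithConv.toConv (curry r 1) * WithConv.toConv (curry r 1) =
      WithConv.toConv (curry r 1) := by
    ext a
    have := hr.mul_left 1 1 a
    rw [mul_one] at this
    simpa using! this.symm
  have h2 : WithConv.toConv (curry r 1) * WithConv.toConv (curry s 1) = 1 := by
    ext a
    have := congr(($hs) ((1 : H) ⊗ₜ[k] a))
    rw [((Coalgebra.Repr.mk {()} (fun _ => (1 : H)) (fun _ => 1)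
      (by simp [Algebra.TensorProduct.one_def])).tmul (ℛ k a)).convMul_apply] at this
    rw [(ℛ k a).convMul_apply]
    simpa using! this
  have h3 := congr($h1 * WithConv.toConv (curry s 1))
  rw [mul_assoc, h2, mul_one] at h3
  ext a
  simpa using! congr($h3 a)

/-- The right radical `J = {h ∈ H | r(H ⊗ h) = 0}`, as an ideal of `H`. -/
def rightRadical {r : H ⊗[k] H →ₗ[k] k} (hr : IsCoquasitriangular r) : Ideal H where
  carrier := {h | ∀ a : H, r (a ⊗ₜ[k] h) = 0}
  add_mem' ha hb x := by rw [tmul_add, map_add, ha x, hb x, add_zero]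
  zero_mem' x := by rw [tmul_zero, map_zero]
  smul_mem' b h hh a := by
    have h0 : (curry r).flip h = 0 := LinearMap.ext hh
    rw [smul_eq_mul, hr.mul_right, h0, TensorProduct.map_zero_left]
    simp

lemma mem_rightRadical {r : H ⊗[k] H →ₗ[k] k} (hr : IsCoquasitriangular r) {h : H} :
    h ∈ rightRadical hr ↔ ∀ a : H, r (a ⊗ₜ[k] h) = 0 := Iff.rfl

instance rightRadical_isTwoSided {r : H ⊗[k] H →ₗ[k] k} (hr : IsCoquasitriangular r) :
    (rightRadical hr).IsTwoSided where
  mul_mem_of_left b hh a := by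
    have h0 : (curry r).flip _ = 0 := LinearMap.ext hh
    rw [hr.mul_right, h0, TensorProduct.map_zero_right]
    simp

/-- If a family of linear forms `f` separates the points of `Q`, then the forms
`f a ⊗ f b` separate the points of `Q ⊗ Q`. -/
lemma eq_zero_of_forall_map_eq_zero {ι Q : Type*} [AddCommGroup Q] [Module k Q]
    (f : ι → Q →ₗ[k] k) (hf : ∀ q, (∀ a, f a q = 0) → q = 0) (z : Q ⊗[k] Q)
    (hz : ∀ a b, LinearMap.mul' k k (TensorProduct.map (f a) (f b) z) = 0) : z = 0 := by
  classical
  let B := Basis.ofVectorSpace k Q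
  obtain ⟨m, rfl⟩ := (TensorProduct.equivFinsuppOfBasisLeft (N := Q) B).symm.surjective z
  have key : ∀ b i, f b (m i) = 0 := by
    intro b
    have h0 : (m.sum fun i q => f b q • B i) = 0 := by
      apply hf
      intro a
      have := hz a b
      rw [TensorProduct.equivFinsuppOfBasisLeft_symm_apply] at this
      simpa [Finsupp.sum, map_sum, mul_comm] using this
    intro i
    have h1 := congr(B.repr $h0 i)
    simp only [Finsupp.sum, map_sum, map_smul, Basis.repr_self, Finsupp.coe_finsetSum,
      Finset.sum_apply, Finsupp.smul_apply, Finsupp.single_apply, smul_eq_mul, map_zero,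
      Finsupp.coe_zero, Pi.zero_apply] at h1
    by_cases hi : i ∈ m.support
    · rw [Finset.sum_eq_single i (fun j _ hj => by simp [hj]) (fun h => absurd hi h)] at h1
      simpa using h1
    · rw [Finsupp.notMem_support_iff.mp hi, map_zero]
  have : m = 0 := Finsupp.ext fun i => hf _ fun b => key b i
  rw [this, map_zero]

instance rightRadical_isCoideal {r : H ⊗[k] H →ₗ[k] k} (hr : IsCoquasitriangular r) :
    ((rightRadical hr).restrictScalars k).IsCoideal where
  counit_eq_zero h hh := by
    rw [← hr.apply_one_left]
    exact hh 1
  map_mkQ_comul_eq_zero h hh := by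
    set J := (rightRadical hr).restrictScalars k with hJ
    let f : H → (H ⧸ J) →ₗ[k] k := fun a => J.liftQ (curry r a) fun x hx => hx a
    refine eq_zero_of_forall_map_eq_zero f ?_ _ ?_
    · intro q hq
      obtain ⟨x, rfl⟩ := J.mkQ_surjective q
      exact (Submodule.Quotient.mk_eq_zero J).mpr fun a => by simpa using! hq a
    · intro a b
      rw [← LinearMap.comp_apply (TensorProduct.map _ _), ← TensorProduct.map_comp]
      have := hh (a * b)
      rw [hr.mul_left] at this
      have hf : ∀ a, f a ∘ₗ J.mkQ = curry r a := fun a => Submodule.liftQ_mkQ _ _ _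
      rw [hf, hf]
      exact this

/-- The reduced bialgebra `H^red = H / J`, where `J` is the right radical. -/
abbrev Reduced {r : H ⊗[k] H →ₗ[k] k} (hr : IsCoquasitriangular r) : Type w :=
  H ⧸ rightRadical hr

variable {M : Type v} [AddCommGroup M] [Module k M]

/-- The braiding `c(m ⊗ n) = r(n₍₋₁₎ ⊗ m₍₋₁₎) n₍₀₎ ⊗ m₍₀₎` of a comodule over a
coquasitriangular bialgebra. -/
def formBraiding (r : H ⊗[k] H →ₗ[k] k) (δ : M →ₗ[k] H ⊗[k] M) : M ⊗[k] M →ₗ[k] M ⊗[k] M :=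
  (TensorProduct.lid k (M ⊗[k] M)).toLinearMap ∘ₗ
    TensorProduct.map (r ∘ₗ (TensorProduct.comm k H H).toLinearMap)
      (TensorProduct.comm k M M).toLinearMap ∘ₗ
    (tensorTensorTensorComm k H M H M).toLinearMap ∘ₗ
    TensorProduct.map δ δ

/-- The operator `m ↦ f(m₍₋₁₎) m₍₀₎` on a comodule, for a linear form `f`. -/
def evalCoact (δ : M →ₗ[k] H ⊗[k] M) (f : H →ₗ[k] k) : M →ₗ[k] M :=
  (TensorProduct.lid k M).toLinearMap ∘ₗ f.rTensor M ∘ₗ δ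

lemma evalCoact_comp (V : LeftComodule k H M) (f g : H →ₗ[k] k) :
    evalCoact V.coact f ∘ₗ evalCoact V.coact g =
      evalCoact V.coact (LinearMap.mul' k k ∘ₗ TensorProduct.map g f ∘ₗ comul) := by
  have h1 : evalCoact V.coact f ∘ₗ evalCoact V.coact g =
      (TensorProduct.lid k M).toLinearMap ∘ₗ
        TensorProduct.map g ((TensorProduct.lid k M).toLinearMap ∘ₗ f.rTensor M) ∘ₗ
        V.coact.lTensor H ∘ₗ V.coact := by
    have : V.coact ∘ₗ (TensorProduct.lid k M).toLinearMap =
        (TensorProduct.lid k (H ⊗[k] M)).toLinearMap ∘ₗ V.coact.lTensor k := by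
      ext; simp
    have h2 : evalCoact V.coact f ∘ₗ (TensorProduct.lid k M).toLinearMap ∘ₗ g.rTensor M =
        (TensorProduct.lid k M).toLinearMap ∘ₗ
        TensorProduct.map g ((TensorProduct.lid k M).toLinearMap ∘ₗ f.rTensor M) ∘ₗ
        V.coact.lTensor H := by
      ext a m; simp [evalCoact]
    exact LinearMap.ext fun m => congr($h2 (V.coact m))
  rw [h1, ← V.coassoc]
  have h3 : (TensorProduct.lid k M).toLinearMap ∘ₗ
        TensorProduct.map g ((TensorProduct.lid k M).toLinearMap ∘ₗ f.rTensor M) ∘ₗ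
        (TensorProduct.assoc k H H M).toLinearMap = (TensorProduct.lid k M).toLinearMap ∘ₗ
        (LinearMap.mul' k k ∘ₗ TensorProduct.map g f).rTensor M := by
    ext a b m; simp [mul_smul, smul_comm (f b) (g a) m]
  ext m
  have h4 := congr($h3 ((comul (R := k)).rTensor M (V.coact m)))
  have h5 : ((LinearMap.mul' k k ∘ₗ TensorProduct.map g f) ∘ₗ comul (R := k)).rTensor M =
      (LinearMap.mul' k k ∘ₗ TensorProduct.map g f).rTensor M ∘ₗ (comul (R := k)).rTensor M :=
    LinearMap.rTensor_comp _ _ _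
  change _ = (TensorProduct.lid k M).toLinearMap
    (((LinearMap.mul' k k ∘ₗ TensorProduct.map g f) ∘ₗ comul (R := k)).rTensor M (V.coact m))
  rw [h5]
  exact h4

/-- The action `h m = r(m₍₋₁₎ ⊗ h) m₍₀₎` of a coquasitriangular bialgebra `H` on a left
`H`-comodule. -/
def formAction {r : H ⊗[k] H →ₗ[k] k} (hr : IsCoquasitriangular r) (V : LeftComodule k H M) :
    H →ₐ[k] Module.End k M :=
  AlgHom.ofLinearMap
    { toFun := fun h => evalCoact V.coact ((curry r).flip h)
      map_add' := fun a b => by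
        simp [evalCoact, LinearMap.rTensor_add, LinearMap.add_comp, LinearMap.comp_add]
      map_smul' := fun a b => by
        simp [evalCoact, LinearMap.rTensor_smul, LinearMap.smul_comp, LinearMap.comp_smul] }
    (by
      change evalCoact V.coact ((curry r).flip 1) = _
      rw [hr.apply_one_right]
      exact V.counit_coact)
    (fun a b => by
      change evalCoact V.coact _ = evalCoact V.coact _ ∘ₗ evalCoact V.coact _
      rw [evalCoact_comp]
      congr 1
      ext x
      exact hr.mul_right x a b)

/-- The action of `H^red = H / J` on a left `H`-comodule, induced by the action of `H`. -/
def reducedAction {r : H ⊗[k] H →ₗ[k] k} (hr : IsCoquasitriangular r) (V : LeftComodule k H M) :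
    Reduced hr →ₐ[k] Module.End k M :=
  Ideal.Quotient.liftₐ (rightRadical hr) (formAction hr V) fun h hh => by
    have h0 : (curry r).flip h = 0 := LinearMap.ext hh
    change evalCoact V.coact ((curry r).flip h) = 0
    rw [h0]
    simp [evalCoact]

end Coquasitriangular

/-! ### The FRT Hopf algebra and its reduced version -/

/-- The FRT Hopf algebra `H(c)`: a coquasitriangular Hopf algebra with `M` as a left comodule
inducing the braiding `c`, which is universal among all Hopf algebras having `M` as a
Yetter-Drinfeld module with induced braiding `c`.  (Bialgebra homomorphisms between Hopf
algebras automatically respect the antipodes.) -/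
structure FRTHopfAlgebra {k : Type u} [Field k] {M : Type v} [AddCommGroup M] [Module k M]
    (c : M ⊗[k] M ≃ₗ[k] M ⊗[k] M) where
  carrier : Type (max u w)
  [ring : Ring carrier]
  [hopfAlgebra : HopfAlgebra k carrier]
  /-- The coquasitriangular structure. -/
  form : carrier ⊗[k] carrier →ₗ[k] k
  isCoquasitriangular : IsCoquasitriangular form
  comodule : LeftComodule k carrier M
  formBraiding_eq : formBraiding form comodule.coact = c.toLinearMap
  existsUnique_hom : ∀ (H : Type (max u w)) [Ring H] [HopfAlgebra k H]
    (V : YetterDrinfeld k H M), V.braiding = c.toLinearMap →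
    ∃! ψ : carrier →ₐc[k] H,
      V.coact = (ψ : carrier →ₗ[k] H).rTensor M ∘ₗ comodule.coact ∧
      ∀ (x : carrier) (m : M), formAction isCoquasitriangular comodule x m = V.act (ψ x) m

attribute [instance] FRTHopfAlgebra.ring FRTHopfAlgebra.hopfAlgebra

section Reduced

variable {k : Type u} [Field k] {M : Type v} [AddCommGroup M] [Module k M]
  {c : M ⊗[k] M ≃ₗ[k] M ⊗[k] M}

/-- The right radical `J` of `H(c)`. -/
abbrev FRTHopfAlgebra.radical (F : FRTHopfAlgebra.{u, v, w} c) : Ideal F.carrier :=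
  rightRadical F.isCoquasitriangular

/-- The reduced FRT Hopf algebra `H^red(c) = H(c) / J`. -/
abbrev FRTHopfAlgebra.Red (F : FRTHopfAlgebra.{u, v, w} c) : Type (max u w) :=
  Reduced F.isCoquasitriangular

/-- The action of `H^red(c)` on `M`. -/
abbrev FRTHopfAlgebra.redAction (F : FRTHopfAlgebra.{u, v, w} c) : F.Red →ₐ[k] Module.End k M :=
  reducedAction F.isCoquasitriangular F.comodule

end Reduced

/-- The action of the monoid (group, if `H` is a Hopf algebra) `G(H)` of grouplike elements
on an `H`-module. -/
def groupLikeAction {k : Type u} [Field k] {H : Type w} [Ring H] [Bialgebra k H]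
    {M : Type v} [AddCommGroup M] [Module k M] (ρ : H →ₐ[k] Module.End k M) :
    GroupLike k H →* Module.End k M :=
  (ρ : H →* Module.End k M).comp (GroupLike.valMonoidHom k H)

end
end BraidedHopf

open BraidedHopf

set_option linter.unusedSectionVars false

/-! Fix a basis of M, write δ(b_i) = ∑ T_ij ⊗ b_j, and let C_ip be the operator by which T_ip must
act, so that c(b_i ⊗ b_j) = ∑_p C_ip b_j ⊗ b_p. View C as a matrix with entries in End M.
Bijectivity of c♭ means that C has an inverse C' (the action of S(T)); bijectivity of c means that
the block transpose of C is invertible.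

Existence of H(c). The algebra `FRTAlg` is generated by two matrices t and u = S(t), mutually
inverse, with the FRT relation R(t ⊗ t) = (t ⊗ t)R, where R is the matrix of c. An antipode would in
general require generators for all S^n(t). Here two suffice, because S² is conjugation by the
Drinfeld operator G(m) = S(m₍₋₁₎)m₍₀₎, which rigidity makes invertible
(`exists_mul_drinfeldMat_eq_one`). The resulting relations between t, u and G hold in every Hopf
algebra having M as a Yetter-Drinfeld module with braiding c (`conj_drinfeldMat`,
`YetterDrinfeld.isFRTPair`), which gives universality. The form is built as an algebra map a ↦ r(a ⊗
-) into the convolution algebra, with r(t_ij ⊗ h) = ρ(h)_ji. Each axiom becomes an equality of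
algebra maps and is checked on generators, where it is the FRT relation or the braid equation. Any
other H(c) is a quotient of this model by universality.

The radical J is a Hopf ideal because r is invariant under S ⊗ S and S is surjective.

From pointed to triangular. Over a pointed Hopf algebra, M/N contains a one-dimensional subcomodule,
with some grouplike label g, for each proper subcomodule N (`LeftComodule.exists_isGroupLikeElem`).
The vectors with label g modulo N are stable under G(H), since the action of h changes the label to
hgh⁻¹ = g; so a joint eigenvector can be chosen among them. Iteration yields a basis in which the
coaction is triangular and grouplikes act diagonally, and c is then right triangular.

From triangular to pointed. Right triangularity gives r(H(c) ⊗ T_xz) = 0 for z < x, so T becomes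
triangular in H(c)/J (`coactMat_mem_radical`). Giving T_xz and S(T_xz) the weight z - x, one obtains
a filtration compatible with Δ, and every nonzero subcoalgebra contains a product of weight-zero
generators (`exists_mem_of_weightedGenerators`). These products are grouplike and act by diagonal
matrices. A grouplike of H(c)/J is determined by its action on M, because a ↦ r(a ⊗ g) is a
character fixed by its values on t. Hence grouplikes commute. Finally H(c)/J itself carries M as a
Yetter-Drinfeld module with braiding c. -/

namespace BraidedHopf

noncomputable section

open TensorProduct Coalgebra Module Matrix

/-! ### Matrices over noncommutative algebras -/

section MatrixLemmas

variable {ι : Type} [Fintype ι] {A : Type*} [Ring A]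

/-- The matrix `(i, j), (p, q) ↦ t i p * t j q`. -/
def kron (t : Matrix ι ι A) : Matrix (ι × ι) (ι × ι) A :=
  Matrix.of fun x y => t x.1 y.1 * t x.2 y.2

/-- The matrix `(i, j), (p, q) ↦ t j q * t i p`. -/
def kronRev (t : Matrix ι ι A) : Matrix (ι × ι) (ι × ι) A :=
  Matrix.of fun x y => t x.2 y.2 * t x.1 y.1

lemma kron_apply (t : Matrix ι ι A) (x y : ι × ι) : kron t x y = t x.1 y.1 * t x.2 y.2 := rfl

lemma kronRev_apply (t : Matrix ι ι A) (x y : ι × ι) : kronRev t x y = t x.2 y.2 * t x.1 y.1 := rfl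

lemma kron_mul_of_commute {t s : Matrix ι ι A} (h : ∀ i j p q, Commute (t i j) (s p q)) :
    kron (t * s) = kron t * kron s := by
  ext ⟨i, j⟩ ⟨p, q⟩
  simp only [kron_apply, Matrix.mul_apply, Finset.sum_mul_sum, Fintype.sum_prod_type]
  refine Finset.sum_congr rfl fun a _ => Finset.sum_congr rfl fun b _ => ?_
  rw [mul_assoc, ← mul_assoc (s a p), ← (h j b a p).eq, mul_assoc, mul_assoc]

lemma transpose_mul_of_commute {t s : Matrix ι ι A} (h : ∀ i j p q, Commute (t i j) (s p q)) :
    (t * s)ᵀ = sᵀ * tᵀ := by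
  ext i j
  simp only [Matrix.transpose_apply, Matrix.mul_apply]
  exact Finset.sum_congr rfl fun a _ => (h _ _ _ _).eq

lemma map_op_mul_map_op (X Y : Matrix ι ι A) :
    X.map MulOpposite.op * Y.map MulOpposite.op = ((Yᵀ * Xᵀ)ᵀ).map MulOpposite.op := by
  ext i j
  apply MulOpposite.unop_injective
  simp [Matrix.mul_apply, Finset.unop_sum]

variable [DecidableEq ι]

/-- Over a noncommutative ring the inverse of a Kronecker square needs its factors in reverse order,
so that the inner pair cancels before the outer one. -/
lemma kron_mul_kronRev {t u : Matrix ι ι A} (h : t * u = 1) : kron t * kronRev u = 1 := by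
  ext ⟨i, j⟩ ⟨p, q⟩
  have h1 : ∀ i j, ∑ a, t i a * u a j = (1 : Matrix ι ι A) i j := fun i j => by
    rw [← h, Matrix.mul_apply]
  simp only [kron_apply, kronRev_apply, Matrix.mul_apply, Fintype.sum_prod_type]
  calc ∑ a, ∑ b, t i a * t j b * (u b q * u a p)
      = ∑ a, t i a * (∑ b, t j b * u b q) * u a p := by
        refine Finset.sum_congr rfl fun a _ => ?_
        simp only [Finset.mul_sum, Finset.sum_mul, mul_assoc]
    _ = _ := by
        rw [h1]
        rcases eq_or_ne j q with rfl | hjq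
        · simp only [Matrix.one_apply_eq, mul_one, h1]
          simp [Matrix.one_apply]
        · simp [hjq]

lemma kronRev_mul_kron {t u : Matrix ι ι A} (h : u * t = 1) : kronRev u * kron t = 1 := by
  ext ⟨i, j⟩ ⟨p, q⟩
  have h1 : ∀ i j, ∑ a, u i a * t a j = (1 : Matrix ι ι A) i j := fun i j => by
    rw [← h, Matrix.mul_apply]
  simp only [kron_apply, kronRev_apply, Matrix.mul_apply, Fintype.sum_prod_type]
  rw [Finset.sum_comm]
  calc ∑ b, ∑ a, u j b * u i a * (t a p * t b q)
      = ∑ b, u j b * (∑ a, u i a * t a p) * t b q := by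
        refine Finset.sum_congr rfl fun a _ => ?_
        simp only [Finset.mul_sum, Finset.sum_mul, mul_assoc]
    _ = _ := by
        rw [h1]
        rcases eq_or_ne i p with rfl | hjq
        · simp only [Matrix.one_apply_eq, mul_one, h1]
          simp [Matrix.one_apply]
        · simp [hjq]

lemma commute_of_mul_eq_one {n : Type*} [Fintype n] [DecidableEq n] {X K L : Matrix n n A}
    (h1 : K * L = 1) (h2 : L * K = 1) (h : X * K = K * X) : X * L = L * X := by
  calc X * L = L * K * X * L := by rw [h2, one_mul]
    _ = L * (X * K) * L := by rw [h]; simp only [mul_assoc]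
    _ = L * X * (K * L) := by simp only [mul_assoc]
    _ = L * X := by rw [h1, mul_one]

variable {k : Type*} [Field k] [Algebra k A]

/-- The matrix over `A` with the entries of a matrix over `k`. -/
abbrev sc (A : Type*) [Ring A] [Algebra k A] {n m : Type*} (G : Matrix n m k) : Matrix n m A :=
  G.map (algebraMap k A)

lemma sc_mul {l n m : Type*} [Fintype n] (G : Matrix l n k) (H : Matrix n m k) :
    sc A (G * H) = sc A G * sc A H := Matrix.map_mul

lemma sc_one {n : Type*} [DecidableEq n] : sc A (1 : Matrix n n k) = 1 := by
  exact Matrix.map_one _ (map_zero _) (map_one _)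

lemma one_apply_algebraMap {n : Type*} [DecidableEq n] (i j : n) :
    (1 : Matrix n n A) i j = algebraMap k A ((1 : Matrix n n k) i j) := by
  exact congr($((sc_one (k := k) (A := A) (n := n)).symm) i j)

lemma one_apply_comm {n : Type*} [DecidableEq n] (i j : n) :
    (1 : Matrix n n A) i j = (1 : Matrix n n A) j i := by
  simp [Matrix.one_apply, eq_comm]

lemma sc_map {B : Type*} [Ring B] [Algebra k B] {n m : Type*} (G : Matrix n m k) (f : A →ₐ[k] B) :
    (sc A G).map f = sc B G := by ext; simp

lemma sc_mul_transpose {l n m : Type*} [Fintype n] (G : Matrix l n k) (X : Matrix n m A) :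
    (sc A G * X)ᵀ = Xᵀ * sc A Gᵀ := by
  ext i j
  simp [Matrix.mul_apply, Algebra.commutes]

lemma mul_sc_transpose {l n m : Type*} [Fintype n] (X : Matrix l n A) (G : Matrix n m k) :
    (X * sc A G)ᵀ = sc A Gᵀ * Xᵀ := by
  ext i j
  simp [Matrix.mul_apply, Algebra.commutes]

lemma sc_mul_map_op {l n m : Type*} [Fintype n] (G : Matrix l n k) (X : Matrix n m A) :
    sc Aᵐᵒᵖ G * X.map MulOpposite.op = (sc A G * X).map MulOpposite.op := by
  ext i j
  apply MulOpposite.unop_injective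
  simp [Matrix.mul_apply, Finset.unop_sum, Algebra.commutes]

lemma map_op_mul_sc {l n m : Type*} [Fintype n] (X : Matrix l n A) (G : Matrix n m k) :
    X.map MulOpposite.op * sc Aᵐᵒᵖ G = (X * sc A G).map MulOpposite.op := by
  ext i j
  apply MulOpposite.unop_injective
  simp [Matrix.mul_apply, Finset.unop_sum, Algebra.commutes]

end MatrixLemmas

/-! ### The defining relations of the FRT Hopf algebra -/

section Pairs

variable {ι : Type} [Fintype ι] [DecidableEq ι] {k : Type u} [Field k]

/-- The relations between the coefficient matrix `t` of the coaction and its antipode `u`: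
they are mutually inverse, the square of the antipode is conjugation by `G`, and `R` commutes
with the coefficient matrix of the tensor square. -/
structure IsFRTPair (R : Matrix (ι × ι) (ι × ι) k) (G G' : Matrix ι ι k)
    {A : Type*} [Ring A] [Algebra k A] (t u : Matrix ι ι A) : Prop where
  mul_eq : t * u = 1
  mul_eq' : u * t = 1
  conj : tᵀ * sc A G * uᵀ = sc A G
  conj' : uᵀ * sc A G' * tᵀ = sc A G'
  comm : sc A R * kron t = kron t * sc A R

variable {R : Matrix (ι × ι) (ι × ι) k} {G G' : Matrix ι ι k}
  {A : Type*} [Ring A] [Algebra k A] {B : Type*} [Ring B] [Algebra k B]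

lemma kron_map (t : Matrix ι ι A) (f : A →ₐ[k] B) : kron (t.map f) = (kron t).map f := by
  ext; simp [kron_apply]

lemma IsFRTPair.map {t u : Matrix ι ι A} (h : IsFRTPair R G G' t u) (f : A →ₐ[k] B) :
    IsFRTPair R G G' (t.map f) (u.map f) where
  mul_eq := by rw [← Matrix.map_mul, h.mul_eq, Matrix.map_one _ (map_zero f) (map_one f)]
  mul_eq' := by rw [← Matrix.map_mul, h.mul_eq', Matrix.map_one _ (map_zero f) (map_one f)]
  conj := by
    rw [← sc_map G f, ← Matrix.transpose_map, ← Matrix.transpose_map, ← Matrix.map_mul,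
      ← Matrix.map_mul, h.conj]
  conj' := by
    rw [← sc_map G' f, ← Matrix.transpose_map, ← Matrix.transpose_map, ← Matrix.map_mul,
      ← Matrix.map_mul, h.conj']
  comm := by
    rw [← sc_map R f, kron_map, ← Matrix.map_mul, ← Matrix.map_mul, h.comm]

lemma IsFRTPair.one : IsFRTPair R G G' (1 : Matrix ι ι A) 1 where
  mul_eq := by simp
  mul_eq' := by simp
  conj := by simp
  conj' := by simp
  comm := by
    have : kron (1 : Matrix ι ι A) = 1 := by
      ext ⟨i, j⟩ ⟨p, q⟩; simp [kron_apply, Matrix.one_apply, ← ite_and, and_comm]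
    rw [this, mul_one, one_mul]

/-- Applied to t ⊗ 1 and 1 ⊗ t this yields the comultiplication. The second component is v * u
because inversion reverses products. -/
lemma IsFRTPair.mul {t u s v : Matrix ι ι A} (h : IsFRTPair R G G' t u) (h' : IsFRTPair R G G' s v)
    (hts : ∀ i j p q, Commute (t i j) (s p q)) (huv : ∀ i j p q, Commute (u i j) (v p q)) :
    IsFRTPair R G G' (t * s) (v * u) where
  mul_eq := by
    rw [mul_assoc, ← mul_assoc s, h'.mul_eq, one_mul, h.mul_eq]
  mul_eq' := by
    rw [mul_assoc, ← mul_assoc u, h.mul_eq', one_mul, h'.mul_eq']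
  conj := by
    rw [transpose_mul_of_commute hts, transpose_mul_of_commute fun _ _ _ _ => (huv _ _ _ _).symm]
    calc _ = sᵀ * (tᵀ * sc A G * uᵀ) * vᵀ := by simp only [mul_assoc]
      _ = _ := by rw [h.conj, h'.conj]
  conj' := by
    rw [transpose_mul_of_commute hts, transpose_mul_of_commute fun _ _ _ _ => (huv _ _ _ _).symm]
    calc _ = uᵀ * (vᵀ * sc A G' * sᵀ) * tᵀ := by simp only [mul_assoc]
      _ = _ := by rw [h'.conj', h.conj']
  comm := by
    rw [kron_mul_of_commute hts, ← mul_assoc, h.comm, mul_assoc, h'.comm, mul_assoc]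

/-- This pair defines the antipode: t ↦ u and u ↦ (G' tᵀ G)ᵀ. Since S is antimultiplicative, S(u)ᵀ
has to be inverse to uᵀ, and the relations `conj` and `conj'` say that G' tᵀ G is this inverse. Thus
S²(t) is already expressed by t. -/
lemma IsFRTPair.op {t u : Matrix ι ι A} (h : IsFRTPair R G G' t u) (hG : G * G' = 1) :
    IsFRTPair R G G' (u.map MulOpposite.op)
      (((sc A G' * tᵀ * sc A G)ᵀ).map MulOpposite.op) := by
  have hG' : G' * G = 1 := mul_eq_one_comm.mp hG
  have e1 : sc A G * sc A G' = 1 := by rw [← sc_mul, hG, sc_one]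
  have e2 : sc A G' * sc A G = 1 := by rw [← sc_mul, hG', sc_one]
  have e3 : sc A G'ᵀ * sc A Gᵀ = 1 := by rw [← sc_mul, ← Matrix.transpose_mul, hG,
    Matrix.transpose_one, sc_one]
  have e4 : sc A Gᵀ * sc A G'ᵀ = 1 := by rw [← sc_mul, ← Matrix.transpose_mul, hG',
    Matrix.transpose_one, sc_one]
  have hs : (sc A G' * tᵀ * sc A G)ᵀ = sc A Gᵀ * t * sc A G'ᵀ := by
    rw [mul_sc_transpose, sc_mul_transpose, Matrix.transpose_transpose, mul_assoc]
  have one_op : ∀ X : Matrix ι ι A, X = 1 → X.map MulOpposite.op = 1 := by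
    rintro _ rfl; exact Matrix.map_one _ rfl rfl
  constructor
  · rw [map_op_mul_map_op]
    apply one_op
    rw [Matrix.transpose_transpose, mul_assoc, mul_assoc, ← mul_assoc tᵀ, h.conj, e2,
      Matrix.transpose_one]
  · rw [map_op_mul_map_op]
    apply one_op
    rw [Matrix.transpose_transpose, ← mul_assoc, ← mul_assoc, h.conj', e2, Matrix.transpose_one]
  · rw [← Matrix.transpose_map, ← Matrix.transpose_map, Matrix.transpose_transpose, map_op_mul_sc,
      map_op_mul_map_op, hs, mul_sc_transpose, Matrix.transpose_transpose]
    have : sc A Gᵀ * t * sc A G'ᵀ * (sc A Gᵀ * u) = sc A Gᵀ := by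
      rw [mul_assoc, ← mul_assoc _ _ u, e3, one_mul, mul_assoc, h.mul_eq, mul_one]
    rw [this]
    ext i j; rfl
  · rw [← Matrix.transpose_map, ← Matrix.transpose_map, Matrix.transpose_transpose, map_op_mul_sc,
      map_op_mul_map_op, Matrix.transpose_transpose, mul_sc_transpose, hs]
    have : u * (sc A G'ᵀ * (sc A Gᵀ * t * sc A G'ᵀ)) = sc A G'ᵀ := by
      rw [← mul_assoc (sc A G'ᵀ), ← mul_assoc (sc A G'ᵀ), e3, one_mul, ← mul_assoc, h.mul_eq',
        one_mul]
    rw [this]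
    ext i j; rfl
  · have hk : kron (u.map MulOpposite.op) = (kronRev u).map MulOpposite.op := by
      ext; simp [kron_apply, kronRev_apply]
    rw [hk, sc_mul_map_op, map_op_mul_sc,
      commute_of_mul_eq_one (kron_mul_kronRev h.mul_eq) (kronRev_mul_kron h.mul_eq') h.comm]

end Pairs

/-! ### The Hopf algebra defined by the relations -/

section FRTAlg

variable {ι : Type} [Fintype ι] [DecidableEq ι] {k : Type u} [Field k]

/-- The matrix of generators `t` (for `true`) or `u` (for `false`) of the free algebra. -/
def freeMat (ι : Type) (k : Type u) [Field k] (e : Bool) :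
    Matrix ι ι (FreeAlgebra k (ULift.{w} (Bool × ι × ι))) :=
  Matrix.of fun i j => FreeAlgebra.ι k (ULift.up (e, i, j))

/-- The relations imposed on the generators. -/
inductive FRTRel (R : Matrix (ι × ι) (ι × ι) k) (G G' : Matrix ι ι k) :
    FreeAlgebra k (ULift.{w} (Bool × ι × ι)) → FreeAlgebra k (ULift.{w} (Bool × ι × ι)) → Prop
  | mul_eq (i j : ι) : FRTRel R G G' ((freeMat ι k true * freeMat ι k false) i j)
      ((1 : Matrix ι ι _) i j)
  | mul_eq' (i j : ι) : FRTRel R G G' ((freeMat ι k false * freeMat ι k true) i j)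
      ((1 : Matrix ι ι _) i j)
  | conj (i j : ι) : FRTRel R G G'
      (((freeMat ι k true)ᵀ * sc (FreeAlgebra k (ULift.{w} (Bool × ι × ι))) G *
        (freeMat ι k false)ᵀ : Matrix ι ι _) i j) (sc _ G i j)
  | conj' (i j : ι) : FRTRel R G G'
      (((freeMat ι k false)ᵀ * sc (FreeAlgebra k (ULift.{w} (Bool × ι × ι))) G' *
        (freeMat ι k true)ᵀ : Matrix ι ι _) i j) (sc _ G' i j)
  | comm (x y : ι × ι) : FRTRel R G G'
      ((sc (FreeAlgebra k (ULift.{w} (Bool × ι × ι))) R * kron (freeMat ι k true) :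
        Matrix (ι × ι) (ι × ι) _) x y)
      ((kron (freeMat ι k true) * sc (FreeAlgebra k (ULift.{w} (Bool × ι × ι))) R :
        Matrix (ι × ι) (ι × ι) _) x y)

variable (R : Matrix (ι × ι) (ι × ι) k) (G G' : Matrix ι ι k)

/-- The universal algebra with a pair of matrices satisfying the FRT relations. -/
def FRTAlg : Type (max u w) := RingQuot (FRTRel.{u, w} R G G')

namespace FRTAlg

instance : Ring (FRTAlg.{u, w} R G G') := inferInstanceAs (Ring (RingQuot _))
instance : Algebra k (FRTAlg.{u, w} R G G') := inferInstanceAs (Algebra k (RingQuot _))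

/-- The quotient map from the free algebra. -/
def mk : FreeAlgebra k (ULift.{w} (Bool × ι × ι)) →ₐ[k] FRTAlg.{u, w} R G G' :=
  RingQuot.mkAlgHom k _

lemma mk_surjective : Function.Surjective (mk.{u, w} R G G') :=
  RingQuot.mkAlgHom_surjective k _

/-- The generating matrix `t`. -/
def t : Matrix ι ι (FRTAlg.{u, w} R G G') := (freeMat ι k true).map (mk R G G')

/-- The generating matrix `u`. -/
def u : Matrix ι ι (FRTAlg.{u, w} R G G') := (freeMat ι k false).map (mk R G G')

lemma mk_eq {x y : FreeAlgebra k (ULift.{w} (Bool × ι × ι))} (h : FRTRel R G G' x y) :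
    mk R G G' x = mk R G G' y := RingQuot.mkAlgHom_rel k h

lemma isFRTPair : IsFRTPair R G G' (t.{u, w} R G G') (u.{u, w} R G G') where
  mul_eq := by
    rw [t, u, ← Matrix.map_mul, ← Matrix.map_one _ (map_zero (mk R G G')) (map_one (mk R G G'))]
    ext i j; exact mk_eq _ _ _ (.mul_eq i j)
  mul_eq' := by
    rw [t, u, ← Matrix.map_mul, ← Matrix.map_one _ (map_zero (mk R G G')) (map_one (mk R G G'))]
    ext i j; exact mk_eq _ _ _ (.mul_eq' i j)
  conj := by
    rw [← sc_map G (mk R G G'), t, u, ← Matrix.transpose_map, ← Matrix.transpose_map,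
      ← Matrix.map_mul, ← Matrix.map_mul]
    ext i j; exact mk_eq _ _ _ (.conj i j)
  conj' := by
    rw [← sc_map G' (mk R G G'), t, u, ← Matrix.transpose_map, ← Matrix.transpose_map,
      ← Matrix.map_mul, ← Matrix.map_mul]
    ext i j; exact mk_eq _ _ _ (.conj' i j)
  comm := by
    rw [← sc_map R (mk R G G'), t, kron_map, ← Matrix.map_mul, ← Matrix.map_mul]
    ext i j; exact mk_eq _ _ _ (.comm i j)

variable {R G G'}
variable {A : Type*} [Ring A] [Algebra k A]

/-- The algebra map on the free algebra defined by two matrices. -/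
def liftFree (t u : Matrix ι ι A) : FreeAlgebra k (ULift.{w} (Bool × ι × ι)) →ₐ[k] A :=
  FreeAlgebra.lift k fun x => if x.down.1 then t x.down.2.1 x.down.2.2
      else u x.down.2.1 x.down.2.2

/-- The algebra map defined by a pair of matrices satisfying the FRT relations. -/
def lift {t u : Matrix ι ι A} (h : IsFRTPair R G G' t u) : FRTAlg.{u, w} R G G' →ₐ[k] A :=
  RingQuot.liftAlgHom k
    ⟨liftFree t u, by
    set f : FreeAlgebra k (ULift.{w} (Bool × ι × ι)) →ₐ[k] A := liftFree t u
    have ht : (freeMat ι k true).map f = t := by ext; simp [freeMat, f, liftFree]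
    have hu : (freeMat ι k false).map f = u := by ext; simp [freeMat, f, liftFree]
    have key : ∀ {n : Type} {X Y : Matrix n n (FreeAlgebra k (ULift.{w} (Bool × ι × ι)))},
        X.map f = Y.map f → ∀ i j, f (X i j) = f (Y i j) := fun h i j => congr($h i j)
    rintro x y (⟨i, j⟩ | ⟨i, j⟩ | ⟨i, j⟩ | ⟨i, j⟩ | ⟨i, j⟩) <;> refine key ?_ i j
    · rw [Matrix.map_mul, ht, hu, h.mul_eq, Matrix.map_one _ (map_zero f) (map_one f)]
    · rw [Matrix.map_mul, ht, hu, h.mul_eq', Matrix.map_one _ (map_zero f) (map_one f)]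
    · rw [Matrix.map_mul, Matrix.map_mul, Matrix.transpose_map, Matrix.transpose_map, ht, hu,
        sc_map, h.conj]
    · rw [Matrix.map_mul, Matrix.map_mul, Matrix.transpose_map, Matrix.transpose_map, ht, hu,
        sc_map, h.conj']
    · rw [Matrix.map_mul, Matrix.map_mul, ← kron_map, ht, sc_map, h.comm]⟩

lemma lift_t {t u : Matrix ι ι A} (h : IsFRTPair R G G' t u) :
    (FRTAlg.t.{u, w} R G G').map (lift h) = t := by
  ext i j
  change RingQuot.liftAlgHom k ⟨liftFree t u, _⟩ (RingQuot.mkAlgHom k _ _) = _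
  rw [RingQuot.liftAlgHom_mkAlgHom_apply]
  simp [freeMat, liftFree]

lemma lift_u {t u : Matrix ι ι A} (h : IsFRTPair R G G' t u) :
    (FRTAlg.u.{u, w} R G G').map (lift h) = u := by
  ext i j
  change RingQuot.liftAlgHom k ⟨liftFree t u, _⟩ (RingQuot.mkAlgHom k _ _) = _
  rw [RingQuot.liftAlgHom_mkAlgHom_apply]
  simp [freeMat, liftFree]

lemma lift_t_apply {t u : Matrix ι ι A} (h : IsFRTPair R G G' t u) (i j : ι) :
    lift h (FRTAlg.t.{u, w} R G G' i j) = t i j := congr($(lift_t h) i j)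

lemma lift_u_apply {t u : Matrix ι ι A} (h : IsFRTPair R G G' t u) (i j : ι) :
    lift h (FRTAlg.u.{u, w} R G G' i j) = u i j := congr($(lift_u h) i j)

/-- A subset closed under the algebra operations and containing the generators is everything. -/
lemma induction {p : FRTAlg.{u, w} R G G' → Prop} (ht : ∀ i j, p (t R G G' i j))
    (hu : ∀ i j, p (u R G G' i j)) (hc : ∀ c : k, p (algebraMap k _ c))
    (hadd : ∀ a b, p a → p b → p (a + b)) (hmul : ∀ a b, p a → p b → p (a * b))
    (a : FRTAlg.{u, w} R G G') : p a := by
  obtain ⟨x, rfl⟩ := mk_surjective R G G' a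
  induction x using FreeAlgebra.induction with
  | grade0 c => rw [AlgHom.commutes]; exact hc c
  | grade1 x =>
    obtain ⟨e, i, j⟩ := x
    cases e
    · exact hu i j
    · exact ht i j
  | mul a b ha hb => rw [map_mul]; exact hmul _ _ ha hb
  | add a b ha hb => rw [map_add]; exact hadd _ _ ha hb

/-- Algebra maps agreeing on `t` are equal. -/
lemma algHom_ext {f g : FRTAlg.{u, w} R G G' →ₐ[k] A}
    (h : ∀ i j, f (t R G G' i j) = g (t R G G' i j)) : f = g := by
  have ht : (t R G G').map f = (t R G G').map g := by ext; exact h _ _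
  -- The images of u are the inverses of the images of t, hence determined by them.
  have hu : (u R G G').map f = (u R G G').map g := by
    have hf := (isFRTPair R G G').map f
    have hg := (isFRTPair R G G').map g
    exact left_inv_eq_right_inv hf.mul_eq' (ht ▸ hg.mul_eq)
  ext a
  induction a using FRTAlg.induction with
  | ht i j => exact h i j
  | hu i j => exact congr($hu i j)
  | hc c => simp
  | hadd a b ha hb => simp [ha, hb]
  | hmul a b ha hb => simp [ha, hb]

/-- The comultiplication on generators. -/
def comulHom : FRTAlg.{u, w} R G G' →ₐ[k] FRTAlg.{u, w} R G G' ⊗[k] FRTAlg.{u, w} R G G' :=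
  lift (((isFRTPair R G G').map Algebra.TensorProduct.includeLeft).mul
    ((isFRTPair R G G').map Algebra.TensorProduct.includeRight)
    (fun i j p q => by simp [Commute, SemiconjBy]) (fun i j p q => by simp [Commute, SemiconjBy]))

lemma comulHom_t (i j : ι) : comulHom (t.{u, w} R G G' i j) =
    ∑ l, t R G G' i l ⊗ₜ[k] t R G G' l j := by
  rw [comulHom, lift_t_apply]
  simp [Matrix.mul_apply]

lemma comulHom_u (i j : ι) : comulHom (u.{u, w} R G G' i j) =
    ∑ l, u R G G' l j ⊗ₜ[k] u R G G' i l := by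
  rw [comulHom, lift_u_apply]
  simp [Matrix.mul_apply]

/-- The counit on generators. -/
def counitHom : FRTAlg.{u, w} R G G' →ₐ[k] k := lift IsFRTPair.one

lemma counitHom_t (i j : ι) : counitHom (t.{u, w} R G G' i j) = (1 : Matrix ι ι k) i j := by
  rw [counitHom, lift_t_apply]

lemma counitHom_u (i j : ι) : counitHom (u.{u, w} R G G' i j) = (1 : Matrix ι ι k) i j := by
  rw [counitHom, lift_u_apply]

/-- The coalgebra axioms are equalities of algebra maps, so it suffices to verify them on t. -/
instance : Bialgebra k (FRTAlg.{u, w} R G G') :=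
  Bialgebra.ofAlgHom comulHom counitHom
    (algHom_ext fun i j => by
      simp only [AlgHom.comp_apply, comulHom_t, map_sum, Algebra.TensorProduct.map_tmul,
        AlgHom.id_apply, sum_tmul, tmul_sum]
      rw [Finset.sum_comm]
      simp)
    (algHom_ext fun i j => by
      simp only [AlgHom.comp_apply, comulHom_t, map_sum, Algebra.TensorProduct.map_tmul,
        AlgHom.id_apply, counitHom_t]
      rw [Finset.sum_eq_single i (fun l _ hl => by simp [Ne.symm hl]) (by simp)]
      simp)
    (algHom_ext fun i j => by
      simp only [AlgHom.comp_apply, comulHom_t, map_sum, Algebra.TensorProduct.map_tmul,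
        AlgHom.id_apply, counitHom_t]
      rw [Finset.sum_eq_single j (fun l _ hl => by simp [hl]) (by simp)]
      simp)

lemma comul_t (i j : ι) : comul (R := k) (t.{u, w} R G G' i j) =
    ∑ l, t R G G' i l ⊗ₜ[k] t R G G' l j := comulHom_t i j

lemma comul_u (i j : ι) : comul (R := k) (u.{u, w} R G G' i j) =
    ∑ l, u R G G' l j ⊗ₜ[k] u R G G' i l := comulHom_u i j

lemma counit_t (i j : ι) : counit (R := k) (t.{u, w} R G G' i j) = (1 : Matrix ι ι k) i j :=
  counitHom_t i j

lemma counit_u (i j : ι) : counit (R := k) (u.{u, w} R G G' i j) = (1 : Matrix ι ι k) i j :=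
  counitHom_u i j

end FRTAlg
end FRTAlg

/-! ### Hopf algebras from antimultiplicative maps -/

section Antipode

variable {k : Type u} [Field k] {A : Type*} [Ring A] [Bialgebra k A]

/-- If `S` is antimultiplicative, then the set of all `a` with `S(a₍₁₎) a₍₂₎ = ε(a)` is closed
under products. -/
lemma antipode_left_mul (S : A →ₐ[k] Aᵐᵒᵖ) {a b : A}
    (ha : LinearMap.mul' k A (((MulOpposite.opLinearEquiv k).symm.toLinearMap ∘ₗ
      S.toLinearMap).rTensor A (comul a)) = algebraMap k A (counit a))
    (hb : LinearMap.mul' k A (((MulOpposite.opLinearEquiv k).symm.toLinearMap ∘ₗ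
      S.toLinearMap).rTensor A (comul b)) = algebraMap k A (counit b)) :
    LinearMap.mul' k A (((MulOpposite.opLinearEquiv k).symm.toLinearMap ∘ₗ
      S.toLinearMap).rTensor A (comul (a * b))) = algebraMap k A (counit (a * b)) := by
  have h2 := ha
  have h3 := hb
  rw [← (ℛ k a).eq] at h2
  rw [← (ℛ k b).eq] at h3
  simp only [map_sum, LinearMap.rTensor_tmul, LinearMap.mul'_apply, LinearMap.comp_apply,
    LinearEquiv.coe_coe, MulOpposite.coe_opLinearEquiv_symm, AlgHom.toLinearMap_apply] at h2 h3
  rw [Bialgebra.comul_mul, Bialgebra.counit_mul, ← (ℛ k a).eq, ← (ℛ k b).eq, Finset.sum_mul_sum]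
  simp only [map_sum, LinearMap.rTensor_tmul, LinearMap.mul'_apply, LinearMap.comp_apply,
    LinearEquiv.coe_coe, MulOpposite.coe_opLinearEquiv_symm, AlgHom.toLinearMap_apply,
    Algebra.TensorProduct.tmul_mul_tmul, map_mul, MulOpposite.unop_mul]
  rw [Finset.sum_comm, Algebra.commutes, ← h3, Finset.sum_mul]
  refine Finset.sum_congr rfl fun i _ => ?_
  rw [mul_assoc, ← Algebra.commutes, ← h2, Finset.sum_mul, Finset.mul_sum]
  simp only [mul_assoc]

lemma antipode_right_mul (S : A →ₐ[k] Aᵐᵒᵖ) {a b : A}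
    (ha : LinearMap.mul' k A (((MulOpposite.opLinearEquiv k).symm.toLinearMap ∘ₗ
      S.toLinearMap).lTensor A (comul a)) = algebraMap k A (counit a))
    (hb : LinearMap.mul' k A (((MulOpposite.opLinearEquiv k).symm.toLinearMap ∘ₗ
      S.toLinearMap).lTensor A (comul b)) = algebraMap k A (counit b)) :
    LinearMap.mul' k A (((MulOpposite.opLinearEquiv k).symm.toLinearMap ∘ₗ
      S.toLinearMap).lTensor A (comul (a * b))) = algebraMap k A (counit (a * b)) := by
  have h2 := ha
  have h3 := hb
  rw [← (ℛ k a).eq] at h2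
  rw [← (ℛ k b).eq] at h3
  simp only [map_sum, LinearMap.lTensor_tmul, LinearMap.mul'_apply, LinearMap.comp_apply,
    LinearEquiv.coe_coe, MulOpposite.coe_opLinearEquiv_symm, AlgHom.toLinearMap_apply] at h2 h3
  rw [Bialgebra.comul_mul, Bialgebra.counit_mul, ← (ℛ k a).eq, ← (ℛ k b).eq, Finset.sum_mul_sum]
  simp only [map_sum, LinearMap.lTensor_tmul, LinearMap.mul'_apply, LinearMap.comp_apply,
    LinearEquiv.coe_coe, MulOpposite.coe_opLinearEquiv_symm, AlgHom.toLinearMap_apply,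
    Algebra.TensorProduct.tmul_mul_tmul, map_mul, MulOpposite.unop_mul]
  rw [← h2, Finset.sum_mul]
  refine Finset.sum_congr rfl fun i _ => ?_
  rw [mul_assoc, ← Algebra.commutes, ← h3, Finset.sum_mul, Finset.mul_sum]
  simp only [mul_assoc]

end Antipode

/-! ### The antipode of the FRT algebra -/

namespace FRTAlg

variable {ι : Type} [Fintype ι] [DecidableEq ι] {k : Type u} [Field k]
  {R : Matrix (ι × ι) (ι × ι) k} {G G' : Matrix ι ι k}

/-- The antipode as an algebra map to the opposite algebra. -/
def antipodeHom (hG : G * G' = 1) : FRTAlg.{u, w} R G G' →ₐ[k] (FRTAlg.{u, w} R G G')ᵐᵒᵖ :=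
  lift ((isFRTPair R G G').op hG)

lemma antipodeHom_t (hG : G * G' = 1) (i j : ι) :
    (antipodeHom hG (t.{u, w} R G G' i j)).unop = u R G G' i j := by
  rw [antipodeHom, lift_t_apply]; rfl

lemma antipodeHom_u (hG : G * G' = 1) (i j : ι) :
    (antipodeHom hG (u.{u, w} R G G' i j)).unop =
      (sc _ G' * (t.{u, w} R G G')ᵀ * sc _ G : Matrix ι ι (FRTAlg.{u, w} R G G')) j i := by
  rw [antipodeHom, lift_u_apply]; rfl

/-- The Hopf algebra structure. -/
@[reducible] def hopfAlgebra (hG : G * G' = 1) : HopfAlgebra k (FRTAlg.{u, w} R G G') where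
  antipode := (MulOpposite.opLinearEquiv k).symm.toLinearMap ∘ₗ (antipodeHom hG).toLinearMap
  mul_antipode_rTensor_comul := by
    have hP := isFRTPair.{u, w} R G G'
    have e2 : sc (FRTAlg.{u, w} R G G') G' * sc _ G = 1 := by
      rw [← sc_mul, mul_eq_one_comm.mp hG, sc_one]
    refine LinearMap.ext fun a => ?_
    refine induction (p := fun a => LinearMap.mul' k _
      (((MulOpposite.opLinearEquiv k).symm.toLinearMap ∘ₗ (antipodeHom hG).toLinearMap).rTensor _
        (comul a)) = algebraMap k _ (counit a)) (fun i j => ?_) (fun i j => ?_) (fun c => ?_)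
      (fun a b ha hb => ?_) (fun a b ha hb => antipode_left_mul _ ha hb) a
    · simp only [LinearMap.comp_apply, comul_t, map_sum, LinearMap.rTensor_tmul,
        LinearMap.mul'_apply, LinearEquiv.coe_coe, MulOpposite.coe_opLinearEquiv_symm,
        AlgHom.toLinearMap_apply, antipodeHom_t, counit_t]
      rw [← Matrix.mul_apply, hP.mul_eq']
      exact one_apply_algebraMap i j
    · simp only [LinearMap.comp_apply, comul_u, map_sum, LinearMap.rTensor_tmul,
        LinearMap.mul'_apply, LinearEquiv.coe_coe, MulOpposite.coe_opLinearEquiv_symm,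
        AlgHom.toLinearMap_apply, antipodeHom_u, counit_u]
      -- On u the antipode axiom is the transposed relation `conj`; the other axiom uses `conj'` in
      -- the same way.
      have : (sc (FRTAlg.{u, w} R G G') G' * (t.{u, w} R G G')ᵀ * sc (FRTAlg.{u, w} R G G') G) * (u R G G')ᵀ = 1 := by
        rw [mul_assoc, mul_assoc, ← mul_assoc _ _ (u R G G')ᵀ, hP.conj, e2]
      have h2 := congr($this j i)
      rw [Matrix.mul_apply] at h2
      simp only [Matrix.transpose_apply] at h2
      exact h2.trans ((one_apply_comm j i).trans (one_apply_algebraMap i j))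
    · simp [Algebra.TensorProduct.one_def, Algebra.algebraMap_eq_smul_one]
    · simpa using congr($ha + $hb)
  mul_antipode_lTensor_comul := by
    have hP := isFRTPair.{u, w} R G G'
    have e2 : sc (FRTAlg.{u, w} R G G') G' * sc _ G = 1 := by
      rw [← sc_mul, mul_eq_one_comm.mp hG, sc_one]
    refine LinearMap.ext fun a => ?_
    refine induction (p := fun a => LinearMap.mul' k _
      (((MulOpposite.opLinearEquiv k).symm.toLinearMap ∘ₗ (antipodeHom hG).toLinearMap).lTensor _
        (comul a)) = algebraMap k _ (counit a)) (fun i j => ?_) (fun i j => ?_) (fun c => ?_)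
      (fun a b ha hb => ?_) (fun a b ha hb => antipode_right_mul _ ha hb) a
    · simp only [LinearMap.comp_apply, comul_t, map_sum, LinearMap.lTensor_tmul,
        LinearMap.mul'_apply, LinearEquiv.coe_coe, MulOpposite.coe_opLinearEquiv_symm,
        AlgHom.toLinearMap_apply, antipodeHom_t, counit_t]
      rw [← Matrix.mul_apply, hP.mul_eq]
      exact one_apply_algebraMap i j
    · simp only [LinearMap.comp_apply, comul_u, map_sum, LinearMap.lTensor_tmul,
        LinearMap.mul'_apply, LinearEquiv.coe_coe, MulOpposite.coe_opLinearEquiv_symm,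
        AlgHom.toLinearMap_apply, antipodeHom_u, counit_u]
      have : (u R G G')ᵀ * (sc (FRTAlg.{u, w} R G G') G' * (t.{u, w} R G G')ᵀ * sc (FRTAlg.{u, w} R G G') G) = 1 := by
        rw [← mul_assoc, ← mul_assoc, hP.conj', e2]
      have h2 := congr($this j i)
      rw [Matrix.mul_apply] at h2
      simp only [Matrix.transpose_apply] at h2
      exact h2.trans ((one_apply_comm j i).trans (one_apply_algebraMap i j))
    · simp [Algebra.TensorProduct.one_def, Algebra.algebraMap_eq_smul_one]
    · simpa using congr($ha + $hb)

end FRTAlg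

/-! ### The Drinfeld operator of a rigid braiding, in matrix form -/

section Drinfeld

variable {ι : Type} [Fintype ι] [DecidableEq ι] {k : Type u} [Field k]

/-- The matrix of the braiding whose coefficient matrix acts by `C`. -/
def braidMat (C : Matrix ι ι (Matrix ι ι k)) : Matrix (ι × ι) (ι × ι) k :=
  Matrix.of fun x y => C x.1 y.2 y.1 x.2

/-- The matrix of the operator `m ↦ S(m₍₋₁₎) m₍₀₎`, where the antipode of the coefficient matrix
acts by `C'`. -/
def drinfeldMat (C' : Matrix ι ι (Matrix ι ι k)) : Matrix ι ι k :=
  Matrix.of fun a x => ∑ f, C' x f a f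

/-- Extension of scalars for block matrices. -/
def scBlock (A : Type*) [Ring A] [Algebra k A] :
    Matrix ι ι (Matrix ι ι k) →+* Matrix ι ι (Matrix ι ι A) :=
  (algebraMap k A).mapMatrix.mapMatrix

variable {C C' : Matrix ι ι (Matrix ι ι k)} {A : Type*} [Ring A] [Algebra k A]

lemma scBlock_apply (i j p q : ι) : scBlock A C i j p q = algebraMap k A (C i j p q) := rfl

lemma sum_reorder {N : Type*} [AddCommMonoid N] (F : ι → ι → ι → ι → N) :
    ∑ a, ∑ q, ∑ p, ∑ y, F a q p y = ∑ p, ∑ y, ∑ q, ∑ a, F a q p y := by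
  calc _ = ∑ a, ∑ p, ∑ q, ∑ y, F a q p y := Finset.sum_congr rfl fun a _ => Finset.sum_comm
    _ = ∑ p, ∑ a, ∑ q, ∑ y, F a q p y := Finset.sum_comm
    _ = ∑ p, ∑ a, ∑ y, ∑ q, F a q p y := Finset.sum_congr rfl fun p _ =>
        Finset.sum_congr rfl fun a _ => Finset.sum_comm
    _ = ∑ p, ∑ y, ∑ a, ∑ q, F a q p y := Finset.sum_congr rfl fun p _ => Finset.sum_comm
    _ = _ := Finset.sum_congr rfl fun p _ => Finset.sum_congr rfl fun y _ => Finset.sum_comm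

lemma block_mul_apply (X Y : Matrix ι ι (Matrix ι ι A)) (i j a b : ι) :
    (X * Y) i j a b = ∑ l, ∑ p, X i l a p * Y l j p b := by
  simp [Matrix.mul_apply, Matrix.sum_apply]

/-- The FRT relation multiplied by u on both sides: one factor t cancels on each side, leaving a
mixed relation between t and u. -/
lemma braidMat_exchange {t u : Matrix ι ι A} (h1 : t * u = 1) (h2 : u * t = 1)
    (h : sc A (braidMat C) * kron t = kron t * sc A (braidMat C)) (f e a j : ι) :
    ∑ i, ∑ q, u f i * t q a * algebraMap k A (C i e q j) =
      ∑ b, ∑ p, algebraMap k A (C f b a p) * t j p * u b e := by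
  have h1' : ∀ i j, ∑ a, t i a * u a j = (1 : Matrix ι ι A) i j := fun i j => by
    rw [← h1, Matrix.mul_apply]
  have h2' : ∀ i j, ∑ a, u i a * t a j = (1 : Matrix ι ι A) i j := fun i j => by
    rw [← h2, Matrix.mul_apply]
  have key : ∀ i b, ∑ q, ∑ p, algebraMap k A (C i p q j) * (t q a * t p b) =
      ∑ q, ∑ p, t i q * t j p * algebraMap k A (C q b a p) := fun i b => by
    simpa [Matrix.mul_apply, Fintype.sum_prod_type, kron_apply, braidMat] using
      congr($h (i, j) (a, b))
  have e1 : ∀ i, ∑ b, (∑ q, ∑ p, algebraMap k A (C i p q j) * (t q a * t p b)) * u b e =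
      ∑ q, t q a * algebraMap k A (C i e q j) := fun i => by
    calc _ = ∑ q, ∑ p, algebraMap k A (C i p q j) * t q a * ∑ b, t p b * u b e := by
          simp only [Finset.sum_mul, Finset.mul_sum, mul_assoc]
          rw [Finset.sum_comm]
          exact Finset.sum_congr rfl fun q _ => Finset.sum_comm
      _ = _ := by simp [h1', Matrix.one_apply, Algebra.commutes]
  have e2 : ∑ i, u f i * ∑ b, (∑ q, ∑ p, t i q * t j p * algebraMap k A (C q b a p)) * u b e =
      ∑ b, ∑ p, algebraMap k A (C f b a p) * t j p * u b e := by
    calc _ = ∑ b, ∑ q, ∑ p, (∑ i, u f i * t i q) * (t j p * algebraMap k A (C q b a p) * u b e) := by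
          simp only [Finset.sum_mul, Finset.mul_sum, mul_assoc]
          rw [Finset.sum_comm]
          refine Finset.sum_congr rfl fun b _ => ?_
          rw [Finset.sum_comm]
          exact Finset.sum_congr rfl fun q _ => Finset.sum_comm
      _ = _ := by simp [h2', Matrix.one_apply, Algebra.commutes]
  rw [← e2]
  simp only [← key]
  simp only [e1, Finset.mul_sum, mul_assoc]

/-- The relation says that S² is conjugation by the Drinfeld operator, and it is a consequence of
the FRT relation. The mixed exchange relation reads U T C = C T U for block matrices U, T built from
u and tᵀ; multiplying by C' on both sides gives C' U T = T U C', and a partial trace of this is the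
claim. It is used both for the coefficients in a Hopf algebra and for t = C itself. -/
lemma conj_drinfeldMat (hC : C * C' = 1) (hC' : C' * C = 1) {t u : Matrix ι ι A} (h1 : t * u = 1)
    (h2 : u * t = 1) (h : sc A (braidMat C) * kron t = kron t * sc A (braidMat C)) :
    tᵀ * sc A (drinfeldMat C') * uᵀ = sc A (drinfeldMat C') := by
  set U : Matrix ι ι (Matrix ι ι A) := u.map fun x => Matrix.diagonal fun _ => x with hU
  set T : Matrix ι ι (Matrix ι ι A) := Matrix.diagonal fun _ => tᵀ with hT
  have hUe : ∀ f e a j, U f e a j = if a = j then u f e else 0 := fun f e a j => by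
    simp [hU, Matrix.diagonal_apply]
  have hTe : ∀ f e a j, T f e a j = if f = e then t j a else 0 := fun f e a j => by
    simp only [hT, Matrix.diagonal_apply]; split_ifs <;> simp
  have e1 : U * T * scBlock A C = scBlock A C * T * U := by
    ext f e a j
    simp only [block_mul_apply, hUe, hTe, scBlock_apply]
    simpa [Finset.sum_mul, Finset.mul_sum] using braidMat_exchange h1 h2 h f e a j
  have e2 : scBlock A C' * U * T = T * U * scBlock A C' := by
    have hA : scBlock A C * scBlock A C' = 1 := by rw [← map_mul, hC, map_one]
    have hA' : scBlock A C' * scBlock A C = 1 := by rw [← map_mul, hC', map_one]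
    calc _ = scBlock A C' * (U * T * scBlock A C) * scBlock A C' := by
          simp only [mul_assoc, hA, mul_one]
      _ = _ := by rw [e1]; simp only [← mul_assoc, hA', one_mul]
  have h1' : ∀ i j, ∑ a, u i a * t a j = (1 : Matrix ι ι A) i j := fun i j => by
    rw [← h2, Matrix.mul_apply]
  ext a x
  -- Contract the second block index with the second inner index. On the left, u t = 1 removes both
  -- generators and the trace of C' remains, which is G; on the right the same contraction produces
  -- tᵀ G uᵀ.
  have e3 : ∑ y, (scBlock A C' * U * T) x y a y = algebraMap k A (drinfeldMat C' a x) := by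
    calc _ = ∑ q, ∑ f, algebraMap k A (C' x f a q) * ∑ y, u f y * t y q := by
          simp only [block_mul_apply, hUe, hTe, scBlock_apply]
          simp only [mul_ite, ite_mul, mul_zero, zero_mul, Finset.sum_ite_eq, Finset.sum_ite_eq',
            Finset.mem_univ, if_true, Finset.sum_mul, Finset.mul_sum, mul_assoc]
          simp
          rw [Finset.sum_comm]
          exact Finset.sum_congr rfl fun q _ => Finset.sum_comm
      _ = _ := by simp [h1', Matrix.one_apply, drinfeldMat]
  have e4 : ∑ y, (T * U * scBlock A C') x y a y =
      (tᵀ * sc A (drinfeldMat C') * uᵀ) a x := by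
    simp only [block_mul_apply, hUe, hTe, scBlock_apply, Matrix.mul_apply, drinfeldMat,
      Matrix.map_apply, Matrix.of_apply, map_sum]
    simp only [Matrix.transpose_apply, mul_ite, ite_mul, mul_zero, zero_mul, Finset.sum_ite_eq,
      Finset.sum_ite_eq', Finset.mem_univ, if_true, Finset.sum_mul, Finset.mul_sum]
    rw [Finset.sum_comm]
    refine Finset.sum_congr rfl fun e _ => ?_
    rw [Finset.sum_comm]
    refine Finset.sum_congr rfl fun q _ => Finset.sum_congr rfl fun y _ => ?_
    rw [mul_assoc, mul_assoc, Algebra.commutes]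
  rw [← e4, ← e2, e3]
  rfl

/-- `S(h₍₂₎) u(h₍₁₎ m) = ε(h) u(m)` for the coefficients `h`. -/
lemma drinfeldMat_exchange (hC : C * C' = 1) (hC' : C' * C = 1)
    (h : sc (Matrix ι ι k) (braidMat C) * kron C = kron C * sc (Matrix ι ι k) (braidMat C)) :
    C'ᵀ * Matrix.diagonal (fun _ => drinfeldMat C') * Cᵀ =
      Matrix.diagonal (fun _ => drinfeldMat C') := by
  -- R also commutes with the inverse of the Kronecker square of C, which is the reversed Kronecker
  -- square of C'.
  have h' := commute_of_mul_eq_one (kron_mul_kronRev hC) (kronRev_mul_kron hC') h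
  have h2' : ∀ i j y z, ∑ a, ∑ p, C' i a y p * C a j p z =
      (1 : Matrix ι ι (Matrix ι ι k)) i j y z := fun i j y z => by
    rw [← hC', block_mul_apply]
  ext b i x j
  -- Tracing the tensor index a against the inner column index turns C' q a into a column of the
  -- Drinfeld matrix.
  have key : ∑ a, ∑ q, ∑ p, C i p q j * (C' p b * C' q a) x a =
      ∑ a, ∑ q, ∑ p, (C' j p * C' i q) x a * C q b a p := by
    refine Finset.sum_congr rfl fun a _ => ?_
    have h3 := congr($h' (i, j) (a, b))
    rw [Matrix.mul_apply, Matrix.mul_apply] at h3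
    have := congr($h3 x a)
    simpa [Fintype.sum_prod_type, kronRev_apply, braidMat, Matrix.sum_apply,
      Algebra.algebraMap_eq_smul_one, mul_comm] using this
  have e1 : ∑ a, ∑ q, ∑ p, (C' j p * C' i q) x a * C q b a p =
      ∑ p, ∑ y, C' j p x y * ∑ q, ∑ a, C' i q y a * C q b a p := by
    simp only [Matrix.mul_apply, Finset.sum_mul, Finset.mul_sum]
    rw [sum_reorder]
    simp only [mul_assoc]
  have e2 : ∑ a, ∑ q, ∑ p, C i p q j * (C' p b * C' q a) x a =
      (C'ᵀ * Matrix.diagonal (fun _ => drinfeldMat C') * Cᵀ : Matrix ι ι (Matrix ι ι k)) b i x j := by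
    rw [block_mul_apply]
    simp only [Matrix.mul_diagonal]
    simp only [Matrix.mul_apply, Finset.sum_mul, Finset.mul_sum, drinfeldMat, Matrix.of_apply,
      Matrix.transpose_apply]
    rw [sum_reorder]
    refine Finset.sum_congr rfl fun p _ => ?_
    rw [Finset.sum_comm]
    refine Finset.sum_congr rfl fun q _ => Finset.sum_congr rfl fun y _ =>
      Finset.sum_congr rfl fun a _ => by ring
  rw [← e2, key, e1]
  simp only [h2']
  have e3 : ∀ p y, (1 : Matrix ι ι (Matrix ι ι k)) i b y p =
      if i = b then if y = p then 1 else 0 else 0 := fun p y => by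
    rw [Matrix.one_apply]
    split_ifs <;> simp_all [Matrix.one_apply]
  have e4 : Matrix.diagonal (fun _ => drinfeldMat C') b i x j =
      if i = b then drinfeldMat C' x j else 0 := by
    rw [Matrix.diagonal_apply]
    simp only [eq_comm]
    split_ifs <;> simp
  simp only [e3, e4]
  split_ifs <;> simp [drinfeldMat]

/-- The evaluation of the coaction on the Drinfeld operator. -/
lemma sum_mul_drinfeldMat (hC : C * C' = 1) (j y : ι) :
    ∑ p, ∑ i, C j i y p * drinfeldMat C' p i = (1 : Matrix ι ι k) j y := by
  have h2' : ∀ i j y z, ∑ a, ∑ p, C i a y p * C' a j p z =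
      (1 : Matrix ι ι (Matrix ι ι k)) i j y z := fun i j y z => by
    rw [← hC, block_mul_apply]
  calc _ = ∑ f, ∑ a, ∑ p, C j a y p * C' a f p f := by
        simp only [drinfeldMat, Matrix.of_apply, Finset.mul_sum]
        rw [Finset.sum_comm, Finset.sum_comm_cycle]
    _ = ∑ f, if f = y then (1 : Matrix ι ι k) j f else 0 := by
        refine Finset.sum_congr rfl fun f _ => ?_
        rw [h2']
        rcases eq_or_ne f y with rfl | h2
        · rcases eq_or_ne j f with rfl | h1
          · simp
          · simp [Matrix.one_apply_ne h1]
        · rcases eq_or_ne j f with rfl | h1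
          · simp [h2, Matrix.one_apply_ne h2.symm]
          · simp [h2, Matrix.one_apply_ne h1]
    _ = _ := by simp

/-- The Drinfeld operator is invertible. -/
lemma exists_mul_drinfeldMat_eq_one {D : Matrix ι ι (Matrix ι ι k)} (hC : C * C' = 1)
    (hC' : C' * C = 1) (hD : D * Cᵀ = 1)
    (h : sc (Matrix ι ι k) (braidMat C) * kron C = kron C * sc (Matrix ι ι k) (braidMat C)) :
    ∃ G', drinfeldMat C' * G' = 1 := by
  set G := drinfeldMat C'
  have hL : sc (Matrix ι ι k) G * C'ᵀ = D * sc (Matrix ι ι k) G := by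
    conv_rhs => rw [← conj_drinfeldMat hC hC' hC hC' h]
    rw [← mul_assoc, ← mul_assoc, hD, one_mul]
  -- `Y` is ker G ⊗ End M. By `hL` it is stable under y ↦ y C', which is injective, so by finite
  -- dimension this map is onto `Y`. Hence `Y` is also stable under C.
  let Y : Submodule k (ι → Matrix ι ι k) :=
    { carrier := {y | ∀ p, ∑ i, G p i • y i = 0}
      add_mem' := fun ha hb p => by simp [smul_add, Finset.sum_add_distrib, ha p, hb p]
      zero_mem' := fun p => by simp
      smul_mem' := fun c y hy p => by
        simp only [Pi.smul_apply, smul_comm _ c, ← Finset.smul_sum, hy p, smul_zero] }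
  let f : (ι → Matrix ι ι k) →ₗ[k] (ι → Matrix ι ι k) := 
    { toFun := fun y => y ᵥ* C'
      map_add' := fun a b => Matrix.add_vecMul _ _ _
      map_smul' := fun c a => Matrix.smul_vecMul _ _ _ }
  have hf : Function.Injective f := fun a b hab => by
    have := congr($hab ᵥ* C)
    change (a ᵥ* C') ᵥ* C = (b ᵥ* C') ᵥ* C at this
    simpa [Matrix.vecMul_vecMul, hC'] using this
  have hY : ∀ y ∈ Y, f y ∈ Y := fun y hy p => by
    have e1 : ∀ i, ∑ j, G p j • C' i j = ∑ l, G l i • D p l := fun i => by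
      have := congr($hL p i)
      rw [Matrix.mul_apply, Matrix.mul_apply] at this
      simpa [Algebra.smul_def, Algebra.commutes] using this
    calc ∑ j, G p j • ∑ i, y i * C' i j = ∑ i, y i * ∑ j, G p j • C' i j := by
          simp only [Finset.smul_sum, Finset.mul_sum, mul_smul_comm]
          exact Finset.sum_comm
      _ = ∑ l, (∑ i, G l i • y i) * D p l := by
          simp only [e1, Finset.mul_sum, Finset.sum_mul, mul_smul_comm, smul_mul_assoc]
          exact Finset.sum_comm
      _ = 0 := by simp [hy _]
  have hsurj : Function.Surjective (f.restrict hY) := by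
    rw [← LinearMap.injective_iff_surjective]
    intro a b hab
    exact Subtype.ext (hf congr(($hab : ι → Matrix ι ι k)))
  have hinj : Function.Injective G.mulVec := by
    rw [← Matrix.coe_mulVecLin]
    refine (injective_iff_map_eq_zero _).mpr fun x hx => ?_
    have hxY : (fun i => x i • (1 : Matrix ι ι k)) ∈ Y := fun p => by
      simp only [smul_smul, ← Finset.sum_smul]
      have : ∑ i, G p i * x i = 0 := congr($hx p)
      rw [this, zero_smul]
    obtain ⟨⟨y, hy⟩, hyx⟩ := hsurj ⟨_, hxY⟩
    have hyx' : y ᵥ* C' = fun i => x i • (1 : Matrix ι ι k) := congr(($hyx : ι → Matrix ι ι k))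
    have hyC : y = (fun i => x i • (1 : Matrix ι ι k)) ᵥ* C := by
      rw [← hyx', Matrix.vecMul_vecMul, hC', Matrix.vecMul_one]
    ext z
    -- Evaluating the stability of `Y` under C at x in ker G. Summation over p then recovers x z, by
    -- the identity m₍₋₁₎ G(m₍₀₎) = m; so x = 0.
    have e2 : ∀ p, ∑ i, G p i * ∑ j, x j * C j i z p = 0 := fun p => by
      have := congr($(hy p) z p)
      simpa [hyC, Matrix.vecMul, dotProduct, Matrix.sum_apply] using this
    calc x z = ∑ j, x j * (1 : Matrix ι ι k) j z := by simp [Matrix.one_apply]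
      _ = ∑ p, ∑ i, G p i * ∑ j, x j * C j i z p := by
        simp only [← sum_mul_drinfeldMat hC, Finset.mul_sum]
        rw [Finset.sum_comm]
        refine Finset.sum_congr rfl fun p _ => ?_
        rw [Finset.sum_comm]
        refine Finset.sum_congr rfl fun q _ => Finset.sum_congr rfl fun y _ => ?_
        change x _ * (_ * G _ _) = _
        ring
      _ = 0 := by simp [e2]
  exact ⟨G⁻¹, Matrix.mul_nonsing_inv _
    ((Matrix.isUnit_iff_isUnit_det _).mp (Matrix.mulVec_injective_iff_isUnit.mp hinj))⟩

/-- The square of the antipode acts by conjugation with the Drinfeld operator. -/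
lemma drinfeldMat_mul_mul {D : Matrix ι ι (Matrix ι ι k)} {G' : Matrix ι ι k} (hC : C * C' = 1)
    (hC' : C' * C = 1) (hD : D * Cᵀ = 1) (hD' : Cᵀ * D = 1)
    (h : sc (Matrix ι ι k) (braidMat C) * kron C = kron C * sc (Matrix ι ι k) (braidMat C))
    (hG : drinfeldMat C' * G' = 1) (i j : ι) :
    (sc (Matrix ι ι k) G' * Cᵀ * sc (Matrix ι ι k) (drinfeldMat C')) j i =
      drinfeldMat C' * C i j * G' := by
  set G := drinfeldMat C'
  set E : Matrix ι ι (Matrix ι ι k) := Matrix.diagonal fun _ => G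
  set E' : Matrix ι ι (Matrix ι ι k) := Matrix.diagonal fun _ => G'
  have hE : E * E' = 1 := by
    simp only [E, E', Matrix.diagonal_mul_diagonal, hG]
    exact Matrix.diagonal_one
  have e1 : sc (Matrix ι ι k) G * C'ᵀ = D * sc (Matrix ι ι k) G := by
    conv_rhs => rw [← conj_drinfeldMat hC hC' hC hC' h]
    rw [← mul_assoc, ← mul_assoc, hD, one_mul]
  have e2 : C'ᵀ * E = E * D := by
    have := drinfeldMat_exchange hC hC' h
    rw [← mul_one (C'ᵀ * E), ← hD', ← mul_assoc, this]
  have e3 : sc (Matrix ι ι k) G * E = E * sc (Matrix ι ι k) G := by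
    ext i j : 2
    simp [E, Matrix.mul_diagonal, Matrix.diagonal_mul, Algebra.commutes]
  have hG'' : sc (Matrix ι ι k) G' * sc (Matrix ι ι k) G = 1 := by
    rw [← sc_mul, mul_eq_one_comm.mp hG, sc_one]
  -- In matrix form this says that G ⊗ G commutes with the braiding; cancelling one factor G against
  -- its inverse on each side gives the formula for the square of the antipode.
  have e4 : Cᵀ * (sc (Matrix ι ι k) G * E) = sc (Matrix ι ι k) G * E * Cᵀ := by
    have : sc (Matrix ι ι k) G * E * D = D * (sc (Matrix ι ι k) G * E) := by
      rw [mul_assoc, ← e2, ← mul_assoc, e1, mul_assoc]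
    exact (commute_of_mul_eq_one hD hD' this).symm
  have e5 : sc (Matrix ι ι k) G' * Cᵀ * sc (Matrix ι ι k) G = E * Cᵀ * E' := by
    calc _ = sc (Matrix ι ι k) G' * (Cᵀ * (sc (Matrix ι ι k) G * E)) * E' := by
          simp only [mul_assoc, hE, mul_one]
      _ = _ := by rw [e4]; simp only [← mul_assoc, hG'', one_mul]
  rw [e5]
  simp [E, E', Matrix.mul_diagonal, Matrix.diagonal_mul]

end Drinfeld

/-! ### The universal form -/

section Form

variable {ι : Type} [Fintype ι] [DecidableEq ι] {k : Type u} [Field k]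

/-- Matrices acting on the braided vector space which define a rigid braiding, together with its
Drinfeld operator `G`. -/
structure IsBraidSystem (C C' : Matrix ι ι (Matrix ι ι k)) (G G' : Matrix ι ι k) : Prop where
  pair : IsFRTPair (braidMat C) G G' C C'
  sq : ∀ i j, (sc (Matrix ι ι k) G' * Cᵀ * sc (Matrix ι ι k) G) j i = G * C i j * G'
  inv : G * G' = 1

namespace FRTAlg

instance {R : Matrix (ι × ι) (ι × ι) k} {G G' : Matrix ι ι k} [hG : Fact (G * G' = 1)] :
    HopfAlgebra k (FRTAlg.{u, w} R G G') := hopfAlgebra hG.out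

section
variable {R : Matrix (ι × ι) (ι × ι) k} {G G' : Matrix ι ι k} [hG : Fact (G * G' = 1)]

lemma antipode_t (i j : ι) : HopfAlgebra.antipode k (t.{u, w} R G G' i j) = u R G G' i j :=
  antipodeHom_t hG.out i j

lemma antipode_u (i j : ι) : HopfAlgebra.antipode k (u.{u, w} R G G' i j) =
    (sc (FRTAlg.{u, w} R G G') G' * (t.{u, w} R G G')ᵀ * sc (FRTAlg.{u, w} R G G') G) j i :=
  antipodeHom_u hG.out i j

end

variable {C C' : Matrix ι ι (Matrix ι ι k)} {G G' : Matrix ι ι k}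

/-- The representation by which the FRT algebra acts on the braided vector space. -/
def rep (hB : IsBraidSystem C C' G G') : FRTAlg.{u, w} (braidMat C) G G' →ₐ[k] Matrix ι ι k :=
  lift hB.pair

lemma rep_t (hB : IsBraidSystem C C' G G') (i j : ι) :
    rep.{u, w} hB (t (braidMat C) G G' i j) = C i j := lift_t_apply _ _ _

variable [hG : Fact (G * G' = 1)]

/-- Both sides are algebra maps in h, since S² is multiplicative; on t the identity is the field
`sq`. -/
lemma rep_antipode_antipode (hB : IsBraidSystem C C' G G')
    (h : FRTAlg.{u, w} (braidMat C) G G') :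
    rep hB (HopfAlgebra.antipode k (HopfAlgebra.antipode k h)) = G * rep hB h * G' := by
  have hG' : G' * G = 1 := mul_eq_one_comm.mp hB.inv
  let f : FRTAlg.{u, w} (braidMat C) G G' →ₐ[k] Matrix ι ι k := AlgHom.ofLinearMap
    ((rep hB).toLinearMap ∘ₗ HopfAlgebra.antipode k ∘ₗ HopfAlgebra.antipode k)
    (by simp) (fun a b => by simp [HopfAlgebra.antipode_mul_antidistrib])
  let g : FRTAlg.{u, w} (braidMat C) G G' →ₐ[k] Matrix ι ι k := AlgHom.ofLinearMap
    (LinearMap.mulLeft k G ∘ₗ LinearMap.mulRight k G' ∘ₗ (rep hB).toLinearMap)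
    (by simp [hB.inv]) (fun a b => by
      simp only [LinearMap.comp_apply, LinearMap.mulRight_apply, LinearMap.mulLeft_apply,
        AlgHom.toLinearMap_apply, map_mul]
      simp only [mul_assoc]
      rw [← mul_assoc G' G, hG', one_mul])
  have : f = g := algHom_ext fun i j => by
    change rep hB (HopfAlgebra.antipode k (HopfAlgebra.antipode k _)) = G * (rep hB _ * G')
    rw [antipode_t, antipode_u, rep_t, ← mul_assoc, ← hB.sq]
    have e1 : ((sc (FRTAlg.{u, w} (braidMat C) G G') G' * (t.{u, w} (braidMat C) G G')ᵀ *
        sc (FRTAlg.{u, w} (braidMat C) G G') G)).map (rep hB) =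
        sc (Matrix ι ι k) G' * Cᵀ * sc (Matrix ι ι k) G := by
      rw [Matrix.map_mul, Matrix.map_mul, sc_map, sc_map, Matrix.transpose_map]
      have : (t.{u, w} (braidMat C) G G').map (rep hB) = C := Matrix.ext fun i j => rep_t hB i j
      rw [this]
    exact congr($e1 j i)
  have := congr($this h)
  exact this.trans (mul_assoc _ _ _).symm

/-- The operators by which the antipode acts through the second leg of the form. -/
def repDual (hB : IsBraidSystem C C' G G') :
    FRTAlg.{u, w} (braidMat C) G G' →ₗ[k] Matrix ι ι k :=
  LinearMap.mulLeft k G' ∘ₗ LinearMap.mulRight k G ∘ₗ (rep hB).toLinearMap ∘ₗ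
    HopfAlgebra.antipode k

lemma repDual_apply (hB : IsBraidSystem C C' G G') (h : FRTAlg.{u, w} (braidMat C) G G') :
    repDual hB h = G' * (rep hB (HopfAlgebra.antipode k h) * G) := rfl

section Convolution

variable (hB : IsBraidSystem C C' G G') (h : FRTAlg.{u, w} (braidMat C) G G')

/-- Because ρ(S²h) = G ρ(h) G', the map `repDual` plays the role of ρ ∘ S⁻¹ without S having to be
inverted. This identity and the next three are the antipode axioms rewritten in terms of it; the
last two arise by applying ρ ∘ S to those axioms. They become the first four relations in
`isFRTPair_dual`. -/
lemma sum_rep_mul_repDual : ∑ i ∈ (ℛ k h).index, rep hB ((ℛ k h).left i) *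
    (G * repDual hB ((ℛ k h).right i)) = counit (R := k) h • G := by
  have e1 := congrArg (fun x => rep hB x * G) (HopfAlgebra.sum_mul_antipode_eq_smul (ℛ k h))
  simp only [map_sum, map_mul, map_smul, map_one, Finset.sum_mul, smul_mul_assoc, one_mul] at e1
  rw [← e1]
  refine Finset.sum_congr rfl fun i _ => ?_
  rw [repDual_apply, ← mul_assoc G G', hB.inv, one_mul, mul_assoc]

lemma sum_repDual_mul_rep : ∑ i ∈ (ℛ k h).index, repDual hB ((ℛ k h).left i) *
    (G' * rep hB ((ℛ k h).right i)) = counit (R := k) h • G' := by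
  have e1 := congr(G' * rep hB $(HopfAlgebra.sum_antipode_mul_eq_smul (ℛ k h)))
  simp only [map_sum, map_mul, map_smul, map_one, Finset.mul_sum, mul_smul_comm, mul_one] at e1
  rw [← e1]
  refine Finset.sum_congr rfl fun i _ => ?_
  rw [repDual_apply, mul_assoc, mul_assoc, ← mul_assoc G G', hB.inv, one_mul]

lemma sum_repDual_mul_rep' : ∑ i ∈ (ℛ k h).index, repDual hB ((ℛ k h).right i) *
    rep hB ((ℛ k h).left i) = counit (R := k) h • 1 := by
  have hG' : G' * G = 1 := mul_eq_one_comm.mp hB.inv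
  have e1 := congr(G' * (rep hB (HopfAlgebra.antipode k
    $(HopfAlgebra.sum_antipode_mul_eq_smul (ℛ k h))) * G))
  simp only [map_sum, HopfAlgebra.antipode_mul_antidistrib, map_mul, map_smul, map_one,
    HopfAlgebra.antipode_one, Finset.sum_mul, Finset.mul_sum, mul_smul_comm, smul_mul_assoc,
    one_mul, hG', rep_antipode_antipode] at e1
  rw [← e1]
  refine Finset.sum_congr rfl fun i _ => ?_
  simp only [repDual_apply, mul_assoc, hG', mul_one]

lemma sum_rep_mul_repDual' : ∑ i ∈ (ℛ k h).index, rep hB ((ℛ k h).right i) *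
    repDual hB ((ℛ k h).left i) = counit (R := k) h • 1 := by
  have hG' : G' * G = 1 := mul_eq_one_comm.mp hB.inv
  have e1 := congr(G' * (rep hB (HopfAlgebra.antipode k
    $(HopfAlgebra.sum_mul_antipode_eq_smul (ℛ k h))) * G))
  simp only [map_sum, HopfAlgebra.antipode_mul_antidistrib, map_mul, map_smul, map_one,
    HopfAlgebra.antipode_one, Finset.sum_mul, Finset.mul_sum, mul_smul_comm, smul_mul_assoc,
    one_mul, hG', rep_antipode_antipode] at e1
  rw [← e1]
  refine Finset.sum_congr rfl fun i _ => ?_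
  simp only [repDual_apply, mul_assoc]
  rw [← mul_assoc G' G, hG', one_mul]

end Convolution

end FRTAlg

/-! ### The tensor square of a matrix representation -/

section TensorSquare

open scoped Kronecker

/-- The algebra map `X ↦ X ⊗ 1`. -/
def kronLeft : Matrix ι ι k →ₐ[k] Matrix (ι × ι) (ι × ι) k :=
  AlgHom.ofLinearMap
    { toFun := fun X => X ⊗ₖ (1 : Matrix ι ι k)
      map_add' := fun a b => Matrix.add_kronecker _ _ _
      map_smul' := fun a b => Matrix.smul_kronecker _ _ _ }
    Matrix.one_kronecker_one (fun a b => by simp [← Matrix.mul_kronecker_mul])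

/-- The algebra map `X ↦ 1 ⊗ X`. -/
def kronRight : Matrix ι ι k →ₐ[k] Matrix (ι × ι) (ι × ι) k :=
  AlgHom.ofLinearMap
    { toFun := fun X => (1 : Matrix ι ι k) ⊗ₖ X
      map_add' := fun a b => Matrix.kronecker_add _ _ _
      map_smul' := fun a b => Matrix.kronecker_smul _ _ _ }
    Matrix.one_kronecker_one (fun a b => by simp [← Matrix.mul_kronecker_mul])

lemma kronLeft_mul_kronRight (X Y : Matrix ι ι k) : kronLeft X * kronRight Y = X ⊗ₖ Y := by
  change X ⊗ₖ (1 : Matrix ι ι k) * (1 : Matrix ι ι k) ⊗ₖ Y = _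
  simp [← Matrix.mul_kronecker_mul]

lemma kronRight_mul_kronLeft (X Y : Matrix ι ι k) : kronRight Y * kronLeft X = X ⊗ₖ Y := by
  change (1 : Matrix ι ι k) ⊗ₖ Y * X ⊗ₖ (1 : Matrix ι ι k) = _
  simp [← Matrix.mul_kronecker_mul]

variable {H : Type*} [Ring H] [Bialgebra k H] (ρ : H →ₐ[k] Matrix ι ι k)

/-- The tensor square of a matrix representation of a bialgebra. -/
def tensorSquare : H →ₐ[k] Matrix (ι × ι) (ι × ι) k :=
  (Algebra.TensorProduct.lift (kronLeft.comp ρ) (kronRight.comp ρ)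
    (fun a b => by
      simp [Commute, SemiconjBy, kronLeft_mul_kronRight, kronRight_mul_kronLeft])).comp
    (Bialgebra.comulAlgHom k H)

lemma tensorSquare_apply (h : H) : tensorSquare ρ h =
    ∑ i ∈ (ℛ k h).index, ρ ((ℛ k h).left i) ⊗ₖ ρ ((ℛ k h).right i) := by
  rw [tensorSquare, AlgHom.comp_apply, Bialgebra.comulAlgHom_apply]
  conv_lhs => rw [← (ℛ k h).eq]
  rw [map_sum]
  exact Finset.sum_congr rfl fun i _ => kronLeft_mul_kronRight _ _

end TensorSquare

/-! ### An FRT pair in the convolution algebra -/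

namespace FRTAlg

open WithConv

/-- An element commuting with the images of the generators `t` commutes with everything. -/
lemma commute_of_commute_t {R : Matrix (ι × ι) (ι × ι) k} {G G' : Matrix ι ι k} {B : Type*}
    [Ring B] [Algebra k B] (f : FRTAlg.{u, w} R G G' →ₐ[k] B) {x : B}
    (h : ∀ i j, Commute x (f (t R G G' i j))) (a : FRTAlg.{u, w} R G G') : Commute x (f a) := by
  have hu : ∀ i j, Commute x (f (u R G G' i j)) := by
    have hP := (isFRTPair R G G').map f
    -- A scalar matrix x·1 commutes with a matrix exactly when x commutes with its entries, and
    -- commutation passes to the inverse matrix.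
    have := commute_of_mul_eq_one (X := Matrix.diagonal fun _ => x) hP.mul_eq hP.mul_eq' (by
      ext i j
      rw [Matrix.diagonal_mul, Matrix.mul_diagonal]
      exact h i j)
    intro i j
    have := congr($this i j)
    rwa [Matrix.diagonal_mul, Matrix.mul_diagonal] at this
  induction a using FRTAlg.induction with
  | ht i j => exact h i j
  | hu i j => exact hu i j
  | hc c => rw [AlgHom.commutes]; exact Algebra.commute_algebraMap_right c x
  | hadd a b ha hb => rw [map_add]; exact ha.add_right hb
  | hmul a b ha hb => rw [map_mul]; exact ha.mul_right hb

variable {C C' : Matrix ι ι (Matrix ι ι k)} {G G' : Matrix ι ι k} [hG : Fact (G * G' = 1)]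

/-- The braiding is H-linear on M ⊗ M. Only h = t_xy has to be checked, and there it is the FRT
relation for the matrices C, that is, the braid equation. -/
lemma braidMat_commute (hB : IsBraidSystem C C' G G') (h : FRTAlg.{u, w} (braidMat C) G G') :
    Commute (braidMat C)ᵀ (tensorSquare (rep hB) h) := by
  refine commute_of_commute_t _ (fun x y => ?_) h
  have e1 : tensorSquare (rep.{u, w} hB) (t (braidMat C) G G' x y) =
      ∑ l, Matrix.kroneckerMap (· * ·) (C x l) (C l y) := by
    rw [tensorSquare, AlgHom.comp_apply, Bialgebra.comulAlgHom_apply, comul_t]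
    rw [map_sum]
    refine Finset.sum_congr rfl fun l _ => (kronLeft_mul_kronRight _ _).trans ?_
    exact congrArg₂ (Matrix.kroneckerMap (· * ·)) (rep_t hB x l) (rep_t hB l y)
  rw [e1]
  ext ⟨a, b⟩ ⟨i, j⟩
  have h1 : ∀ x j a y b i, ∑ q, ∑ p, C x p q j * (C q a * C p y) b i =
      ∑ q, ∑ p, (C x q * C j p) b i * C q y a p := fun x j a y b i => by
    have h3 := congr($(hB.pair.comm) (x, j) (a, y))
    rw [Matrix.mul_apply, Matrix.mul_apply] at h3
    have := congr($h3 b i)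
    simpa [Fintype.sum_prod_type, kron_apply, braidMat, Matrix.sum_apply,
      Algebra.algebraMap_eq_smul_one, mul_comm] using this
  have e2 := h1 x i b y a j
  simp only [Matrix.mul_apply, Finset.mul_sum, Finset.sum_mul] at e2
  simp only [Matrix.mul_apply, Fintype.sum_prod_type, Matrix.sum_apply, Matrix.kroneckerMap_apply,
    Finset.mul_sum, Finset.sum_mul, Matrix.transpose_apply, braidMat, Matrix.of_apply]
  calc _ = ∑ q, ∑ p, ∑ y', C x p q i * (C q b a y' * C p y y' j) := by
        refine Finset.sum_congr rfl fun q _ => ?_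
        rw [Finset.sum_comm]
        refine Finset.sum_congr rfl fun p _ => Finset.sum_congr rfl fun y' _ => by ring
    _ = ∑ p, ∑ y', ∑ q, C x q a y' * C i p y' j * C q y b p := by
        rw [e2, Finset.sum_comm]
        exact Finset.sum_congr rfl fun p _ => Finset.sum_comm
    _ = _ := by
        rw [Finset.sum_comm]
        refine Finset.sum_congr rfl fun y' _ => Finset.sum_congr rfl fun p _ =>
          Finset.sum_congr rfl fun q _ => by ring

/-- Evaluation of a matrix entry. -/
def entry (P : FRTAlg.{u, w} (braidMat C) G G' →ₗ[k] Matrix ι ι k) (i j : ι) :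
    WithConv (FRTAlg.{u, w} (braidMat C) G G' →ₗ[k] k) :=
  toConv (Matrix.entryLinearMap k k i j ∘ₗ P)

lemma sum_entry_mul_entry (P Q : FRTAlg.{u, w} (braidMat C) G G' →ₗ[k] Matrix ι ι k) (i j : ι)
    (h : FRTAlg.{u, w} (braidMat C) G G') :
    (∑ l, entry P i l * entry Q l j) h =
      (∑ r ∈ (ℛ k h).index, P ((ℛ k h).left r) * Q ((ℛ k h).right r)) i j := by
  simp only [ofConv_sum, LinearMap.sum_apply, (ℛ k h).convMul_apply, Matrix.sum_apply,
    Matrix.mul_apply]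
  exact Finset.sum_comm

lemma sum_entry_mul_entry' (P Q : FRTAlg.{u, w} (braidMat C) G G' →ₗ[k] Matrix ι ι k) (i j : ι)
    (h : FRTAlg.{u, w} (braidMat C) G G') :
    (∑ l, entry P l j * entry Q i l) h =
      (∑ r ∈ (ℛ k h).index, Q ((ℛ k h).right r) * P ((ℛ k h).left r)) i j := by
  simp only [ofConv_sum, LinearMap.sum_apply, (ℛ k h).convMul_apply, Matrix.sum_apply,
    Matrix.mul_apply]
  rw [Finset.sum_comm]
  exact Finset.sum_congr rfl fun _ _ => Finset.sum_congr rfl fun _ _ => mul_comm _ _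

lemma one_entry_apply (i j : ι) (h : FRTAlg.{u, w} (braidMat C) G G') :
    (1 : Matrix ι ι (WithConv (FRTAlg.{u, w} (braidMat C) G G' →ₗ[k] k))) i j h =
      (counit (R := k) h • (1 : Matrix ι ι k)) j i := by
  rcases eq_or_ne i j with rfl | hij
  · simp
  · simp [Matrix.one_apply_ne hij, Matrix.one_apply_ne hij.symm]

lemma entry_mul_sc (P : FRTAlg.{u, w} (braidMat C) G G' →ₗ[k] Matrix ι ι k) (N : Matrix ι ι k) :
    Matrix.of (entry P) * sc (WithConv (FRTAlg.{u, w} (braidMat C) G G' →ₗ[k] k)) N =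
      Matrix.of (entry (LinearMap.mulRight k N ∘ₗ P)) := by
  ext i j h
  simp only [Matrix.mul_apply, Matrix.map_apply, Algebra.algebraMap_eq_smul_one, mul_smul_comm,
    mul_one]
  simp [entry, Matrix.mul_apply, mul_comm]

/-- The universal form should satisfy r(t_ij ⊗ h) = ρ(h)_ji and r(u_ij ⊗ h) = ρ(S⁻¹h)_ji, whence the
transposes. These functionals satisfy the defining relations in the convolution algebra: `comm` is
the H-linearity of the braiding, the others are the antipode identities above. -/
lemma isFRTPair_dual (hB : IsBraidSystem C C' G G') :
    IsFRTPair (braidMat C) G G'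
      (Matrix.of (entry (rep.{u, w} hB).toLinearMap))ᵀ (Matrix.of (entry (repDual.{u, w} hB)))ᵀ where
  mul_eq := by
    ext i j h
    rw [Matrix.mul_apply]
    simp only [Matrix.of_apply, Matrix.transpose_apply]
    rw [sum_entry_mul_entry', one_entry_apply]
    simp only [AlgHom.toLinearMap_apply, sum_repDual_mul_rep']
  mul_eq' := by
    ext i j h
    rw [Matrix.mul_apply]
    simp only [Matrix.of_apply, Matrix.transpose_apply]
    rw [sum_entry_mul_entry', one_entry_apply]
    simp only [AlgHom.toLinearMap_apply, sum_rep_mul_repDual']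
  conj := by
    rw [Matrix.transpose_transpose, Matrix.transpose_transpose, entry_mul_sc]
    ext i j h
    rw [Matrix.mul_apply]
    simp only [Matrix.of_apply]
    rw [sum_entry_mul_entry]
    simp only [LinearMap.comp_apply, AlgHom.toLinearMap_apply, LinearMap.mulRight_apply, mul_assoc,
      sum_rep_mul_repDual]
    simp [mul_comm]
  conj' := by
    rw [Matrix.transpose_transpose, Matrix.transpose_transpose, entry_mul_sc]
    ext i j h
    rw [Matrix.mul_apply]
    simp only [Matrix.of_apply]
    rw [sum_entry_mul_entry]
    simp only [LinearMap.comp_apply, AlgHom.toLinearMap_apply, LinearMap.mulRight_apply, mul_assoc,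
      sum_repDual_mul_rep]
    simp [mul_comm]
  comm := by
    ext ⟨i, j⟩ ⟨a, b⟩ h
    have e1 : ∀ x y : ι × ι, kron (Matrix.of (entry (rep.{u, w} hB).toLinearMap))ᵀ x y h =
        tensorSquare (rep hB) h y x := fun x y => by
      simp only [kron_apply, Matrix.transpose_apply, Matrix.of_apply, (ℛ k h).convMul_apply,
        tensorSquare_apply, Matrix.sum_apply]
      rfl
    rw [Matrix.mul_apply, Matrix.mul_apply]
    have := congr($((braidMat_commute hB h).eq) (a, b) (i, j))
    rw [Matrix.mul_apply, Matrix.mul_apply] at this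
    simp only [Matrix.map_apply, Algebra.algebraMap_eq_smul_one, mul_smul_comm, smul_mul_assoc,
      mul_one, one_mul, ofConv_sum, ofConv_smul, LinearMap.sum_apply, LinearMap.smul_apply, e1,
      smul_eq_mul]
    simp only [Matrix.transpose_apply] at this
    rw [this]
    exact Finset.sum_congr rfl fun _ _ => mul_comm _ _

end FRTAlg
end Form

/-! ### Constructing coquasitriangular structures -/

section Criterion

open WithConv

variable {k : Type u} [Field k]

section Maps
variable {C D A B : Type*} [AddCommGroup C] [Module k C] [Coalgebra k C] [AddCommGroup D]
  [Module k D] [Coalgebra k D] [Ring A] [Algebra k A] [Ring B] [Algebra k B]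

/-- Precomposition with a coalgebra map, as a map of convolution algebras. -/
def convPrecomp (f : C →ₗc[k] D) : WithConv (D →ₗ[k] A) →ₐ[k] WithConv (C →ₗ[k] A) :=
  AlgHom.ofLinearMap
    { toFun := fun φ => toConv (φ.ofConv ∘ₗ f.toLinearMap)
      map_add' := fun _ _ => rfl
      map_smul' := fun _ _ => rfl }
    (by ext c; simp)
    (fun φ ψ => congrArg toConv (LinearMap.convMul_comp_coalgHom_distrib φ ψ f))

/-- Postcomposition with an algebra map, as a map of convolution algebras. -/
def convPostcomp (f : A →ₐ[k] B) : WithConv (C →ₗ[k] A) →ₐ[k] WithConv (C →ₗ[k] B) :=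
  AlgHom.ofLinearMap
    { toFun := fun φ => toConv (f.toLinearMap ∘ₗ φ.ofConv)
      map_add' := fun _ _ => by ext; simp
      map_smul' := fun _ _ => by ext; simp }
    (by ext c; simp)
    (fun φ ψ => congrArg toConv (LinearMap.algHom_comp_convMul_distrib f φ ψ))

lemma sum_counit_smul_map {N : Type*} [AddCommGroup N] [Module k N] (f : C →ₗ[k] N) {c : C}
    {κ : Type*} (𝓡 : Coalgebra.Repr k c κ) :
    ∑ x ∈ 𝓡.index, counit (R := k) (𝓡.left x) • f (𝓡.right x) = f c := by
  conv_rhs => rw [← sum_counit_smul 𝓡]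
  simp

lemma sum_smul_counit_map {N : Type*} [AddCommGroup N] [Module k N] (f : C →ₗ[k] N) {c : C}
    {κ : Type*} (𝓡 : Coalgebra.Repr k c κ) :
    ∑ x ∈ 𝓡.index, counit (R := k) (𝓡.right x) • f (𝓡.left x) = f c := by
  have := congr(TensorProduct.lift (LinearMap.lsmul k C).flip $(sum_tmul_counit_eq (R := k) 𝓡))
  simp only [map_sum, TensorProduct.lift.tmul, LinearMap.flip_apply, LinearMap.lsmul_apply,
    one_smul] at this
  conv_rhs => rw [← this]
  simp

variable (C A) in
/-- The map `a ↦ ε(-) a` into the convolution algebra. -/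
def convConst : A →ₐ[k] WithConv (C →ₗ[k] A) :=
  AlgHom.ofLinearMap
    { toFun := fun a => toConv ((counit (R := k) (A := C)).smulRight a)
      map_add' := fun _ _ => by ext; simp
      map_smul' := fun c a => by
        ext x
        exact smul_comm _ _ _ }
    (by ext c; simp [Algebra.algebraMap_eq_smul_one])
    (fun a b => by
      ext c
      change counit (R := k) c • (a * b) = (toConv ((counit (R := k) (A := C)).smulRight a) *
        toConv ((counit (R := k) (A := C)).smulRight b) : WithConv (C →ₗ[k] A)).ofConv c
      rw [(ℛ k c).convMul_apply]
      refine (sum_counit_smul_map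
        ((counit (R := k) (A := C)).smulRight (a * b)) (ℛ k c)).symm.trans ?_
      refine Finset.sum_congr rfl fun i _ => ?_
      simp only [LinearMap.smulRight_apply, smul_mul_assoc, mul_smul_comm]
      exact smul_comm _ _ _)

lemma convConst_apply (a : A) (c : C) : (convConst (k := k) C A a).ofConv c =
    counit (R := k) c • a := rfl

lemma mul_convConst_apply (φ : WithConv (C →ₗ[k] A)) (a : A) (c : C) :
    (φ * convConst C A a).ofConv c = φ c * a := by
  rw [(ℛ k c).convMul_apply]
  refine Eq.trans ?_ (sum_smul_counit_map (LinearMap.mulRight k a ∘ₗ φ.ofConv) (ℛ k c))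
  exact Finset.sum_congr rfl fun i _ => by simp [convConst_apply]

lemma convConst_mul_apply (φ : WithConv (C →ₗ[k] A)) (a : A) (c : C) :
    (convConst C A a * φ).ofConv c = a * φ c := by
  rw [(ℛ k c).convMul_apply]
  refine Eq.trans ?_ (sum_counit_smul_map (LinearMap.mulLeft k a ∘ₗ φ.ofConv) (ℛ k c))
  exact Finset.sum_congr rfl fun i _ => by simp [convConst_apply]

lemma commute_convPostcomp_convConst (φ : WithConv (C →ₗ[k] k)) (a : A) :
    Commute (convPostcomp (Algebra.ofId k A) φ) (convConst C A a) := by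
  ext c
  rw [mul_convConst_apply, convConst_mul_apply]
  exact Algebra.commutes _ _

/-- Conjugation by a unit. -/
def conjHom {d e : A} (h : d * e = 1) (h' : e * d = 1) : A →ₐ[k] A :=
  AlgHom.ofLinearMap (LinearMap.mulLeft k e ∘ₗ LinearMap.mulRight k d) (by simpa using h')
    (fun a b => by
      simp only [LinearMap.comp_apply, LinearMap.mulRight_apply, LinearMap.mulLeft_apply, mul_assoc]
      rw [← mul_assoc d e, h, one_mul])

lemma conjHom_apply {d e : A} (h : d * e = 1) (h' : e * d = 1) (x : A) :
    conjHom (k := k) h h' x = e * (x * d) := rfl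

/-- Rewrites an intertwining relation as an equality involving a conjugation. When x and y are
values of algebra maps, it can thereby be checked on generators. -/
lemma eq_conjHom_iff {d e : A} (h : d * e = 1) (h' : e * d = 1) (x y : A) :
    x = conjHom (k := k) h h' y ↔ d * x = y * d := by
  rw [conjHom_apply]
  constructor
  · rintro rfl
    rw [← mul_assoc, h, one_mul]
  · intro hx
    rw [← hx, ← mul_assoc, h', one_mul]

end Maps
section Tensor
variable {C D : Type*} [AddCommGroup C] [Module k C] [Coalgebra k C] [AddCommGroup D]
  [Module k D] [Coalgebra k D]

/-- The linear form `f ⊗ g` on the tensor product of coalgebras. -/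
def convTensor (f : WithConv (C →ₗ[k] k)) (g : WithConv (D →ₗ[k] k)) :
    WithConv (C ⊗[k] D →ₗ[k] k) :=
  toConv (LinearMap.mul' k k ∘ₗ TensorProduct.map f.ofConv g.ofConv)

lemma convTensor_mul (f f' : WithConv (C →ₗ[k] k)) (g g' : WithConv (D →ₗ[k] k)) :
    convTensor f g * convTensor f' g' = convTensor (f * f') (g * g') := by
  apply WithConv.ext
  have h1 := LinearMap.algHom_comp_convMul_distrib (Algebra.TensorProduct.lmul' k (S := k))
    (toConv (TensorProduct.map f.ofConv g.ofConv)) (toConv (TensorProduct.map f'.ofConv g'.ofConv))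
  rw [TensorProduct.map_convMul_map] at h1
  exact h1.symm

lemma convTensor_one : convTensor (1 : WithConv (C →ₗ[k] k)) (1 : WithConv (D →ₗ[k] k)) = 1 := by
  ext c d
  change counit (R := k) c * counit (R := k) d = counit (R := k) (c ⊗ₜ[k] d)
  rw [TensorProduct.counit_tmul, smul_eq_mul, mul_comm]

variable (k C D) in
/-- The algebra map `f ↦ f ⊗ ε`. -/
def convTensorLeft : WithConv (C →ₗ[k] k) →ₐ[k] WithConv (C ⊗[k] D →ₗ[k] k) :=
  AlgHom.ofLinearMap
    { toFun := fun f => convTensor f 1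
      map_add' := fun _ _ => by ext; simp [convTensor, add_mul]
      map_smul' := fun _ _ => by ext; simp [convTensor, mul_assoc] }
    convTensor_one (fun f g => by
      change convTensor _ _ = convTensor _ _ * convTensor _ _
      rw [convTensor_mul, one_mul])

variable (k C D) in
/-- The algebra map `g ↦ ε ⊗ g`. -/
def convTensorRight : WithConv (D →ₗ[k] k) →ₐ[k] WithConv (C ⊗[k] D →ₗ[k] k) :=
  AlgHom.ofLinearMap
    { toFun := fun f => convTensor 1 f
      map_add' := fun _ _ => by ext; simp [convTensor, mul_add]
      map_smul' := fun _ _ => by ext; simp [convTensor, mul_left_comm] }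
    convTensor_one (fun f g => by
      change convTensor _ _ = convTensor _ _ * convTensor _ _
      rw [convTensor_mul, one_mul])

lemma convTensorLeft_mul_convTensorRight (f : WithConv (C →ₗ[k] k)) (g : WithConv (D →ₗ[k] k)) :
    convTensorLeft k C D f * convTensorRight k C D g = convTensor f g :=
  (convTensor_mul _ _ _ _).trans (by rw [one_mul, mul_one])

lemma convTensorRight_mul_convTensorLeft (f : WithConv (C →ₗ[k] k)) (g : WithConv (D →ₗ[k] k)) :
    convTensorRight k C D g * convTensorLeft k C D f = convTensor f g :=
  (convTensor_mul _ _ _ _).trans (by rw [one_mul, mul_one])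

end Tensor

section Form
variable {H : Type*} [Ring H]

section Bialg
variable [Bialgebra k H] (Φ : H →ₐ[k] WithConv (H →ₗ[k] k))

/-- The form `a ⊗ b ↦ Φ(a)(b)`. -/
def homForm : H ⊗[k] H →ₗ[k] k :=
  TensorProduct.lift ((WithConv.linearEquiv k (H →ₗ[k] k)).toLinearMap ∘ₗ Φ.toLinearMap)

lemma homForm_tmul (a b : H) : homForm Φ (a ⊗ₜ b) = (Φ a).ofConv b := rfl

/-- The map `a ↦ (b ⊗ c ↦ Φ(a)(bc))`. -/
def homFormMul : H →ₐ[k] WithConv (H ⊗[k] H →ₗ[k] k) :=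
  (convPrecomp (Bialgebra.mulCoalgHom k H)).comp Φ

lemma homFormMul_tmul (a b c : H) : (homFormMul Φ a).ofConv (b ⊗ₜ c) = (Φ a).ofConv (b * c) := rfl

/-- The map `a ↦ (b ⊗ c ↦ Φ(a₍₁₎)(c) Φ(a₍₂₎)(b))`. -/
def homFormComul : H →ₐ[k] WithConv (H ⊗[k] H →ₗ[k] k) :=
  (Algebra.TensorProduct.lift ((convTensorRight k H H).comp Φ) ((convTensorLeft k H H).comp Φ) (fun a b =>
    (convTensorRight_mul_convTensorLeft (Φ b) (Φ a)).trans
      (convTensorLeft_mul_convTensorRight (Φ b) (Φ a)).symm)).comp (Bialgebra.comulAlgHom k H)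

lemma homFormComul_tmul (a b c : H) : (homFormComul Φ a).ofConv (b ⊗ₜ c) =
    LinearMap.mul' k k (TensorProduct.map ((curry (homForm Φ)).flip c)
      ((curry (homForm Φ)).flip b) (comul a)) := by
  rw [homFormComul, AlgHom.comp_apply, Bialgebra.comulAlgHom_apply]
  induction comul (R := k) a with
  | zero => simp
  | add x y hx hy => rw [map_add, map_add, map_add, ofConv_add, LinearMap.add_apply, hx, hy]
  | tmul x y =>
    change (convTensorRight k H H (Φ x) * convTensorLeft k H H (Φ y)).ofConv (b ⊗ₜ c) = _
    rw [convTensorRight_mul_convTensorLeft]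
    exact mul_comm _ _

/-- The map `a ↦ (b ↦ Φ(a₍₁₎)(b) a₍₂₎)`. -/
def homFormLeft : H →ₐ[k] WithConv (H →ₗ[k] H) :=
  (Algebra.TensorProduct.lift ((convPostcomp (Algebra.ofId k H)).comp Φ) (convConst H H)
    (fun _ _ => commute_convPostcomp_convConst _ _)).comp (Bialgebra.comulAlgHom k H)

/-- The map `a ↦ (b ↦ a₍₁₎ Φ(a₍₂₎)(b))`. -/
def homFormRight : H →ₐ[k] WithConv (H →ₗ[k] H) :=
  (Algebra.TensorProduct.lift (convConst H H) ((convPostcomp (Algebra.ofId k H)).comp Φ)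
    (fun _ _ => (commute_convPostcomp_convConst _ _).symm)).comp (Bialgebra.comulAlgHom k H)

lemma homFormLeft_apply {a : H} {κ : Type*} (𝓡 : Coalgebra.Repr k a κ) (b : H) :
    (homFormLeft Φ a).ofConv b = ∑ i ∈ 𝓡.index, Φ (𝓡.left i) b • 𝓡.right i := by
  rw [homFormLeft, AlgHom.comp_apply, Bialgebra.comulAlgHom_apply, ← 𝓡.eq, map_sum, ofConv_sum,
    LinearMap.sum_apply]
  exact Finset.sum_congr rfl fun i _ => (mul_convConst_apply _ _ _).trans (Algebra.smul_def _ _).symm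

lemma homFormRight_apply {a : H} {κ : Type*} (𝓡 : Coalgebra.Repr k a κ) (b : H) :
    (homFormRight Φ a).ofConv b = ∑ i ∈ 𝓡.index, Φ (𝓡.right i) b • 𝓡.left i := by
  rw [homFormRight, AlgHom.comp_apply, Bialgebra.comulAlgHom_apply, ← 𝓡.eq, map_sum, ofConv_sum,
    LinearMap.sum_apply]
  exact Finset.sum_congr rfl fun i _ => (convConst_mul_apply _ _ _).trans
    ((Algebra.commutes _ _).symm.trans (Algebra.smul_def _ _).symm)

end Bialg

variable [HopfAlgebra k H] {Φ : H →ₐ[k] WithConv (H →ₗ[k] k)}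

/-- Multiplicativity of Φ is the axiom `mul_left`, and it makes r(S(a) ⊗ b) the convolution inverse
of r. The hypothesis `h2` is the relation ∇ᵒᵖ ⋆ r = r ⋆ ∇ with its first argument fixed. -/
lemma isCoquasitriangular_homForm (h1 : homFormMul Φ = homFormComul Φ)
    (h2 : ∀ a, homFormLeft Φ a * toConv LinearMap.id = toConv LinearMap.id * homFormRight Φ a) :
    IsCoquasitriangular (homForm Φ) where
  mul_left a b c := by
    rw [homForm_tmul, map_mul]
    rfl
  mul_right a b c := by
    rw [← homFormComul_tmul, ← h1]
    rfl
  exists_inv := by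
    set s : H ⊗[k] H →ₗ[k] k := homForm Φ ∘ₗ (HopfAlgebra.antipode k).rTensor H with hs
    have hs' : ∀ a b, s (a ⊗ₜ b) = (Φ (HopfAlgebra.antipode k a)).ofConv b := fun _ _ => rfl
    have e1 : toConv (homForm Φ) * toConv s = 1 := by
      ext a b
      change (toConv (homForm Φ) * toConv s).ofConv (a ⊗ₜ b) = counit (R := k) (a ⊗ₜ[k] b)
      rw [((ℛ k a).tmul (ℛ k b)).convMul_apply, TensorProduct.counit_tmul]
      have := congr((Φ $(HopfAlgebra.sum_mul_antipode_eq_smul (ℛ k a))).ofConv b)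
      simp only [map_sum, map_mul, ofConv_sum, LinearMap.sum_apply, (ℛ k b).convMul_apply, map_smul,
        map_one, ofConv_smul, LinearMap.smul_apply] at this
      simp only [Repr.tmul_index, Repr.tmul_left, Repr.tmul_right, Finset.sum_product]
      refine this.trans ?_
      simp [mul_comm]
    have e2 : toConv s * toConv (homForm Φ) = 1 := by
      ext a b
      change (toConv s * toConv (homForm Φ)).ofConv (a ⊗ₜ b) = counit (R := k) (a ⊗ₜ[k] b)
      rw [((ℛ k a).tmul (ℛ k b)).convMul_apply, TensorProduct.counit_tmul]
      have := congr((Φ $(HopfAlgebra.sum_antipode_mul_eq_smul (ℛ k a))).ofConv b)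
      simp only [map_sum, map_mul, ofConv_sum, LinearMap.sum_apply, (ℛ k b).convMul_apply, map_smul,
        map_one, ofConv_smul, LinearMap.smul_apply] at this
      simp only [Repr.tmul_index, Repr.tmul_left, Repr.tmul_right, Finset.sum_product]
      refine this.trans ?_
      simp [mul_comm]
    refine ⟨s, e1, e2, ?_⟩
    have e3 : toConv (LinearMap.mul' k H ∘ₗ (TensorProduct.comm k H H).toLinearMap) *
        toConv (formToHom (homForm Φ)) =
        toConv (formToHom (homForm Φ)) * toConv (LinearMap.mul' k H) := by
      ext a b
      change (toConv (LinearMap.mul' k H ∘ₗ (TensorProduct.comm k H H).toLinearMap) *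
        toConv (formToHom (homForm Φ))).ofConv (a ⊗ₜ b) = 
        (toConv (formToHom (homForm Φ)) * toConv (LinearMap.mul' k H)).ofConv (a ⊗ₜ b)
      rw [((ℛ k a).tmul (ℛ k b)).convMul_apply, ((ℛ k a).tmul (ℛ k b)).convMul_apply]
      have := congr(($(h2 a)).ofConv b)
      rw [(ℛ k b).convMul_apply, (ℛ k b).convMul_apply] at this
      simp only [homFormLeft_apply Φ (ℛ k a), homFormRight_apply Φ (ℛ k a), Finset.sum_mul,
        Finset.mul_sum] at this
      simp only [Repr.tmul_index, Repr.tmul_left, Repr.tmul_right, Finset.sum_product]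
      rw [Finset.sum_comm] at this
      rw [Finset.sum_comm (s := (ℛ k b).index)] at this
      refine Eq.trans ?_ (this.symm.trans ?_)
      · refine Finset.sum_congr rfl fun i _ => Finset.sum_congr rfl fun j _ => ?_
        simp [formToHom, homForm_tmul, Algebra.algebraMap_eq_smul_one]
      · refine Finset.sum_congr rfl fun i _ => Finset.sum_congr rfl fun j _ => ?_
        simp [formToHom, homForm_tmul, Algebra.algebraMap_eq_smul_one]
    have e4 : toConv (formToHom (homForm Φ)) * toConv (formToHom s) = 1 :=
      (map_mul (convPostcomp (Algebra.ofId k H)) (toConv (homForm Φ)) (toConv s)).symm.trans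
        ((congrArg (convPostcomp (Algebra.ofId k H)) e1).trans (map_one _))
    rw [← e3, mul_assoc, e4, mul_one]

end Form
end Criterion

/-! ### The universal form of the FRT algebra is coquasitriangular -/

namespace FRTAlg

open WithConv

variable {ι : Type} [Fintype ι] [DecidableEq ι] {k : Type u} [Field k]
  {C C' : Matrix ι ι (Matrix ι ι k)} {G G' : Matrix ι ι k}

/-- The map `h ↦ h₍₁₎ ρ(h₍₂₎)` into matrices over the FRT algebra. -/
def repLeft (hB : IsBraidSystem C C' G G') :
    FRTAlg.{u, w} (braidMat C) G G' →ₐ[k] Matrix ι ι (FRTAlg.{u, w} (braidMat C) G G') :=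
  (Algebra.TensorProduct.lift (Matrix.scalarAlgHom ι k)
    ((Algebra.ofId k (FRTAlg.{u, w} (braidMat C) G G')).mapMatrix.comp (rep hB))
    (fun a b => by
      ext i j
      simpa using (Algebra.commutes _ _).symm)).comp
    (Bialgebra.comulAlgHom k (FRTAlg.{u, w} (braidMat C) G G'))

/-- The map `h ↦ ρ(h₍₁₎) h₍₂₎` into matrices over the FRT algebra. -/
def repRight (hB : IsBraidSystem C C' G G') :
    FRTAlg.{u, w} (braidMat C) G G' →ₐ[k] Matrix ι ι (FRTAlg.{u, w} (braidMat C) G G') :=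
  (Algebra.TensorProduct.lift
    ((Algebra.ofId k (FRTAlg.{u, w} (braidMat C) G G')).mapMatrix.comp (rep hB))
    (Matrix.scalarAlgHom ι k)
    (fun a b => by
      ext i j
      simpa using Algebra.commutes _ _)).comp
    (Bialgebra.comulAlgHom k (FRTAlg.{u, w} (braidMat C) G G'))

lemma repLeft_apply (hB : IsBraidSystem C C' G G') {h : FRTAlg.{u, w} (braidMat C) G G'}
    {κ : Type*} (𝓡 : Coalgebra.Repr k h κ) (i j : ι) :
    repLeft hB h i j = ∑ x ∈ 𝓡.index, rep hB (𝓡.right x) i j • 𝓡.left x := by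
  rw [repLeft, AlgHom.comp_apply, Bialgebra.comulAlgHom_apply, ← 𝓡.eq, map_sum, Matrix.sum_apply]
  refine Finset.sum_congr rfl fun x _ => ?_
  erw [Algebra.TensorProduct.lift_tmul]
  simp [Algebra.smul_def, Algebra.commutes, Algebra.ofId_apply]

lemma repRight_apply (hB : IsBraidSystem C C' G G') {h : FRTAlg.{u, w} (braidMat C) G G'}
    {κ : Type*} (𝓡 : Coalgebra.Repr k h κ) (i j : ι) :
    repRight hB h i j = ∑ x ∈ 𝓡.index, rep hB (𝓡.left x) i j • 𝓡.right x := by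
  rw [repRight, AlgHom.comp_apply, Bialgebra.comulAlgHom_apply, ← 𝓡.eq, map_sum, Matrix.sum_apply]
  refine Finset.sum_congr rfl fun x _ => ?_
  erw [Algebra.TensorProduct.lift_tmul]
  simp [Algebra.smul_def, Algebra.ofId_apply]

/-- The canonical representation of the comultiplication of a generator. -/
def reprT {R : Matrix (ι × ι) (ι × ι) k} (i j : ι) :
    Coalgebra.Repr k (t.{u, w} R G G' i j) ι where
  index := Finset.univ
  left l := t R G G' i l
  right l := t R G G' l j
  eq := (comul_t i j).symm

variable [hG : Fact (G * G' = 1)]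

/-- This is the commutation rule between a generator t_ij and an arbitrary h. Since tᵀ is
invertible, the rule compares two algebra maps in h, one of them conjugated by tᵀ, so h may be taken
to be a generator; there it is the FRT relation. -/
lemma transpose_t_mul_repRight (hB : IsBraidSystem C C' G G')
    (h : FRTAlg.{u, w} (braidMat C) G G') :
    (t.{u, w} (braidMat C) G G')ᵀ * repRight hB h =
      repLeft hB h * (t.{u, w} (braidMat C) G G')ᵀ := by
  have hP := isFRTPair.{u, w} (braidMat C) G G'
  have hs : sc (FRTAlg.{u, w} (braidMat C) G G') G * sc (FRTAlg.{u, w} (braidMat C) G G') G' = 1 := by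
    rw [← sc_mul, hG.out, sc_one]
  -- The inverse of tᵀ is not uᵀ but G uᵀ G', by `conj` and `conj'`.
  have h1 : (t.{u, w} (braidMat C) G G')ᵀ * (sc _ G * ((u.{u, w} (braidMat C) G G')ᵀ * sc _ G')) =
      1 := by
    rw [← mul_assoc, ← mul_assoc, hP.conj, hs]
  have h2 : (sc _ G * ((u.{u, w} (braidMat C) G G')ᵀ * sc _ G')) * (t.{u, w} (braidMat C) G G')ᵀ =
      1 := by
    rw [mul_assoc, hP.conj', hs]
  rw [← eq_conjHom_iff (k := k) h1 h2]
  revert h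
  suffices repRight hB = (conjHom h1 h2).comp (repLeft hB) from fun h => congr($this h)
  refine algHom_ext fun x y => ?_
  rw [AlgHom.comp_apply, eq_conjHom_iff]
  ext j i
  rw [Matrix.mul_apply, Matrix.mul_apply]
  have h3 := congr($(hP.comm) (x, i) (j, y))
  rw [Matrix.mul_apply, Matrix.mul_apply] at h3
  simp only [repRight_apply hB (reprT x y), repLeft_apply hB (reprT x y), reprT, rep_t,
    Matrix.transpose_apply, Finset.sum_mul, Finset.mul_sum]
  have hR : ∀ p q, braidMat C p q = C p.1 q.2 q.1 p.2 := fun _ _ => rfl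
  simp only [Matrix.map_apply, kron_apply, hR, Fintype.sum_prod_type] at h3
  simp only [mul_smul_comm, smul_mul_assoc]
  rw [Finset.sum_comm]
  refine (Eq.trans ?_ h3).trans ?_
  · rw [Finset.sum_comm]
    exact Finset.sum_congr rfl fun _ _ => Finset.sum_congr rfl fun _ _ => Algebra.smul_def _ _
  · rw [Finset.sum_comm]
    exact Finset.sum_congr rfl fun _ _ => Finset.sum_congr rfl fun _ _ =>
      (Algebra.commutes _ _).symm.trans (Algebra.smul_def _ _).symm

/-- The map `a ↦ r(a ⊗ -)` defined by the universal form `r` of the FRT algebra. -/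
def formHom (hB : IsBraidSystem C C' G G') : FRTAlg.{u, w} (braidMat C) G G' →ₐ[k]
    WithConv (FRTAlg.{u, w} (braidMat C) G G' →ₗ[k] k) :=
  lift (isFRTPair_dual hB)

lemma formHom_t (hB : IsBraidSystem C C' G G') (i j : ι) (h : FRTAlg.{u, w} (braidMat C) G G') :
    (formHom hB (t (braidMat C) G G' i j)).ofConv h = rep hB h j i := by
  rw [formHom, lift_t_apply]
  rfl

/-- Both hypotheses of the criterion are reduced to generators in the first argument, the exchange
law after conjugation by the identity map, whose convolution inverse is S. On t_ij the first says
that ρ is multiplicative, and the second is `transpose_t_mul_repRight`. -/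
theorem isCoquasitriangular (hB : IsBraidSystem C C' G G') :
    IsCoquasitriangular (homForm (formHom.{u, w} hB)) := by
  refine isCoquasitriangular_homForm ?_ ?_
  · refine algHom_ext fun i j => ?_
    ext b c
    change (homFormMul (formHom hB) (t _ _ _ i j)).ofConv (b ⊗ₜ c) =
      (homFormComul (formHom hB) (t _ _ _ i j)).ofConv (b ⊗ₜ c)
    rw [homFormMul_tmul, homFormComul_tmul, comul_t, formHom_t, map_mul, Matrix.mul_apply, map_sum,
      map_sum]
    refine Finset.sum_congr rfl fun l _ => ?_
    rw [TensorProduct.map_tmul, LinearMap.mul'_apply, mul_comm]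
    exact congrArg₂ (· * ·) (formHom_t hB _ _ _).symm (formHom_t hB _ _ _).symm
  · have h1 := LinearMap.id_mul_antipode (R := k) (C := FRTAlg.{u, w} (braidMat C) G G')
    have h2 := LinearMap.antipode_mul_id (R := k) (C := FRTAlg.{u, w} (braidMat C) G G')
    suffices homFormRight (formHom.{u, w} hB) =
        (conjHom h1 h2).comp (homFormLeft (formHom.{u, w} hB)) from fun a =>
      (((eq_conjHom_iff (k := k) h1 h2 _ _).mp congr($this a))).symm
    refine algHom_ext fun i j => ?_
    rw [AlgHom.comp_apply, eq_conjHom_iff]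
    ext h
    rw [(ℛ k h).convMul_apply, (ℛ k h).convMul_apply]
    have := congr($(transpose_t_mul_repRight hB h) j i)
    rw [Matrix.mul_apply, Matrix.mul_apply] at this
    simp only [repRight_apply hB (ℛ k h), repLeft_apply hB (ℛ k h), Matrix.transpose_apply,
      Finset.sum_mul, Finset.mul_sum] at this
    simp only [homFormLeft_apply _ (reprT i j), homFormRight_apply _ (reprT i j), reprT,
      Finset.sum_mul, Finset.mul_sum, formHom_t]
    rw [Finset.sum_comm, Finset.sum_comm (s := (ℛ k h).index)]
    simpa using this.symm

end FRTAlg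

/-! ### The coefficients of a braiding -/

section Coefficients

variable {ι : Type} [Fintype ι] [DecidableEq ι] {k : Type u} [Field k]
  {M : Type v} [AddCommGroup M] [Module k M] (c : M ⊗[k] M ≃ₗ[k] M ⊗[k] M) (b : Basis ι k M)

lemma block_one_apply (i p q j : ι) : (1 : Matrix ι ι (Matrix ι ι k)) i p q j =
    (1 : Matrix (ι × ι) (ι × ι) k) (i, q) (p, j) := by
  rcases eq_or_ne i p with rfl | h
  · simp [Matrix.one_apply]
  · simp [Matrix.one_apply, h]

/-- The coefficients of the braiding: `c(bᵢ ⊗ bⱼ) = ∑ C i p q j b_q ⊗ b_p`. -/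
def braidCoef : Matrix ι ι (Matrix ι ι k) :=
  Matrix.of fun i p => Matrix.of fun q j => (b.tensorProduct b).repr (c (b i ⊗ₜ b j)) (q, p)

lemma braidCoef_apply (i p q j : ι) : braidCoef c b i p q j =
    (b.tensorProduct b).repr (c (b i ⊗ₜ b j)) (q, p) := rfl

lemma braid_basis (i j : ι) :
    c (b i ⊗ₜ b j) = ∑ q, ∑ p, braidCoef c b i p q j • (b q ⊗ₜ[k] b p) := by
  conv_lhs => rw [← (b.tensorProduct b).sum_repr (c (b i ⊗ₜ b j))]
  rw [Fintype.sum_prod_type]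
  simp only [Basis.tensorProduct_apply, braidCoef_apply]

lemma braidLeft_basis (i j l : ι) : braidLeft c ((b i ⊗ₜ b j) ⊗ₜ b l) =
    ∑ q, ∑ p, braidCoef c b i p q j • ((b q ⊗ₜ[k] b p) ⊗ₜ b l) := by
  rw [braidLeft, LinearMap.rTensor_tmul, LinearEquiv.coe_coe, braid_basis]
  simp only [TensorProduct.sum_tmul, TensorProduct.smul_tmul']

lemma braidRight_basis (i j l : ι) : braidRight c ((b i ⊗ₜ b j) ⊗ₜ b l) =
    ∑ q, ∑ p, braidCoef c b j p q l • ((b i ⊗ₜ[k] b q) ⊗ₜ b p) := by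
  simp only [braidRight, LinearMap.comp_apply, LinearEquiv.coe_coe, TensorProduct.assoc_tmul,
    LinearMap.lTensor_tmul, braid_basis, TensorProduct.tmul_sum, map_sum, TensorProduct.tmul_smul,
    map_smul, TensorProduct.assoc_symm_tmul]

/-- Comparing coefficients in the braid equation on b_x ⊗ b_j ⊗ b_i gives the FRT relation for the
matrices C. -/
lemma braidMat_comm (hc : IsBraiding c) :
    sc (Matrix ι ι k) (braidMat (braidCoef c b)) * kron (braidCoef c b) =
      kron (braidCoef c b) * sc (Matrix ι ι k) (braidMat (braidCoef c b)) := by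
  set C := braidCoef c b with hC
  have key : ∀ x j i b' a y, ∑ q, ∑ p, ∑ s, C x p q j * (C p y s i * C q a b' s) =
      ∑ s, ∑ p, ∑ q, C j p s i * (C x q b' s * C q y a p) := fun x j i b' a y => by
    have h1 := congr($hc ((b x ⊗ₜ b j) ⊗ₜ b i))
    simp only [LinearMap.comp_apply, braidLeft_basis, braidRight_basis, map_sum, map_smul] at h1
    have h2 := congr(((b.tensorProduct b).tensorProduct b).repr $h1 ((b', a), y))
    simp only [map_sum, map_smul, Finsupp.coe_finsetSum, Finset.sum_apply, Finsupp.smul_apply,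
      Basis.tensorProduct_repr_tmul_apply, Basis.repr_self, Finsupp.single_apply, smul_eq_mul,
      mul_ite, mul_one, mul_zero, ite_mul, zero_mul, one_mul] at h2
    simp only [Finset.sum_ite_irrel, Finset.sum_const_zero, mul_ite, mul_zero, Finset.sum_ite_eq,
      Finset.sum_ite_eq', Finset.mem_univ, if_true, ← hC, Finset.mul_sum] at h2
    exact h2.symm
  ext ⟨x, j⟩ ⟨a, y⟩ b' i
  rw [Matrix.mul_apply, Matrix.mul_apply]
  have h2 := key x j i b' a y
  simp only [Fintype.sum_prod_type, kron_apply, braidMat, Matrix.sum_apply, Matrix.map_apply,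
    Matrix.of_apply, Algebra.algebraMap_eq_smul_one, smul_mul_assoc, mul_smul_comm, one_mul, mul_one,
    Matrix.smul_apply, smul_eq_mul, Matrix.mul_apply, Finset.mul_sum]
  refine (Eq.trans ?_ h2).trans ?_
  · exact Finset.sum_congr rfl fun _ _ => Finset.sum_congr rfl fun _ _ =>
      Finset.sum_congr rfl fun _ _ => by ring
  · rw [Finset.sum_comm]
    conv_rhs => rw [Finset.sum_comm]
    refine Finset.sum_congr rfl fun _ _ => ?_
    rw [Finset.sum_comm]
    exact Finset.sum_congr rfl fun _ _ => Finset.sum_congr rfl fun _ _ => by ring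

variable [FiniteDimensional k M]

lemma cFlat_tmul (φ : Dual k M) (m : M) : cFlat c (φ ⊗ₜ m) =
    ∑ i, (TensorProduct.lid k M (φ.rTensor M
      (c (m ⊗ₜ Basis.ofVectorSpace k M i)))) ⊗ₜ[k] (Basis.ofVectorSpace k M).coord i := by
  have h1 : ∀ (x : M ⊗[k] M) (ψ : Dual k M), (TensorProduct.lid k (M ⊗[k] Dual k M))
      ((contractLeft k M).rTensor (M ⊗[k] Dual k M)
        ((tensorTensorTensorAssoc k (Dual k M) M M (Dual k M)).symm ((φ ⊗ₜ x) ⊗ₜ ψ))) =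
      (TensorProduct.lid k M (φ.rTensor M x)) ⊗ₜ ψ := fun x ψ => by
    induction x with
    | zero => simp
    | add x y hx hy => simp only [tmul_add, add_tmul, map_add, hx, hy]
    | tmul x y => simp [TensorProduct.smul_tmul']
  simp only [cFlat, LinearMap.comp_apply, LinearEquiv.coe_coe, TensorProduct.rid_symm_apply,
    LinearMap.lTensor_tmul, coevaluation_apply_one, tmul_sum, map_sum, tensorTensorTensorAssoc_tmul,
    LinearMap.rTensor_tmul, h1]

/-- The matrix of c♭ is the block matrix C with its indices regrouped, so rigidity is the
invertibility of C. Grouping the indices for c instead leads to Cᵀ. -/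
lemma toMatrix_cFlat (p j q i : ι) :
    LinearMap.toMatrix (b.dualBasis.tensorProduct b) (b.tensorProduct b.dualBasis) (cFlat c)
      (p, j) (q, i) = braidCoef c b i p q j := by
  rw [LinearMap.toMatrix_apply, Basis.tensorProduct_apply, cFlat_tmul, map_sum, Finsupp.coe_finsetSum,
    Finset.sum_apply]
  simp only [Basis.tensorProduct_repr_tmul_apply, Basis.dualBasis_repr]
  have h1 : ∀ x : M ⊗[k] M, b.repr (TensorProduct.lid k M ((b.dualBasis q).rTensor M x)) p =
      (b.tensorProduct b).repr x (q, p) := fun x => by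
    induction x with
    | zero => simp
    | add x y hx hy => simp only [map_add, Finsupp.add_apply, hx, hy]
    | tmul x y => simp [Basis.tensorProduct_repr_tmul_apply, mul_comm]
  have h2 := congr((b.tensorProduct b).repr (c (b i ⊗ₜ $((Basis.ofVectorSpace k M).sum_repr (b j))))
    (q, p))
  simp only [tmul_sum, tmul_smul, map_sum, map_smul, Finsupp.coe_finsetSum, Finset.sum_apply,
    Finsupp.smul_apply] at h2
  simp only [h1]
  exact h2

/-- Rigidity provides C', bijectivity of c provides the inverse D of Cᵀ, and the braid equation
provides the FRT relation. From these the Drinfeld matrix is invertible and implements S². -/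
theorem exists_isBraidSystem (hc : IsBraiding c) (hr : IsRigid c) :
    ∃ C' G G', IsBraidSystem (braidCoef c b) C' G G' ∧ G = drinfeldMat C' := by
  set C := braidCoef c b with hC
  have h := braidMat_comm c b hc
  obtain ⟨C', hC1⟩ : ∃ C', C' * C = 1 := by
    let e := LinearEquiv.ofBijective (cFlat c) hr
    have h1 := LinearMap.toMatrix_comp (b.tensorProduct b.dualBasis) (b.dualBasis.tensorProduct b)
      (b.tensorProduct b.dualBasis) (cFlat c) e.symm.toLinearMap
    have h2 : cFlat c ∘ₗ e.symm.toLinearMap = LinearMap.id :=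
      LinearMap.ext fun x => e.apply_symm_apply x
    rw [h2, LinearMap.toMatrix_id] at h1
    refine ⟨Matrix.of fun l i => Matrix.of fun s q => LinearMap.toMatrix
      (b.tensorProduct b.dualBasis) (b.dualBasis.tensorProduct b) e.symm.toLinearMap (q, i) (l, s), ?_⟩
    ext l p s j
    rw [block_mul_apply]
    have h3 := congr($h1 (p, j) (l, s))
    simp only [Matrix.mul_apply, Fintype.sum_prod_type, toMatrix_cFlat] at h3
    simp only [Matrix.of_apply, hC]
    rw [block_one_apply, Finset.sum_comm]
    refine Eq.trans ?_ (h3.symm.trans ?_)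
    · exact Finset.sum_congr rfl fun _ _ => Finset.sum_congr rfl fun _ _ => mul_comm _ _
    · simp only [Matrix.one_apply, Prod.mk.injEq, eq_comm, and_comm]
  have hC2 : C * C' = 1 := mul_eq_one_comm.mp hC1
  obtain ⟨D, hD⟩ : ∃ D, D * Cᵀ = 1 := by
    have h1 := LinearMap.toMatrix_comp (b.tensorProduct b) (b.tensorProduct b)
      (b.tensorProduct b) c.symm.toLinearMap c.toLinearMap
    have h2 : c.symm.toLinearMap ∘ₗ c.toLinearMap = LinearMap.id :=
      LinearMap.ext fun x => c.symm_apply_apply x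
    rw [h2, LinearMap.toMatrix_id] at h1
    refine ⟨Matrix.of fun i l => Matrix.of fun q s => LinearMap.toMatrix
      (b.tensorProduct b) (b.tensorProduct b) c.symm.toLinearMap (i, q) (s, l), ?_⟩
    have h4 : ∀ p l s j, LinearMap.toMatrix (b.tensorProduct b) (b.tensorProduct b) c.toLinearMap
        (s, l) (p, j) = C p l s j := fun p l s j => by
      rw [LinearMap.toMatrix_apply, Basis.tensorProduct_apply]
      rfl
    ext i p q j
    rw [block_mul_apply]
    have h3 := congr($h1 (i, q) (p, j))
    simp only [Matrix.mul_apply, Fintype.sum_prod_type, h4] at h3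
    simp only [Matrix.of_apply, Matrix.transpose_apply]
    rw [block_one_apply, Finset.sum_comm, h3]
  have hD' : Cᵀ * D = 1 := mul_eq_one_comm.mp hD
  obtain ⟨G', hG⟩ := exists_mul_drinfeldMat_eq_one hC2 hC1 hD h
  have hG' : G' * drinfeldMat C' = 1 := mul_eq_one_comm.mp hG
  have hs : sc (Matrix ι ι k) (drinfeldMat C') * sc (Matrix ι ι k) G' = 1 := by
    rw [← sc_mul, hG, sc_one]
  have hs' : sc (Matrix ι ι k) G' * sc (Matrix ι ι k) (drinfeldMat C') = 1 := by
    rw [← sc_mul, hG', sc_one]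
  have hconj := conj_drinfeldMat hC2 hC1 hC2 hC1 h
  refine ⟨C', drinfeldMat C', G', ⟨⟨hC2, hC1, hconj, ?_, h⟩,
    drinfeldMat_mul_mul hC2 hC1 hD hD' h hG, hG⟩, rfl⟩
  -- Over a matrix ring one-sided inverses are two-sided, so `conj'` follows from `conj`.
  have h3 : (sc (Matrix ι ι k) G' * Cᵀ * sc (Matrix ι ι k) (drinfeldMat C')) * C'ᵀ = 1 := by
    rw [mul_assoc, mul_assoc, ← mul_assoc Cᵀ, hconj, hs']
  have h4 := mul_eq_one_comm.mp h3
  calc _ = (C'ᵀ * (sc (Matrix ι ι k) G' * Cᵀ * sc (Matrix ι ι k) (drinfeldMat C'))) *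
        sc (Matrix ι ι k) G' := by simp only [mul_assoc, hs, mul_one]
    _ = _ := by rw [h4, one_mul]

end Coefficients

/-! ### Coefficient matrices of comodules -/

section CoefficientMatrix

variable {ι : Type} [Fintype ι] [DecidableEq ι] {k : Type u} [Field k]
  {M : Type v} [AddCommGroup M] [Module k M] (b : Basis ι k M)

section
variable {N : Type*} [AddCommGroup N] [Module k N]

/-- The coefficients of an element of `N ⊗ M` with respect to a basis of `M`. -/
def tensorCoef (j : ι) : N ⊗[k] M →ₗ[k] N :=
  (TensorProduct.rid k N).toLinearMap ∘ₗ (b.coord j).lTensor N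

lemma tensorCoef_tmul (j : ι) (x : N) (m : M) : tensorCoef b j (x ⊗ₜ m) = b.repr m j • x := by
  simp [tensorCoef]

lemma sum_tensorCoef (z : N ⊗[k] M) : ∑ j, tensorCoef b j z ⊗ₜ[k] b j = z := by
  induction z with
  | zero => simp
  | add x y hx hy => simp only [map_add, add_tmul, Finset.sum_add_distrib, hx, hy]
  | tmul x m =>
    simp only [tensorCoef_tmul, smul_tmul, ← tmul_sum]
    rw [b.sum_repr]

lemma tensorCoef_sum (f : ι → N) (j : ι) : tensorCoef b j (∑ i, f i ⊗ₜ[k] b i) = f j := by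
  simp [tensorCoef_tmul, Finsupp.single_apply]

end

section
variable {H : Type w} [AddCommGroup H] [Module k H] [Coalgebra k H]

/-- The coefficient matrix of a comodule. -/
def coactMat (V : LeftComodule k H M) : Matrix ι ι H :=
  Matrix.of fun i j => tensorCoef b j (V.coact (b i))

lemma coact_basis (V : LeftComodule k H M) (i : ι) :
    V.coact (b i) = ∑ j, coactMat b V i j ⊗ₜ[k] b j :=
  (sum_tensorCoef b _).symm

lemma comul_coactMat (V : LeftComodule k H M) (i j : ι) :
    comul (R := k) (coactMat b V i j) = ∑ l, coactMat b V i l ⊗ₜ[k] coactMat b V l j := by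
  have h1 := congr((TensorProduct.assoc k H H M).symm ($(V.coassoc) (b i)))
  simp only [LinearMap.comp_apply, LinearEquiv.coe_coe, coact_basis, map_sum, LinearMap.rTensor_tmul,
    LinearMap.lTensor_tmul, LinearEquiv.symm_apply_apply, tmul_sum, assoc_symm_tmul] at h1
  rw [Finset.sum_comm] at h1
  simp only [← sum_tmul] at h1
  have h2 := congr(tensorCoef b j $h1)
  rwa [tensorCoef_sum, tensorCoef_sum] at h2

lemma counit_coactMat (V : LeftComodule k H M) (i j : ι) :
    counit (R := k) (coactMat b V i j) = (1 : Matrix ι ι k) i j := by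
  have h1 := congr(b.repr ($(V.counit_coact) (b i)) j)
  simp only [LinearMap.comp_apply, LinearEquiv.coe_coe, coact_basis, map_sum, LinearMap.rTensor_tmul,
    lid_tmul, LinearMap.id_apply, Basis.repr_self] at h1
  simpa [Finsupp.single_apply, Matrix.one_apply] using h1

/-- The comultiplication of a coefficient. -/
def coactRepr (V : LeftComodule k H M) (i j : ι) : Coalgebra.Repr k (coactMat b V i j) ι where
  index := Finset.univ
  left l := coactMat b V i l
  right l := coactMat b V l j
  eq := (comul_coactMat b V i j).symm

/-- The comodule with a given coefficient matrix. -/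
def comoduleOfMat (T : Matrix ι ι H)
    (hT : ∀ i j, comul (R := k) (T i j) = ∑ l, T i l ⊗ₜ[k] T l j)
    (hT' : ∀ i j, counit (R := k) (T i j) = (1 : Matrix ι ι k) i j) : LeftComodule k H M where
  coact := b.constr k fun i => ∑ j, T i j ⊗ₜ[k] b j
  coassoc := b.ext fun i => by
    simp only [LinearMap.comp_apply, Basis.constr_basis, map_sum, LinearMap.rTensor_tmul,
      LinearMap.lTensor_tmul, hT, sum_tmul, tmul_sum, LinearEquiv.coe_coe, assoc_tmul]
    exact Finset.sum_comm
  counit_coact := b.ext fun i => by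
    simp [LinearMap.comp_apply, Basis.constr_basis, hT', Matrix.one_apply]

lemma coactMat_comoduleOfMat (T : Matrix ι ι H)
    (hT : ∀ i j, comul (R := k) (T i j) = ∑ l, T i l ⊗ₜ[k] T l j)
    (hT' : ∀ i j, counit (R := k) (T i j) = (1 : Matrix ι ι k) i j) :
    coactMat b (comoduleOfMat b T hT hT') = T := by
  ext i j
  simp only [coactMat, comoduleOfMat, Matrix.of_apply, Basis.constr_basis, tensorCoef_sum]

end

section
variable {H : Type w} [Ring H]

lemma coactMat_mul_map_antipode [HopfAlgebra k H] (V : LeftComodule k H M) :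
    coactMat b V * (coactMat b V).map (HopfAlgebra.antipode k) = 1 := by
  ext i j
  rw [Matrix.mul_apply]
  have := HopfAlgebra.sum_mul_antipode_eq_smul (coactRepr b V i j)
  rw [counit_coactMat] at this
  refine this.trans ?_
  rw [Matrix.one_apply, Matrix.one_apply]
  split_ifs <;> simp

lemma map_antipode_mul_coactMat [HopfAlgebra k H] (V : LeftComodule k H M) :
    (coactMat b V).map (HopfAlgebra.antipode k) * coactMat b V = 1 := by
  ext i j
  rw [Matrix.mul_apply]
  have := HopfAlgebra.sum_antipode_mul_eq_smul (coactRepr b V i j)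
  rw [counit_coactMat] at this
  refine this.trans ?_
  rw [Matrix.one_apply, Matrix.one_apply]
  split_ifs <;> simp

variable [Bialgebra k H]

/-- The matrix of the action of an element. -/
abbrev actMat (ρ : H →ₐ[k] Module.End k M) : H →ₐ[k] Matrix ι ι k :=
  (LinearMap.toMatrixAlgEquiv b).toAlgHom.comp ρ

lemma act_basis (ρ : H →ₐ[k] Module.End k M) (h : H) (i : ι) :
    ρ h (b i) = ∑ p, actMat b ρ h p i • b p := by
  refine (b.sum_repr (ρ h (b i))).symm.trans ?_
  refine Finset.sum_congr rfl fun p _ => ?_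
  congr 1
  exact (LinearMap.toMatrixAlgEquiv_apply b _ _ _).symm

lemma ydLeft_basis (ρ : H →ₐ[k] Module.End k M) (V : LeftComodule k H M) {h : H} {κ : Type*}
    (𝓡 : Coalgebra.Repr k h κ) (i : ι) : ydLeft ρ V.coact (h ⊗ₜ b i) =
      ∑ j, (∑ x ∈ 𝓡.index, ∑ p, actMat b ρ (𝓡.left x) p i • (coactMat b V p j * 𝓡.right x)) ⊗ₜ b j := by
  simp only [ydLeft, LinearMap.comp_apply, LinearMap.rTensor_tmul, ← 𝓡.eq, map_sum, sum_tmul,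
    LinearEquiv.coe_coe, TensorProduct.comm_tmul, assoc_tmul, LinearMap.lTensor_tmul]
  rw [Finset.sum_comm]
  refine Finset.sum_congr rfl fun x _ => ?_
  have : actMap ρ (𝓡.left x ⊗ₜ b i) = ρ (𝓡.left x) (b i) := rfl
  rw [this, act_basis b ρ]
  simp only [map_sum, map_smul, coact_basis, tmul_sum, tmul_smul, Finset.smul_sum, assoc_symm_tmul,
    LinearMap.rTensor_tmul, LinearMap.comp_apply, LinearEquiv.coe_coe, TensorProduct.comm_tmul,
    LinearMap.mul'_apply, smul_tmul']
  rw [Finset.sum_comm]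
  simp only [smul_mul_assoc]

lemma ydRight_basis (ρ : H →ₐ[k] Module.End k M) (V : LeftComodule k H M) {h : H} {κ : Type*}
    (𝓡 : Coalgebra.Repr k h κ) (i : ι) : ydRight ρ V.coact (h ⊗ₜ b i) =
      ∑ j, (∑ x ∈ 𝓡.index, ∑ p, actMat b ρ (𝓡.right x) j p • (𝓡.left x * coactMat b V i p)) ⊗ₜ b j := by
  simp only [ydRight, LinearMap.comp_apply, TensorProduct.map_tmul, ← 𝓡.eq, coact_basis, map_sum,
    sum_tmul, tmul_sum, LinearEquiv.coe_coe, tensorTensorTensorComm_tmul, LinearMap.mul'_apply]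
  have : ∀ x p, actMap ρ (𝓡.right x ⊗ₜ b p) = ∑ j, actMat b ρ (𝓡.right x) j p • b j :=
    fun x p => act_basis b ρ _ _
  simp only [this, tmul_sum, tmul_smul, ← smul_tmul']
  rw [Finset.sum_comm]
  conv_rhs => rw [Finset.sum_comm]
  refine Finset.sum_congr rfl fun x _ => Finset.sum_comm

lemma yd_compat_iff (ρ : H →ₐ[k] Module.End k M) (V : LeftComodule k H M) :
    ydLeft ρ V.coact = ydRight ρ V.coact ↔ ∀ h i j,
      ∑ x ∈ (ℛ k h).index, ∑ p, actMat b ρ ((ℛ k h).left x) p i •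
        (coactMat b V p j * (ℛ k h).right x) =
      ∑ x ∈ (ℛ k h).index, ∑ p, actMat b ρ ((ℛ k h).right x) j p •
        ((ℛ k h).left x * coactMat b V i p) := by
  constructor
  · intro h0 h i j
    have := congr(tensorCoef b j ($h0 (h ⊗ₜ b i)))
    rwa [ydLeft_basis b ρ V (ℛ k h), ydRight_basis b ρ V (ℛ k h), tensorCoef_sum,
      tensorCoef_sum] at this
  · intro h0
    refine TensorProduct.ext' fun h m => ?_
    have : (ydLeft ρ V.coact) ∘ₗ TensorProduct.mk k H M h =
        (ydRight ρ V.coact) ∘ₗ TensorProduct.mk k H M h := b.ext fun i => by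
      simp only [LinearMap.comp_apply, TensorProduct.mk_apply]
      rw [ydLeft_basis b ρ V (ℛ k h), ydRight_basis b ρ V (ℛ k h)]
      simp only [h0]
    exact congr($this m)

lemma YetterDrinfeld.exchange (V : YetterDrinfeld k H M) {h : H} {κ : Type*}
    (𝓡 : Coalgebra.Repr k h κ) (i j : ι) :
      ∑ x ∈ 𝓡.index, ∑ p, actMat b V.act (𝓡.left x) p i •
        (coactMat b V.toLeftComodule p j * 𝓡.right x) =
      ∑ x ∈ 𝓡.index, ∑ p, actMat b V.act (𝓡.right x) j p •
        (𝓡.left x * coactMat b V.toLeftComodule i p) := by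
  have := congr(tensorCoef b j ($(V.compat) (h ⊗ₜ b i)))
  rwa [ydLeft_basis b _ V.toLeftComodule 𝓡, ydRight_basis b _ V.toLeftComodule 𝓡, tensorCoef_sum,
    tensorCoef_sum] at this

lemma YetterDrinfeld.braiding_basis (V : YetterDrinfeld k H M) (i j : ι) :
    V.braiding (b i ⊗ₜ b j) =
      ∑ p, V.act (coactMat b V.toLeftComodule i p) (b j) ⊗ₜ[k] b p := by
  simp only [YetterDrinfeld.braiding, LinearMap.comp_apply, LinearMap.rTensor_tmul, coact_basis,
    sum_tmul, map_sum, LinearEquiv.coe_coe, rightComm_tmul]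
  rfl

lemma YetterDrinfeld.actMat_coactMat {c : M ⊗[k] M ≃ₗ[k] M ⊗[k] M} (V : YetterDrinfeld k H M)
    (hV : V.braiding = c.toLinearMap) (i p : ι) :
    actMat b V.act (coactMat b V.toLeftComodule i p) = braidCoef c b i p := by
  ext q j
  have h1 := congr((b.tensorProduct b).repr ($hV (b i ⊗ₜ b j)) (q, p))
  rw [V.braiding_basis b] at h1
  simp only [map_sum, Finsupp.coe_finsetSum, Finset.sum_apply, Basis.tensorProduct_repr_tmul_apply,
    Basis.repr_self, Finsupp.single_apply] at h1
  refine Eq.trans ?_ h1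
  simp [LinearMap.toMatrixAlgEquiv_apply]

/-- The FRT relation is the Yetter-Drinfeld condition for h = T_xy, because T_xy acts by C_xy. -/
lemma YetterDrinfeld.braidMat_comm {c : M ⊗[k] M ≃ₗ[k] M ⊗[k] M} (V : YetterDrinfeld k H M)
    (hV : V.braiding = c.toLinearMap) :
    sc H (braidMat (braidCoef c b)) * kron (coactMat b V.toLeftComodule) =
      kron (coactMat b V.toLeftComodule) * sc H (braidMat (braidCoef c b)) := by
  ext ⟨x, i⟩ ⟨j, y⟩
  rw [Matrix.mul_apply, Matrix.mul_apply]
  have h1 := V.exchange b (coactRepr b V.toLeftComodule x y) i j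
  have hR : ∀ p q, braidMat (braidCoef c b) p q = braidCoef c b p.1 q.2 q.1 p.2 := fun _ _ => rfl
  simp only [coactRepr, V.actMat_coactMat b hV] at h1
  simp only [Matrix.map_apply, kron_apply, hR, Fintype.sum_prod_type]
  refine (Eq.trans ?_ h1).trans ?_
  · rw [Finset.sum_comm]
    exact Finset.sum_congr rfl fun _ _ => Finset.sum_congr rfl fun _ _ => (Algebra.smul_def _ _).symm
  · exact Finset.sum_congr rfl fun _ _ => Finset.sum_congr rfl fun _ _ =>
      (Algebra.smul_def _ _).trans (Algebra.commutes _ _)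

end
end CoefficientMatrix

/-! ### Comodules over coquasitriangular bialgebras are Yetter-Drinfeld modules -/

section FormYD

variable {ι : Type} [Fintype ι] [DecidableEq ι] {k : Type u} [Field k]
  {M : Type v} [AddCommGroup M] [Module k M] (b : Basis ι k M)
  {H : Type w} [Ring H] [Bialgebra k H] {r : H ⊗[k] H →ₗ[k] k} (hr : IsCoquasitriangular r)
  (V : LeftComodule k H M)

open WithConv

/-- The axiom ∇ᵒᵖ = r ⋆ ∇ ⋆ r⁻¹ convolved with r on the right. For g = T_ij it is the
Yetter-Drinfeld condition of the action defined by r. -/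
lemma IsCoquasitriangular.exchange (hr : IsCoquasitriangular r) {g h : H} {κ κ' : Type*} (𝓖 : Coalgebra.Repr k g κ)
    (𝓡 : Coalgebra.Repr k h κ') :
    ∑ x ∈ 𝓡.index, ∑ p ∈ 𝓖.index, r (𝓖.left p ⊗ₜ 𝓡.left x) • (𝓖.right p * 𝓡.right x) =
      ∑ x ∈ 𝓡.index, ∑ p ∈ 𝓖.index, r (𝓖.right p ⊗ₜ 𝓡.right x) • (𝓡.left x * 𝓖.left p) := by
  obtain ⟨s, -, h2, h3⟩ := hr.exists_inv
  have e4 : toConv (formToHom s) * toConv (formToHom r) = 1 :=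
    (map_mul (convPostcomp (Algebra.ofId k H)) (toConv s) (toConv r)).symm.trans
      ((congrArg (convPostcomp (Algebra.ofId k H)) h2).trans (map_one _))
  have h4 := congr(($h3 * toConv (formToHom r)).ofConv (g ⊗ₜ h))
  rw [mul_assoc, e4, mul_one, (𝓖.tmul 𝓡).convMul_apply, (𝓖.tmul 𝓡).convMul_apply] at h4
  simp only [Repr.tmul_index, Repr.tmul_left, Repr.tmul_right, Finset.sum_product] at h4
  rw [Finset.sum_comm, ← Finset.sum_comm (s := 𝓖.index)]
  refine (Eq.trans ?_ h4.symm).trans ?_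
  · refine Finset.sum_congr rfl fun i _ => Finset.sum_congr rfl fun j _ => ?_
    simp [formToHom, Algebra.algebraMap_eq_smul_one]
  · refine Finset.sum_congr rfl fun i _ => Finset.sum_congr rfl fun j _ => ?_
    simp [formToHom, Algebra.algebraMap_eq_smul_one]

lemma actMat_formAction (h : H) (p i : ι) :
    actMat b (formAction hr V) h p i = r (coactMat b V i p ⊗ₜ h) := by
  change LinearMap.toMatrixAlgEquiv b (formAction hr V h) p i = _
  rw [LinearMap.toMatrixAlgEquiv_apply]
  change b.repr (evalCoact V.coact ((curry r).flip h) (b i)) p = _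
  simp only [evalCoact, LinearMap.comp_apply, coact_basis b V, map_sum, LinearMap.rTensor_tmul,
    LinearEquiv.coe_coe, lid_tmul, map_smul, Basis.repr_self]
  simp [Finsupp.single_apply]

/-- A comodule over a coquasitriangular bialgebra is a Yetter-Drinfeld module. -/
def formYD : YetterDrinfeld k H M where
  toLeftComodule := V
  act := formAction hr V
  compat := by
    rw [yd_compat_iff b]
    intro h i j
    simp only [actMat_formAction]
    exact hr.exchange (coactRepr b V i j) (ℛ k h)

lemma formYD_act : (formYD b hr V).act = formAction hr V := rfl

lemma formBraiding_basis (i j : ι) : formBraiding r V.coact (b i ⊗ₜ b j) =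
    ∑ p, ∑ q, r (coactMat b V j q ⊗ₜ coactMat b V i p) • (b q ⊗ₜ[k] b p) := by
  simp only [formBraiding, LinearMap.comp_apply, TensorProduct.map_tmul, coact_basis b V, map_sum,
    sum_tmul, tmul_sum, LinearEquiv.coe_coe, tensorTensorTensorComm_tmul, TensorProduct.comm_tmul,
    lid_tmul]
  exact Finset.sum_comm

lemma formYD_braiding : (formYD b hr V).braiding = formBraiding r V.coact := by
  refine (b.tensorProduct b).ext fun ⟨i, j⟩ => ?_
  rw [Basis.tensorProduct_apply, YetterDrinfeld.braiding_basis b, formBraiding_basis]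
  refine Finset.sum_congr rfl fun p _ => ?_
  rw [act_basis b, sum_tmul]
  refine Finset.sum_congr rfl fun q _ => ?_
  rw [formYD_act, actMat_formAction, smul_tmul']
  rfl

end FormYD

/-! ### Existence of the FRT Hopf algebra -/

section Existence

variable {ι : Type} [Fintype ι] [DecidableEq ι] {k : Type u} [Field k]
  {M : Type v} [AddCommGroup M] [Module k M] {c : M ⊗[k] M ≃ₗ[k] M ⊗[k] M} (b : Basis ι k M)

/-- This is why `FRTAlg` is universal: its relations hold for T and S(T) in any such Hopf algebra.
-/
lemma YetterDrinfeld.isFRTPair {H : Type*} [Ring H] [HopfAlgebra k H] (V : YetterDrinfeld k H M)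
    (hV : V.braiding = c.toLinearMap) {C' : Matrix ι ι (Matrix ι ι k)} {G' : Matrix ι ι k}
    (hB : IsBraidSystem (braidCoef c b) C' (drinfeldMat C') G') :
    IsFRTPair (braidMat (braidCoef c b)) (drinfeldMat C') G' (coactMat b V.toLeftComodule)
      ((coactMat b V.toLeftComodule).map (HopfAlgebra.antipode k)) := by
  set T := coactMat b V.toLeftComodule
  set U := T.map (HopfAlgebra.antipode k) with hU
  have h1 : T * U = 1 := coactMat_mul_map_antipode b _
  have h2 : U * T = 1 := map_antipode_mul_coactMat b _
  have h3 := V.braidMat_comm b hV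
  have hconj := conj_drinfeldMat hB.pair.mul_eq hB.pair.mul_eq' h1 h2 h3
  have hs : sc H (drinfeldMat C') * sc H G' = 1 := by rw [← sc_mul, hB.inv, sc_one]
  have hs' : sc H G' * sc H (drinfeldMat C') = 1 := by
    rw [← sc_mul, mul_eq_one_comm.mp hB.inv, sc_one]
  -- Over H a one-sided inverse need not be two-sided. The matrix S(U)ᵀ is a two-sided inverse of
  -- Uᵀ, so it equals the left inverse supplied by `hconj`, and `conj'` follows.
  set X := (U.map (HopfAlgebra.antipode k))ᵀ with hX
  have anti : ∀ A B : Matrix ι ι H, A * B = 1 →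
      (B.map (HopfAlgebra.antipode k))ᵀ * (A.map (HopfAlgebra.antipode k))ᵀ = 1 := fun A B h => by
    ext i j
    have := congr(HopfAlgebra.antipode k ($h j i))
    rw [Matrix.mul_apply, map_sum] at this
    rw [Matrix.mul_apply]
    simp only [HopfAlgebra.antipode_mul_antidistrib] at this
    refine this.trans ?_
    rw [Matrix.one_apply, Matrix.one_apply, eq_comm]
    simp only [eq_comm]
    split_ifs <;> simp
  have h5 : X * Uᵀ = 1 := anti T U h1
  have h6 : Uᵀ * X = 1 := anti U T h2
  have h7 : (sc H G' * Tᵀ * sc H (drinfeldMat C')) * Uᵀ = 1 := by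
    rw [mul_assoc, mul_assoc, ← mul_assoc Tᵀ, hconj, hs']
  have h8 : sc H G' * Tᵀ * sc H (drinfeldMat C') = X := left_inv_eq_right_inv h7 h6
  refine ⟨h1, h2, hconj, ?_, h3⟩
  calc _ = (Uᵀ * (sc H G' * Tᵀ * sc H (drinfeldMat C'))) * sc H G' := by
        simp only [mul_assoc, hs, mul_one]
    _ = _ := by rw [h8, h6, one_mul]

variable {C' : Matrix ι ι (Matrix ι ι k)} {G' : Matrix ι ι k}

section
variable {R : Matrix (ι × ι) (ι × ι) k} {G : Matrix ι ι k}

/-- The canonical comodule over the FRT algebra. -/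
def FRTAlg.comodule : LeftComodule k (FRTAlg.{u, w} R G G') M :=
  comoduleOfMat b (FRTAlg.t R G G') FRTAlg.comul_t FRTAlg.counit_t

lemma FRTAlg.coactMat_comodule :
    coactMat b (FRTAlg.comodule.{u, v, w} (R := R) (G := G) (G' := G') b) = FRTAlg.t R G G' :=
  coactMat_comoduleOfMat b _ _ _

/-- An algebra map out of the FRT algebra which is compatible with the comultiplication on
generators is a map of bialgebras. -/
def FRTAlg.bialgHom {H : Type*} [Ring H] [Bialgebra k H] (f : FRTAlg.{u, w} R G G' →ₐ[k] H)
    (V : LeftComodule k H M) (hf : ∀ i j, f (FRTAlg.t R G G' i j) = coactMat b V i j) :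
    FRTAlg.{u, w} R G G' →ₐc[k] H :=
  BialgHom.ofAlgHom f
    (FRTAlg.algHom_ext fun i j => by
      simp only [AlgHom.comp_apply, hf, Bialgebra.counitAlgHom_apply, counit_coactMat,
        FRTAlg.counit_t])
    (FRTAlg.algHom_ext fun i j => by
      simp only [AlgHom.comp_apply, hf, Bialgebra.comulAlgHom_apply, comul_coactMat,
        FRTAlg.comul_t, map_sum, Algebra.TensorProduct.map_tmul])

end

lemma coact_eq_rTensor_iff {H H' : Type*} [AddCommGroup H] [Module k H] [Coalgebra k H]
    [AddCommGroup H'] [Module k H'] [Coalgebra k H'] (V : LeftComodule k H M)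
    (V' : LeftComodule k H' M) (f : H →ₗ[k] H') :
    V'.coact = f.rTensor M ∘ₗ V.coact ↔ ∀ i j, f (coactMat b V i j) = coactMat b V' i j := by
  constructor
  · intro h i j
    rw [coactMat, coactMat, Matrix.of_apply, Matrix.of_apply, h, LinearMap.comp_apply]
    generalize V.coact (b i) = z
    induction z with
    | zero => simp
    | add x y hx hy => simp only [map_add, hx, hy]
    | tmul x y => simp [tensorCoef_tmul]
  · intro h
    refine b.ext fun i => ?_
    simp only [LinearMap.comp_apply, coact_basis b V, coact_basis b V', map_sum,
      LinearMap.rTensor_tmul, h]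

variable [hG : Fact (drinfeldMat C' * G' = 1)]
  (hB : IsBraidSystem (braidCoef c b) C' (drinfeldMat C') G')

lemma FRTAlg.formBraiding_eq :
    formBraiding (homForm (FRTAlg.formHom.{u, w} hB)) (FRTAlg.comodule b).coact =
      c.toLinearMap := by
  refine (b.tensorProduct b).ext fun ⟨i, j⟩ => ?_
  rw [Basis.tensorProduct_apply, formBraiding_basis, LinearEquiv.coe_coe, braid_basis]
  rw [Finset.sum_comm]
  refine Finset.sum_congr rfl fun q _ => Finset.sum_congr rfl fun p _ => ?_
  rw [FRTAlg.coactMat_comodule, homForm_tmul, FRTAlg.formHom_t, FRTAlg.rep_t]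

/-- The FRT Hopf algebra of a rigid braiding. -/
def frtHopfAlgebra : FRTHopfAlgebra.{u, v, w} c where
  carrier := FRTAlg.{u, w} (braidMat (braidCoef c b)) (drinfeldMat C') G'
  form := homForm (FRTAlg.formHom hB)
  isCoquasitriangular := FRTAlg.isCoquasitriangular hB
  comodule := FRTAlg.comodule b
  formBraiding_eq := FRTAlg.formBraiding_eq b hB
  existsUnique_hom H _ _ V hV := by
    have hf : ∀ i j, FRTAlg.lift (V.isFRTPair b hV hB) (FRTAlg.t _ _ _ i j) =
        coactMat b V.toLeftComodule i j := FRTAlg.lift_t_apply _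
    refine ⟨FRTAlg.bialgHom b (FRTAlg.lift (V.isFRTPair b hV hB)) V.toLeftComodule hf,
      ⟨(coact_eq_rTensor_iff b _ V.toLeftComodule _).mpr fun i j => ?_, fun x m => ?_⟩,
      fun ψ hψ => ?_⟩
    · rw [FRTAlg.coactMat_comodule]
      exact hf i j
    · suffices actMat b (formAction (FRTAlg.isCoquasitriangular hB) (FRTAlg.comodule b)) =
          (actMat b V.act).comp (FRTAlg.lift (V.isFRTPair b hV hB)) by
        have h1 := congr($this x)
        exact congr($((LinearMap.toMatrixAlgEquiv b).injective h1) m)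
      refine FRTAlg.algHom_ext fun i j => ?_
      refine Eq.trans ?_ (((congrArg (actMat b V.act) (hf i j)).trans
        (V.actMat_coactMat b hV i j)).symm)
      ext p q
      rw [actMat_formAction, FRTAlg.coactMat_comodule, homForm_tmul, FRTAlg.formHom_t,
        FRTAlg.rep_t]
    · have h1 := (coact_eq_rTensor_iff b _ V.toLeftComodule _).mp hψ.1
      apply BialgHom.coe_toAlgHom_injective
      refine FRTAlg.algHom_ext fun i j => ?_
      have := h1 i j
      rw [FRTAlg.coactMat_comodule] at this
      exact this.trans (hf i j).symm

/-- Every FRT Hopf algebra is a quotient of the one constructed above. -/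
lemma exists_surjective_frtAlg
    (hB : IsBraidSystem (braidCoef c b) C' (drinfeldMat C') G') (F : FRTHopfAlgebra.{u, v, w} c) :
    ∃ ψ : FRTAlg.{u, w} (braidMat (braidCoef c b)) (drinfeldMat C') G' →ₐc[k] F.carrier,
      Function.Surjective ψ ∧ ∀ i j, ψ (FRTAlg.t _ _ _ i j) = coactMat b F.comodule i j := by
  obtain ⟨ψ, hψ, -⟩ := (frtHopfAlgebra b hB).existsUnique_hom F.carrier
    (formYD b F.isCoquasitriangular F.comodule) ((formYD_braiding b _ _).trans F.formBraiding_eq)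
  obtain ⟨φ, hφ, -⟩ := F.existsUnique_hom (frtHopfAlgebra b hB).carrier
    (formYD b (frtHopfAlgebra b hB).isCoquasitriangular (frtHopfAlgebra b hB).comodule)
    ((formYD_braiding b _ _).trans (frtHopfAlgebra b hB).formBraiding_eq)
  -- By uniqueness for F the composite ψ ∘ φ is the identity, so φ is a section of ψ.
  have huniq := (F.existsUnique_hom F.carrier
    (formYD b F.isCoquasitriangular F.comodule)
    ((formYD_braiding b _ _).trans F.formBraiding_eq)).unique (y₁ := ψ.comp φ)
    (y₂ := BialgHom.id k F.carrier)
    ⟨by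
      have h1 : F.comodule.coact = _ := hψ.1
      have h2 : (frtHopfAlgebra b hB).comodule.coact = _ := hφ.1
      change F.comodule.coact = _
      conv_lhs => rw [h1, h2]
      rw [← LinearMap.comp_assoc, ← LinearMap.rTensor_comp]
      rfl,
     fun x m => (hφ.2 x m).trans (hψ.2 (φ x) m)⟩
    ⟨by
      change F.comodule.coact = LinearMap.rTensor M LinearMap.id ∘ₗ _
      rw [LinearMap.rTensor_id, LinearMap.id_comp], fun x m => rfl⟩
  refine ⟨ψ, fun x => ⟨φ x, congr($huniq x)⟩, fun i j => ?_⟩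
  have := (coact_eq_rTensor_iff b _ _ _).mp hψ.1 i j
  rw [← FRTAlg.coactMat_comodule b]
  exact this

end Existence

/-! ### The antipode and the right radical -/

section Antipode

open WithConv

variable {k : Type u} [Field k] {H : Type*} [Ring H] [HopfAlgebra k H]

/-- Both sides are convolution inverses of Δ. Writing Δ as the product of the two inclusions H → H ⊗
H gives the inverse on the right as the reversed product of the inclusions composed with S. -/
lemma comul_comp_antipode : (comul (R := k) (A := H)) ∘ₗ HopfAlgebra.antipode k =
    TensorProduct.map (HopfAlgebra.antipode k) (HopfAlgebra.antipode k) ∘ₗ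
      (TensorProduct.comm k H H).toLinearMap ∘ₗ comul := by
  let i₁ : WithConv (H →ₗ[k] H) →ₐ[k] WithConv (H →ₗ[k] H ⊗[k] H) :=
    convPostcomp Algebra.TensorProduct.includeLeft
  let i₂ : WithConv (H →ₗ[k] H) →ₐ[k] WithConv (H →ₗ[k] H ⊗[k] H) :=
    convPostcomp Algebra.TensorProduct.includeRight
  set S : WithConv (H →ₗ[k] H) := toConv (HopfAlgebra.antipode k)
  set I : WithConv (H →ₗ[k] H) := toConv LinearMap.id
  have h1 : S * I = 1 := LinearMap.antipode_mul_id
  have hδ : i₁ I * i₂ I = toConv comul := by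
    ext h
    rw [(ℛ k h).convMul_apply]
    refine Eq.trans ?_ (ℛ k h).eq
    refine Finset.sum_congr rfl fun x _ => ?_
    change ((ℛ k h).left x ⊗ₜ[k] (1 : H)) * ((1 : H) ⊗ₜ[k] (ℛ k h).right x) = _
    simp
  have hS : i₂ S * i₁ S = toConv (TensorProduct.map (HopfAlgebra.antipode k)
      (HopfAlgebra.antipode k) ∘ₗ (TensorProduct.comm k H H).toLinearMap ∘ₗ comul) := by
    ext h
    rw [(ℛ k h).convMul_apply]
    change _ = TensorProduct.map (HopfAlgebra.antipode k)
      (HopfAlgebra.antipode k) (TensorProduct.comm k H H (comul h))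
    rw [← (ℛ k h).eq, map_sum, map_sum]
    refine Finset.sum_congr rfl fun x _ => ?_
    change ((1 : H) ⊗ₜ[k] HopfAlgebra.antipode k ((ℛ k h).left x)) *
      (HopfAlgebra.antipode k ((ℛ k h).right x) ⊗ₜ[k] (1 : H)) = _
    simp
  have h2 : (i₂ S * i₁ S) * toConv comul = 1 := by
    rw [← hδ, mul_assoc, ← mul_assoc (i₁ S), ← map_mul, h1, map_one, one_mul, ← map_mul, h1, map_one]
  have h3 := left_inv_eq_right_inv h2 (LinearMap.comul_right_inv (R := k) (C := H))
  rw [hS] at h3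
  exact (toConv_injective h3).symm

/-- The comultiplication of `S(h)`. -/
def antipodeRepr {h : H} {κ : Type*} (𝓡 : Coalgebra.Repr k h κ) :
    Coalgebra.Repr k (HopfAlgebra.antipode k h) κ where
  index := 𝓡.index
  left x := HopfAlgebra.antipode k (𝓡.right x)
  right x := HopfAlgebra.antipode k (𝓡.left x)
  eq := by
    have := congr($(comul_comp_antipode (k := k)) h)
    simp only [LinearMap.comp_apply, ← 𝓡.eq, map_sum] at this
    exact this.symm

lemma map_antipode {H' : Type*} [Ring H'] [HopfAlgebra k H'] (f : H →ₐc[k] H') (h : H) :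
    f (HopfAlgebra.antipode k h) = HopfAlgebra.antipode k (f h) := by
  have h1 : toConv ((f : H →ₐ[k] H').toLinearMap ∘ₗ HopfAlgebra.antipode k) *
      toConv ((f : H →ₐ[k] H').toLinearMap) = 1 := by
    have := congr(convPostcomp (f : H →ₐ[k] H') $(LinearMap.antipode_mul_id (R := k) (C := H)))
    rw [map_mul, map_one] at this
    exact this
  have h2 : toConv ((f : H →ₐ[k] H').toLinearMap) *
      toConv (HopfAlgebra.antipode k ∘ₗ (f : H →ₐ[k] H').toLinearMap) = 1 := by
    have := congr(convPrecomp f.toCoalgHom $(LinearMap.id_mul_antipode (R := k) (C := H')))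
    rw [map_mul, map_one] at this
    exact this
  have h3 := left_inv_eq_right_inv h1 h2
  exact congr(($h3).ofConv h)

variable {r : H ⊗[k] H →ₗ[k] k}

lemma IsCoquasitriangular.mul_left_repr (hr : IsCoquasitriangular r) (a b : H) {c : H} {κ : Type*}
    (𝓡 : Coalgebra.Repr k c κ) : r ((a * b) ⊗ₜ c) =
      ∑ x ∈ 𝓡.index, r (a ⊗ₜ 𝓡.left x) * r (b ⊗ₜ 𝓡.right x) := by
  rw [hr.mul_left, ← 𝓡.eq]
  simp

lemma IsCoquasitriangular.mul_right_repr (hr : IsCoquasitriangular r) {a : H} (b c : H) {κ : Type*}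
    (𝓡 : Coalgebra.Repr k a κ) : r (a ⊗ₜ (b * c)) =
      ∑ x ∈ 𝓡.index, r (𝓡.left x ⊗ₜ c) * r (𝓡.right x ⊗ₜ b) := by
  rw [hr.mul_right, ← 𝓡.eq]
  simp

lemma IsCoquasitriangular.one_tmul (hr : IsCoquasitriangular r) (a : H) :
    r (1 ⊗ₜ a) = counit (R := k) a := congr($(hr.apply_one_left) a)

lemma IsCoquasitriangular.tmul_one (hr : IsCoquasitriangular r) (a : H) :
    r (a ⊗ₜ 1) = counit (R := k) a := congr($(hr.apply_one_right) a)

/-- The form r(S(a) ⊗ b) has left inverse r ∘ (S ⊗ S), by `mul_right`, and right inverse r, by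
`mul_left`; so the two agree. -/
lemma IsCoquasitriangular.antipode_tmul_antipode (hr : IsCoquasitriangular r) (a b : H) :
    r (HopfAlgebra.antipode k a ⊗ₜ HopfAlgebra.antipode k b) = r (a ⊗ₜ b) := by
  let s : WithConv (H ⊗[k] H →ₗ[k] k) := toConv (r ∘ₗ (HopfAlgebra.antipode k).rTensor H)
  let s' : WithConv (H ⊗[k] H →ₗ[k] k) :=
    toConv (r ∘ₗ TensorProduct.map (HopfAlgebra.antipode k) (HopfAlgebra.antipode k))
  have h1 : s' * s = 1 := by
    ext a b
    change (s' * s).ofConv (a ⊗ₜ b) = counit (R := k) (a ⊗ₜ[k] b)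
    rw [((ℛ k a).tmul (ℛ k b)).convMul_apply, TensorProduct.counit_tmul]
    have h2 := congr(r (HopfAlgebra.antipode k a ⊗ₜ
      $(HopfAlgebra.sum_antipode_mul_eq_smul (ℛ k b))))
    simp only [tmul_sum, map_sum, hr.mul_right_repr _ _ (antipodeRepr (ℛ k a)), tmul_smul, map_smul,
      hr.tmul_one, HopfAlgebra.counit_antipode] at h2
    simp only [Repr.tmul_index, Repr.tmul_left, Repr.tmul_right, Finset.sum_product]
    rw [Finset.sum_comm]
    refine Eq.trans ?_ h2
    exact Finset.sum_congr rfl fun _ _ => Finset.sum_congr rfl fun _ _ => mul_comm _ _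
  have h2 : s * toConv r = 1 := by
    ext a b
    change (s * toConv r).ofConv (a ⊗ₜ b) = counit (R := k) (a ⊗ₜ[k] b)
    rw [((ℛ k a).tmul (ℛ k b)).convMul_apply, TensorProduct.counit_tmul]
    have h2 := congr(r ($(HopfAlgebra.sum_antipode_mul_eq_smul (ℛ k a)) ⊗ₜ b))
    simp only [sum_tmul, map_sum, hr.mul_left_repr _ _ (ℛ k b), ← smul_tmul', map_smul,
      hr.one_tmul] at h2
    simp only [Repr.tmul_index, Repr.tmul_left, Repr.tmul_right, Finset.sum_product]
    exact h2.trans (mul_comm _ _)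
  have h3 := left_inv_eq_right_inv h1 h2
  exact congr(($h3).ofConv (a ⊗ₜ b))

/-- If h is in J, then r(S(a) ⊗ S(h)) = r(a ⊗ h) = 0, and by surjectivity S(a) is an arbitrary
element. -/
lemma isHopfIdeal_rightRadical (hr : IsCoquasitriangular r)
    (hS : Function.Surjective (HopfAlgebra.antipode k (A := H))) :
    (rightRadical hr).IsHopfIdeal k where
  antipode_mem h hh a := by
    obtain ⟨a, rfl⟩ := hS a
    rw [hr.antipode_tmul_antipode]
    exact hh a

end Antipode

/-! ### Surjectivity of the antipode and the presentation of H(c) -/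

section

variable {ι : Type} [Fintype ι] [DecidableEq ι] {k : Type u} [Field k]

/-- Solving S(u)ᵀ = G' tᵀ G for t writes t as S of linear combinations of u; the range of S is
closed under products by antimultiplicativity. -/
lemma FRTAlg.antipode_surjective {R : Matrix (ι × ι) (ι × ι) k} {G G' : Matrix ι ι k}
    [hG : Fact (G * G' = 1)] :
    Function.Surjective (HopfAlgebra.antipode k (A := FRTAlg.{u, w} R G G')) := by
  intro a
  induction a using FRTAlg.induction with
  | ht i j =>
    set W : Matrix ι ι (FRTAlg.{u, w} R G G') :=
      sc _ G' * (t.{u, w} R G G')ᵀ * sc _ G with hW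
    have hs : sc (FRTAlg.{u, w} R G G') G * sc (FRTAlg.{u, w} R G G') G' = 1 := by
      rw [← sc_mul, hG.out, sc_one]
    have h1 : (t.{u, w} R G G')ᵀ = sc _ G * W * sc _ G' := by
      rw [hW]
      calc _ = (sc (FRTAlg.{u, w} R G G') G * sc (FRTAlg.{u, w} R G G') G') *
            (t.{u, w} R G G')ᵀ * (sc (FRTAlg.{u, w} R G G') G * sc (FRTAlg.{u, w} R G G') G') := by
            rw [hs, one_mul, mul_one]
        _ = _ := by simp only [mul_assoc]
    refine ⟨∑ p, ∑ q, (G j q * G' p i) • u R G G' p q, ?_⟩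
    rw [← Matrix.transpose_apply (t R G G'), h1, Matrix.mul_apply, map_sum]
    refine Finset.sum_congr rfl fun p _ => ?_
    rw [Matrix.mul_apply, Finset.sum_mul, map_sum]
    refine Finset.sum_congr rfl fun q _ => ?_
    rw [map_smul, antipode_u, ← hW, mul_smul, Algebra.smul_def, Algebra.smul_def,
      Algebra.commutes (G' p i), ← mul_assoc]
    rfl
  | hu i j => exact ⟨t R G G' i j, antipode_t i j⟩
  | hc c => exact ⟨algebraMap k _ c, by simp [Algebra.algebraMap_eq_smul_one]⟩
  | hadd a b ha hb =>
    obtain ⟨x, rfl⟩ := ha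
    obtain ⟨y, rfl⟩ := hb
    exact ⟨x + y, map_add _ _ _⟩
  | hmul a b ha hb =>
    obtain ⟨x, rfl⟩ := ha
    obtain ⟨y, rfl⟩ := hb
    exact ⟨y * x, HopfAlgebra.antipode_mul_antidistrib _ _⟩

variable {M : Type v} [AddCommGroup M] [Module k M] [FiniteDimensional k M]
  {c : M ⊗[k] M ≃ₗ[k] M ⊗[k] M} (b : Basis ι k M)

/-- Lets statements about an arbitrary H(c) be proved by induction on the generators T and S(T). -/
lemma exists_presentation (hc : IsBraiding c) (hr : IsRigid c) (F : FRTHopfAlgebra.{u, v, w} c) :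
    ∃ (R : Matrix (ι × ι) (ι × ι) k) (G G' : Matrix ι ι k) (_ : Fact (G * G' = 1))
      (ψ : FRTAlg.{u, w} R G G' →ₐc[k] F.carrier), Function.Surjective ψ ∧
        (∀ i j, ψ (FRTAlg.t _ _ _ i j) = coactMat b F.comodule i j) ∧
        (∀ i j, ψ (FRTAlg.u _ _ _ i j) = HopfAlgebra.antipode k (coactMat b F.comodule i j)) := by
  obtain ⟨C', G, G', hB, rfl⟩ := exists_isBraidSystem c b hc hr
  have hG : Fact (drinfeldMat C' * G' = 1) := ⟨hB.inv⟩
  obtain ⟨ψ, h1, h2⟩ := exists_surjective_frtAlg b hB F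
  refine ⟨_, _, _, hG, ψ, h1, h2, fun i j => ?_⟩
  rw [← h2, ← map_antipode, FRTAlg.antipode_t]

theorem nonempty_frtHopfAlgebra (hc : IsBraiding c) (hr : IsRigid c) :
    Nonempty (FRTHopfAlgebra.{u, v, w} c) := by
  obtain ⟨C', G, G', hB, rfl⟩ := exists_isBraidSystem c (finBasis k M) hc hr
  have hG : Fact (drinfeldMat C' * G' = 1) := ⟨hB.inv⟩
  exact ⟨frtHopfAlgebra (finBasis k M) hB⟩

lemma FRTHopfAlgebra.isHopfIdeal_radical (hc : IsBraiding c) (hr : IsRigid c)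
    (F : FRTHopfAlgebra.{u, v, w} c) : F.radical.IsHopfIdeal k := by
  obtain ⟨R, G, G', hG, ψ, h1, -, -⟩ := exists_presentation (finBasis k M) hc hr F
  refine isHopfIdeal_rightRadical _ fun a => ?_
  obtain ⟨x, rfl⟩ := h1 a
  obtain ⟨y, rfl⟩ := FRTAlg.antipode_surjective x
  exact ⟨ψ y, (map_antipode ψ y).symm⟩

end

/-! ### Quotients of Yetter-Drinfeld modules -/

section Quotient

variable {k : Type u} [Field k] {M : Type v} [AddCommGroup M] [Module k M]

section
variable {H : Type*} [AddCommGroup H] [Module k H] [Coalgebra k H] {H' : Type*} [AddCommGroup H']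
  [Module k H'] [Coalgebra k H']

/-- Corestriction of a comodule along a coalgebra map. -/
def LeftComodule.map (V : LeftComodule k H M) (f : H →ₗc[k] H') : LeftComodule k H' M where
  coact := f.toLinearMap.rTensor M ∘ₗ V.coact
  coassoc := by
    have h1 : (TensorProduct.assoc k H' H' M).toLinearMap ∘ₗ (comul (R := k)).rTensor M ∘ₗ
        f.toLinearMap.rTensor M = (TensorProduct.map f.toLinearMap (f.toLinearMap.rTensor M)) ∘ₗ
        (TensorProduct.assoc k H H M).toLinearMap ∘ₗ (comul (R := k)).rTensor M := by
      rw [← LinearMap.rTensor_comp, ← f.map_comp_comul, LinearMap.rTensor_comp]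
      have : (TensorProduct.assoc k H' H' M).toLinearMap ∘ₗ
          (TensorProduct.map f.toLinearMap f.toLinearMap).rTensor M =
          (TensorProduct.map f.toLinearMap (f.toLinearMap.rTensor M)) ∘ₗ
          (TensorProduct.assoc k H H M).toLinearMap := by
        ext; simp
      rw [← LinearMap.comp_assoc, this, LinearMap.comp_assoc]
    have h2 : TensorProduct.map f.toLinearMap (f.toLinearMap.rTensor M) ∘ₗ V.coact.lTensor H =
        (f.toLinearMap.rTensor M ∘ₗ V.coact).lTensor H' ∘ₗ f.toLinearMap.rTensor M := by
      ext; simp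
    calc _ = ((TensorProduct.assoc k H' H' M).toLinearMap ∘ₗ (comul (R := k)).rTensor M ∘ₗ
        f.toLinearMap.rTensor M) ∘ₗ V.coact := rfl
      _ = TensorProduct.map f.toLinearMap (f.toLinearMap.rTensor M) ∘ₗ
          ((TensorProduct.assoc k H H M).toLinearMap ∘ₗ (comul (R := k)).rTensor M ∘ₗ V.coact) := by
        rw [h1]; rfl
      _ = (TensorProduct.map f.toLinearMap (f.toLinearMap.rTensor M) ∘ₗ V.coact.lTensor H) ∘ₗ
          V.coact := by rw [V.coassoc]; rfl
      _ = _ := by rw [h2]; rfl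
  counit_coact := by
    have h1 : (counit (R := k)).rTensor M ∘ₗ f.toLinearMap.rTensor M =
        (counit (R := k) (A := H)).rTensor M := by
      rw [← LinearMap.rTensor_comp, f.counit_comp]
    calc _ = (TensorProduct.lid k M).toLinearMap ∘ₗ ((counit (R := k)).rTensor M ∘ₗ
        f.toLinearMap.rTensor M) ∘ₗ V.coact := rfl
      _ = _ := by rw [h1, V.counit_coact]

end

variable {H : Type*} [Ring H] [Bialgebra k H] {H' : Type*} [Ring H'] [Bialgebra k H']
  {ι : Type} [Fintype ι] [DecidableEq ι] (b : Basis ι k M)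

lemma coactMat_map (V : LeftComodule k H M) (f : H →ₐc[k] H') (i j : ι) :
    coactMat b (V.map f.toCoalgHom) i j = f (coactMat b V i j) :=
  ((coact_eq_rTensor_iff b V (V.map f.toCoalgHom) _).mp rfl i j).symm

/-- A Yetter-Drinfeld module structure pushed forward along a surjective map of bialgebras through
which the action factors. -/
def YetterDrinfeld.push (V : YetterDrinfeld k H M) (f : H →ₐc[k] H')
    (hf : Function.Surjective f) (ρ : H' →ₐ[k] Module.End k M) (hρ : ∀ h, ρ (f h) = V.act h) :
    YetterDrinfeld k H' M where
  toLeftComodule := V.toLeftComodule.map f.toCoalgHom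
  act := ρ
  compat := by
    refine TensorProduct.ext' fun h m => ?_
    obtain ⟨h, rfl⟩ := hf h
    have hρ' : ∀ h, actMat b ρ (f h) = actMat b V.act h := fun h => by
      simp [actMat, hρ]
    have : (ydLeft ρ (V.toLeftComodule.map f.toCoalgHom).coact) ∘ₗ TensorProduct.mk k H' M (f h) =
        (ydRight ρ (V.toLeftComodule.map f.toCoalgHom).coact) ∘ₗ TensorProduct.mk k H' M (f h) :=
      b.ext fun i => by
        simp only [LinearMap.comp_apply, TensorProduct.mk_apply]
        rw [ydLeft_basis b ρ _ ((ℛ k h).induced f), ydRight_basis b ρ _ ((ℛ k h).induced f)]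
        refine Finset.sum_congr rfl fun j _ => congrArg (· ⊗ₜ[k] b j) ?_
        have := congr(f $(V.exchange b (ℛ k h) i j))
        simp only [map_sum, map_smul, map_mul] at this
        simpa only [Repr.induced, hρ', coactMat_map, Function.comp_apply] using this
    exact congr($this m)

lemma YetterDrinfeld.braiding_push (V : YetterDrinfeld k H M) (f : H →ₐc[k] H')
    (hf : Function.Surjective f) (ρ : H' →ₐ[k] Module.End k M) (hρ : ∀ h, ρ (f h) = V.act h) :
    (V.push b f hf ρ hρ).braiding = V.braiding := by
  refine (b.tensorProduct b).ext fun ⟨i, j⟩ => ?_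
  rw [Basis.tensorProduct_apply, braiding_basis b, braiding_basis b]
  refine Finset.sum_congr rfl fun p _ => ?_
  rw [← hρ, ← coactMat_map]
  rfl

/-- The braiding as the braiding of a Yetter-Drinfeld module over the reduced FRT Hopf algebra. -/
def FRTHopfAlgebra.redYD {c : M ⊗[k] M ≃ₗ[k] M ⊗[k] M} (F : FRTHopfAlgebra.{u, v, w} c) :
    YetterDrinfeld k F.Red M :=
  (formYD b F.isCoquasitriangular F.comodule).push b
    (Bialgebra.Quotient.mkBialgHom (rightRadical F.isCoquasitriangular))
    Ideal.Quotient.mk_surjective F.redAction fun _ => rfl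

lemma FRTHopfAlgebra.redYD_braiding {c : M ⊗[k] M ≃ₗ[k] M ⊗[k] M}
    (F : FRTHopfAlgebra.{u, v, w} c) : (F.redYD b).braiding = c.toLinearMap :=
  (YetterDrinfeld.braiding_push b _ _ _ _ _).trans
    ((formYD_braiding b _ _).trans F.formBraiding_eq)

end Quotient

/-! ### Comodules over pointed coalgebras -/

section Pointed

variable {k : Type u} [Field k]

lemma eq_of_forall_dual {N : Type*} [AddCommGroup N] [Module k N] {x y : N}
    (h : ∀ φ : N →ₗ[k] k, φ x = φ y) : x = y :=
  sub_eq_zero.mp ((Module.forall_dual_apply_eq_zero_iff k _).mp fun φ => by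
    rw [map_sub, h, sub_self])

section Coalg
variable {C : Type*} [AddCommGroup C] [Module k C] [Coalgebra k C]

/-- The operator `x ↦ φ(x₍₁₎) x₍₂₎`. -/
def contrLeft (φ : C →ₗ[k] k) : C →ₗ[k] C :=
  (TensorProduct.lid k C).toLinearMap ∘ₗ φ.rTensor C ∘ₗ comul

/-- The operator `x ↦ x₍₁₎ φ(x₍₂₎)`. -/
def contrRight (φ : C →ₗ[k] k) : C →ₗ[k] C :=
  (TensorProduct.rid k C).toLinearMap ∘ₗ φ.lTensor C ∘ₗ comul

lemma apply_contrLeft (φ ψ : C →ₗ[k] k) (x : C) :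
    ψ (contrLeft φ x) = LinearMap.mul' k k (TensorProduct.map φ ψ (comul x)) := by
  change ψ (TensorProduct.lid k C (φ.rTensor C (comul x))) = _
  induction comul (R := k) x with
  | zero => simp
  | add x y hx hy => simp only [map_add, hx, hy]
  | tmul x y => simp

lemma apply_contrRight (φ ψ : C →ₗ[k] k) (x : C) :
    ψ (contrRight φ x) = LinearMap.mul' k k (TensorProduct.map ψ φ (comul x)) := by
  change ψ (TensorProduct.rid k C (φ.lTensor C (comul x))) = _
  induction comul (R := k) x with
  | zero => simp
  | add x y hx hy => simp only [map_add, hx, hy]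
  | tmul x y => simp [mul_comm]

lemma contrLeft_of_isGroupLikeElem {g : C} (hg : IsGroupLikeElem k g) (φ : C →ₗ[k] k) :
    contrLeft φ g = φ g • g := by
  simp [contrLeft, hg.comul_eq_tmul_self]

/-- A tensor lies in D ⊗ D when all its slices on both sides lie in D: for a projection P onto D,
functionals tested one leg at a time show that P ⊗ P fixes Δ(x). -/
lemma isSubcoalgebra_iff (D : Submodule k C) : IsSubcoalgebra k D ↔
    ∀ x ∈ D, ∀ φ : C →ₗ[k] k, contrLeft φ x ∈ D ∧ contrRight φ x ∈ D := by
  constructor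
  · intro h x hx φ
    obtain ⟨z, hz⟩ := h x hx
    simp only [contrLeft, contrRight, LinearMap.comp_apply, ← hz]
    clear hz
    induction z with
    | zero => simp
    | add z z' hz hz' =>
      simp only [map_add]
      exact ⟨D.add_mem hz.1 hz'.1, D.add_mem hz.2 hz'.2⟩
    | tmul z z' =>
      constructor
      · simpa using D.smul_mem _ z'.2
      · simpa using D.smul_mem _ z.2
  · intro h x hx
    obtain ⟨p, hp⟩ := D.exists_isCompl
    obtain ⟨f, hf⟩ := D.subtype.exists_leftInverse_of_injective D.ker_subtype
    set P : C →ₗ[k] C := D.subtype ∘ₗ f with hP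
    have hPD : ∀ y ∈ D, P y = y := fun y hy => congr((($hf ⟨y, hy⟩ : D) : C))
    have key : TensorProduct.map P P (comul x) = comul (R := k) x := by
      rw [← sub_eq_zero]
      refine eq_zero_of_forall_map_eq_zero (fun φ : C →ₗ[k] k => φ)
        (fun q hq => (Module.forall_dual_apply_eq_zero_iff k _).mp hq) _ fun a b => ?_
      rw [map_sub, map_sub, sub_eq_zero, ← LinearMap.comp_apply (TensorProduct.map a b),
        ← TensorProduct.map_comp, ← apply_contrLeft, LinearMap.comp_apply,
        hPD _ (h x hx _).1, apply_contrLeft, ← apply_contrRight, LinearMap.comp_apply,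
        hPD _ (h x hx _).2, apply_contrRight]
    refine ⟨TensorProduct.map f f (comul x), ?_⟩
    rw [← LinearMap.comp_apply, ← TensorProduct.map_comp]
    exact key

lemma isSubcoalgebra_span_singleton {g : C} (hg : IsGroupLikeElem k g) :
    IsSubcoalgebra k (Submodule.span k {g}) := by
  intro x hx
  obtain ⟨a, rfl⟩ := Submodule.mem_span_singleton.mp hx
  have hgm := Submodule.mem_span_singleton_self (R := k) g
  refine ⟨a • ((⟨g, hgm⟩ : Submodule.span k {g}) ⊗ₜ (⟨g, hgm⟩ : Submodule.span k {g})), ?_⟩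
  simp [hg.comul_eq_tmul_self]

lemma isSimpleSubcoalgebra_span_singleton {g : C} (hg : IsGroupLikeElem k g) :
    IsSimpleSubcoalgebra k (Submodule.span k {g}) := by
  have hg0 : g ≠ 0 := by
    rintro rfl
    simpa using hg.counit_eq_one
  refine ⟨isSubcoalgebra_span_singleton hg, by simpa using hg0, fun E _ hE => ?_⟩
  exact (nonzero_span_atom g hg0).le_iff.mp hE

lemma mem_coradical {g : C} (hg : IsGroupLikeElem k g) : g ∈ coradical k C :=
  (le_sSup (isSimpleSubcoalgebra_span_singleton hg) : _ ≤ coradical k C)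
    (Submodule.mem_span_singleton_self g)

lemma exists_isGroupLikeElem_of_finrank_eq_one {D : Submodule k C} (hD : IsSubcoalgebra k D)
    (h1 : finrank k D = 1) : ∃ g, IsGroupLikeElem k g ∧ D = Submodule.span k {g} := by
  obtain ⟨⟨v, hv⟩, hv0, hvs⟩ := finrank_eq_one_iff'.mp h1
  have hspan : D = Submodule.span k {v} := by
    apply le_antisymm
    · intro y hy
      obtain ⟨a, ha⟩ := hvs ⟨y, hy⟩
      exact Submodule.mem_span_singleton.mpr ⟨a, congr(($ha : D))⟩
    · simpa using hv
  obtain ⟨z, hz⟩ := hD v hv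
  obtain ⟨a, ha⟩ : ∃ a : k, comul (R := k) v = a • (v ⊗ₜ[k] v) := by
    rw [← hz]
    clear hz
    induction z with
    | zero => exact ⟨0, by simp⟩
    | add z z' hz hz' =>
      obtain ⟨a, ha⟩ := hz
      obtain ⟨a', ha'⟩ := hz'
      exact ⟨a + a', by rw [map_add, ha, ha', add_smul]⟩
    | tmul z z' =>
      obtain ⟨a, ha⟩ := hvs z
      obtain ⟨a', ha'⟩ := hvs z'
      refine ⟨a * a', ?_⟩
      rw [← ha, ← ha', TensorProduct.map_tmul]
      simp [smul_tmul', tmul_smul, smul_smul, mul_comm]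
  have hv' : v ≠ 0 := fun h => hv0 (Subtype.ext h)
  have h2 : (a * counit (R := k) v) • v = v := by
    have := rTensor_counit_comul (R := k) v
    rw [ha] at this
    have := congr(TensorProduct.lid k C $this)
    simpa [smul_smul] using this
  have h3 : a * counit (R := k) v = 1 := by
    by_contra h
    have : (a * counit (R := k) v - 1) • v = 0 := by rw [sub_smul, h2, one_smul, sub_self]
    rcases smul_eq_zero.mp this with h' | h'
    · exact h (sub_eq_zero.mp h')
    · exact hv' h'
  have ha0 : a ≠ 0 := fun h => by simp [h] at h3
  -- With Δ(v) = a v ⊗ v, scaling by a makes v grouplike.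
  refine ⟨a • v, ⟨by simpa using h3, ?_⟩, ?_⟩
  · rw [map_smul, ha]
    simp [smul_tmul', tmul_smul, smul_smul]
  · rw [hspan, Submodule.span_singleton_smul_eq (IsUnit.mk0 a ha0)]

lemma exists_isSimpleSubcoalgebra_le {D : Submodule k C} (hD : IsSubcoalgebra k D) (h0 : D ≠ ⊥)
    [FiniteDimensional k D] : ∃ E ≤ D, IsSimpleSubcoalgebra k E := by
  obtain ⟨n, hn⟩ : ∃ n, finrank k D = n := ⟨_, rfl⟩
  induction n using Nat.strong_induction_on generalizing D with
  | _ n ih =>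
    by_cases h : IsSimpleSubcoalgebra k D
    · exact ⟨D, le_rfl, h⟩
    · have : ∃ E, IsSubcoalgebra k E ∧ E ≤ D ∧ E ≠ ⊥ ∧ E ≠ D := by
        by_contra! h'
        exact h ⟨hD, h0, fun E hE hED => or_iff_not_imp_left.mpr (h' E hE hED)⟩
      obtain ⟨E, hE, hED, hE0, hne⟩ := this
      have : FiniteDimensional k E := Submodule.finiteDimensional_of_le hED
      have hlt := Submodule.finrank_lt_finrank_of_lt (lt_of_le_of_ne hED hne)
      obtain ⟨E', h1, h2⟩ := ih _ (hn ▸ hlt) hE hE0 rfl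
      exact ⟨E', h1.trans hED, h2⟩

lemma IsPointed.exists_isGroupLikeElem_mem (hp : IsPointed k C) {D : Submodule k C}
    (hD : IsSubcoalgebra k D) (h0 : D ≠ ⊥) [FiniteDimensional k D] :
    ∃ g ∈ D, IsGroupLikeElem k g := by
  obtain ⟨E, hE, hs⟩ := exists_isSimpleSubcoalgebra_le hD h0
  obtain ⟨g, hg, rfl⟩ := exists_isGroupLikeElem_of_finrank_eq_one hs.1 (hp E hs)
  exact ⟨g, hE (Submodule.mem_span_singleton_self g), hg⟩

end Coalg

section Comod
variable {H : Type w} [Ring H] [Bialgebra k H] {M : Type v} [AddCommGroup M] [Module k M]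
  (V : LeftComodule k H M)

/-- The operator `m ↦ φ(m₍₋₁₎) m₍₀₎`. -/
abbrev LeftComodule.op (φ : H →ₗ[k] k) : M →ₗ[k] M := evalCoact V.coact φ

/-- The map `m ↦ m₍₋₁₎ φ(m₍₀₎)`. -/
def LeftComodule.coef (l : M →ₗ[k] k) : M →ₗ[k] H :=
  (TensorProduct.rid k H).toLinearMap ∘ₗ l.lTensor H ∘ₗ V.coact

lemma LeftComodule.apply_coef (l : M →ₗ[k] k) (φ : H →ₗ[k] k) (m : M) :
    φ (V.coef l m) = l (V.op φ m) := by
  simp only [LeftComodule.coef, evalCoact, LinearMap.comp_apply]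
  induction V.coact m with
  | zero => simp
  | add x y hx hy => simp only [map_add, hx, hy]
  | tmul x y => simp [mul_comm]

/-- By coassociativity, taking coefficients with a fixed l is a comodule map from M to H. -/
lemma LeftComodule.coef_op (l : M →ₗ[k] k) (φ : H →ₗ[k] k) (m : M) :
    V.coef l (V.op φ m) = contrLeft φ (V.coef l m) :=
  eq_of_forall_dual fun ψ => by
    rw [apply_coef, apply_contrLeft]
    have h1 := congr(l ($(evalCoact_comp V ψ φ) m))
    rw [← V.apply_coef] at h1
    exact h1

/-- Slicing on the other side only changes the functional l. Together with `coef_op` this makes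
spaces of coefficients into subcoalgebras. -/
lemma LeftComodule.contrRight_coef (l : M →ₗ[k] k) (φ : H →ₗ[k] k) (m : M) :
    contrRight φ (V.coef l m) = V.coef (l ∘ₗ V.op φ) m :=
  eq_of_forall_dual fun ψ => by
    rw [apply_coef, apply_contrRight]
    have h1 := congr(l ($(evalCoact_comp V φ ψ) m))
    rw [← V.apply_coef] at h1
    exact h1.symm

/-- A subspace is a subcomodule if it is stable under all operators `m ↦ φ(m₍₋₁₎) m₍₀₎`. -/
def LeftComodule.IsSub (N : Submodule k M) : Prop := ∀ φ : H →ₗ[k] k, ∀ m ∈ N, V.op φ m ∈ N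

lemma LeftComodule.coef_eq_zero {N : Submodule k M} (hN : V.IsSub N) {l : M →ₗ[k] k}
    (hl : ∀ m ∈ N, l m = 0) {m : M} (hm : m ∈ N) : V.coef l m = 0 :=
  eq_of_forall_dual fun φ => by rw [apply_coef, hl _ (hN φ m hm), map_zero]

lemma LeftComodule.op_counit (m : M) : V.op (counit (R := k)) m = m := congr($(V.counit_coact) m)

variable [FiniteDimensional k M]

/-- The conclusion describes a one-dimensional subcomodule of M/N. Choose Q/N simple; its
coefficient coalgebra is finite-dimensional and nonzero, hence contains a grouplike g. This
coalgebra is a sum of images of Q/N under comodule maps, so simplicity forces a copy of kg in Q/N.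
-/
theorem LeftComodule.exists_isGroupLikeElem (hp : IsPointed k H) {N : Submodule k M}
    (hN : V.IsSub N) (hN' : N ≠ ⊤) : ∃ g : H, IsGroupLikeElem k g ∧ ∃ m ∉ N,
      ∀ φ : H →ₗ[k] k, V.op φ m - φ g • m ∈ N := by
  obtain ⟨Q, ⟨hQs, hNQ⟩, hmin⟩ : ∃ Q, Minimal (fun Q => V.IsSub Q ∧ N < Q) Q := by
    have : ∃ Q, V.IsSub Q ∧ N < Q := ⟨⊤, fun _ _ _ => trivial, lt_top_iff_ne_top.mpr hN'⟩
    obtain ⟨Q, hQ⟩ := this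
    obtain ⟨Q', -, h⟩ := exists_minimal_le_of_wellFoundedLT (fun Q => V.IsSub Q ∧ N < Q) Q hQ
    exact ⟨Q', h⟩
  let W := N.dualAnnihilator
  have : Module.Free k W := Module.Free.of_divisionRing k W
  have : FiniteDimensional k (Dual k M) := inferInstance
  have : FiniteDimensional k W := FiniteDimensional.finiteDimensional_submodule W
  let l := finBasis k W
  have hl : ∀ j, ∀ m ∈ N, (l j : Dual k M) m = 0 := fun j =>
    (Submodule.mem_dualAnnihilator _).mp (l j).2
  -- The functionals l j form a basis of the annihilator of N, so `D Finset.univ` is the coefficient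
  -- coalgebra of Q/N. The partial sums are kept for the induction.
  let D : Finset (Fin (finrank k W)) → Submodule k H :=
    fun s => ⨆ j ∈ s, Q.map (V.coef (l j : Dual k M))
  have hDinv : ∀ s φ, ∀ x ∈ D s, contrLeft φ x ∈ D s := fun s φ => by
    suffices D s ≤ (D s).comap (contrLeft φ) from this
    refine iSup₂_le fun j hj => ?_
    rintro _ ⟨q, hq, rfl⟩
    rw [Submodule.mem_comap, ← V.coef_op]
    exact Submodule.mem_iSup_of_mem j (Submodule.mem_iSup_of_mem hj ⟨_, hQs φ q hq, rfl⟩)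
  have hmemD : ∀ l' ∈ W, ∀ q ∈ Q, V.coef l' q ∈ D Finset.univ := fun l' hl' q hq => by
    have h1 := l.sum_repr ⟨l', hl'⟩
    have h2 : V.coef l' q = ∑ j, l.repr ⟨l', hl'⟩ j • V.coef (l j : Dual k M) q := by
      refine eq_of_forall_dual (k := k) fun φ => ?_
      have := congr((($h1 : W) : Dual k M) (V.op φ q))
      simp only [Submodule.coe_sum, Submodule.coe_smul, LinearMap.sum_apply,
        LinearMap.smul_apply] at this
      simp only [map_sum, map_smul, V.apply_coef]
      exact this.symm
    rw [h2]
    exact Submodule.sum_mem _ fun j _ => Submodule.smul_mem _ _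
      (Submodule.mem_iSup_of_mem j (Submodule.mem_iSup_of_mem (Finset.mem_univ j) ⟨q, hq, rfl⟩))
  have hDsub : IsSubcoalgebra k (D Finset.univ) := by
    rw [isSubcoalgebra_iff]
    intro x hx φ
    refine ⟨hDinv _ φ x hx, ?_⟩
    revert x
    suffices D Finset.univ ≤ (D Finset.univ).comap (contrRight φ) from this
    refine iSup₂_le fun j hj => ?_
    rintro _ ⟨q, hq, rfl⟩
    rw [Submodule.mem_comap, V.contrRight_coef]
    refine hmemD _ ?_ q hq
    exact (Submodule.mem_dualAnnihilator _).mpr fun m hm => hl j _ (hN φ m hm)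
  have hDfin : FiniteDimensional k (D Finset.univ) := by
    have : D Finset.univ = ⨆ j, Q.map (V.coef (l j : Dual k M)) := by simp [D]
    rw [this]
    infer_instance
  have hD0 : D Finset.univ ≠ ⊥ := fun h0 => by
    obtain ⟨q, hq, hqN⟩ := SetLike.exists_of_lt hNQ
    obtain ⟨f, hf, hf'⟩ := Submodule.exists_dual_map_eq_bot_of_notMem hqN inferInstance
    have hfW : f ∈ W := (Submodule.mem_dualAnnihilator _).mpr fun m hm => by
      have : f m ∈ N.map f := ⟨m, hm, rfl⟩
      rwa [hf', Submodule.mem_bot] at this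
    have h1 := hmemD f hfW q hq
    rw [h0, Submodule.mem_bot] at h1
    apply hf
    rw [← V.op_counit q, ← V.apply_coef, h1, map_zero]
  obtain ⟨g, hgD, hg⟩ := hp.exists_isGroupLikeElem_mem hDsub hD0
  refine ⟨g, hg, ?_⟩
  have key : ∀ s, g ∈ D s → ∃ m ∉ N, ∀ φ : H →ₗ[k] k, V.op φ m - φ g • m ∈ N := fun s => by
    induction s using Finset.induction_on with
    | empty =>
      intro h
      have : g = 0 := by simpa [D] using h
      simpa [this] using hg.counit_eq_one
    | insert j s hj ih =>
      intro h
      have hDi : D (insert j s) = Q.map (V.coef (l j : Dual k M)) ⊔ D s := by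
        simp only [D, Finset.iSup_insert]
      -- By minimality of Q the subcomodule `K` is N or Q. If it is Q, the j-th summand is
      -- redundant. If it is N and g is the sum of the coefficient of v and some d in `D s`, then v
      -- has label g modulo N, unless v is in N and g = d.
      let K : Submodule k M := Q ⊓ (D s).comap (V.coef (l j : Dual k M))
      have hK : V.IsSub K := fun φ m hm =>
        ⟨hQs φ m hm.1, by
          change V.coef (l j : Dual k M) _ ∈ D s
          rw [V.coef_op]
          exact hDinv s φ _ hm.2⟩
      have hNK : N ≤ K := fun m hm => ⟨hNQ.le hm, by
        change V.coef (l j : Dual k M) _ ∈ D s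
        rw [V.coef_eq_zero hN (hl j) hm]
        exact zero_mem _⟩
      rcases hNK.eq_or_lt with hNK | hNK
      · rw [hDi, Submodule.mem_sup] at h
        obtain ⟨_, ⟨v, hv, rfl⟩, d, hd, hgd⟩ := h
        by_cases hvN : v ∈ N
        · rw [V.coef_eq_zero hN (hl j) hvN, zero_add] at hgd
          exact ih (hgd ▸ hd)
        · refine ⟨v, hvN, fun φ => ?_⟩
          rw [hNK]
          refine ⟨Q.sub_mem (hQs φ v hv) (Q.smul_mem _ hv), ?_⟩
          change V.coef (l j : Dual k M) _ ∈ D s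
          rw [map_sub, map_smul, V.coef_op, eq_sub_of_add_eq hgd, map_sub, smul_sub,
            contrLeft_of_isGroupLikeElem hg, sub_sub_sub_cancel_left]
          exact (D s).sub_mem ((D s).smul_mem _ hd) (hDinv s φ d hd)
      · have hQK := hmin ⟨hK, hNK⟩ inf_le_left
        refine ih ?_
        rw [hDi] at h
        have : Q.map (V.coef (l j : Dual k M)) ≤ D s := Submodule.map_le_iff_le_comap.mpr
          (hQK.trans inf_le_right)
        rwa [sup_eq_right.mpr this] at h
  exact key _ hgD

end Comod
end Pointed

/-! ### From pointed Hopf algebras to triangular braidings -/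

section Diagonal

variable {k : Type u} [Field k] {M : Type v} [AddCommGroup M] [Module k M]

/-- If a subspace `P` is stable under a diagonal action and not contained in `N`, then it contains a
simultaneous eigenvector outside of `N`. -/
lemma ActsDiagonally.exists_mem_simultaneousEigenspace {G : Type*} [Monoid G]
    {ρ : G →* Module.End k M} (hρ : ActsDiagonally ρ) {P N : Submodule k M}
    (hP : ∀ g, ∀ m ∈ P, ρ g m ∈ P) {m : M} (hm : m ∈ P) (hmN : m ∉ N) :
    ∃ χ : G →* k, ∃ v ∈ simultaneousEigenspace ρ χ, v ∈ P ∧ v ∉ N := by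
  classical
  have hm' : m ∈ ⨆ χ : G →* k, simultaneousEigenspace ρ χ := by
    rw [DirectSum.IsInternal.submodule_iSup_eq_top hρ]
    trivial
  obtain ⟨f, hf, hfm⟩ := (Submodule.mem_iSup_iff_exists_finsupp _ _).mp hm'
  have key : ∀ n, ∀ s : Finset (G →* k), s.card = n → ∀ f : (G →* k) → M,
      (∀ χ, f χ ∈ simultaneousEigenspace ρ χ) → ∑ χ ∈ s, f χ ∈ P → ∑ χ ∈ s, f χ ∉ N →
      ∃ χ : G →* k, ∃ v ∈ simultaneousEigenspace ρ χ, v ∈ P ∧ v ∉ N := by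
    intro n
    induction n with
    | zero =>
      intro s hs f hf h1 h2
      rw [Finset.card_eq_zero.mp hs] at h2
      exact absurd (zero_mem N) h2
    | succ n ih =>
      intro s hs f hf h1 h2
      by_cases hn : ∃ χ ∈ s, ∃ χ' ∈ s, χ ≠ χ'
      · obtain ⟨χ, hχ, χ', hχ', hne⟩ := hn
        obtain ⟨g, hg⟩ : ∃ g, χ g ≠ χ' g := by
          by_contra! h
          exact hne (MonoidHom.ext h)
        -- Applying ρ(g) - χ(g) removes the χ-component and rescales the others, leaving one
        -- eigenvector fewer.
        have step : ∀ χ ∈ s, ρ g (∑ ψ ∈ s, f ψ) - χ g • ∑ ψ ∈ s, f ψ ∉ N →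
            ∃ χ : G →* k, ∃ v ∈ simultaneousEigenspace ρ χ, v ∈ P ∧ v ∉ N := by
          intro χ hχ h
          have e : ρ g (∑ ψ ∈ s, f ψ) - χ g • ∑ ψ ∈ s, f ψ =
              ∑ ψ ∈ s.erase χ, (ψ g - χ g) • f ψ := by
            rw [map_sum, Finset.smul_sum, ← Finset.sum_sub_distrib, ← Finset.add_sum_erase s _ hχ]
            have : ∀ ψ, ρ g (f ψ) - χ g • f ψ = (ψ g - χ g) • f ψ := fun ψ => by
              rw [hf ψ g, sub_smul]
            simp only [this, sub_self, zero_smul, zero_add]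
          refine ih (s.erase χ) (by rw [Finset.card_erase_of_mem hχ, hs]; rfl)
            (fun ψ => (ψ g - χ g) • f ψ) (fun ψ => Submodule.smul_mem _ _ (hf ψ)) ?_ ?_
          · rw [← e]
            exact P.sub_mem (hP g _ h1) (P.smul_mem _ h1)
          · rwa [← e]
        -- The vectors reduced by χ and by χ' differ by a nonzero multiple of the original one, so
        -- they cannot both lie in N.
        by_cases hχN : ρ g (∑ ψ ∈ s, f ψ) - χ g • ∑ ψ ∈ s, f ψ ∈ N
        · refine step χ' hχ' fun h => h2 ?_
          have h3 := N.sub_mem hχN h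
          rw [sub_sub_sub_cancel_left, ← sub_smul] at h3
          exact (Submodule.smul_mem_iff _ (sub_ne_zero.mpr hg.symm)).mp h3
        · exact step χ hχ hχN
      · push Not at hn
        obtain ⟨χ, hχ⟩ : s.Nonempty := Finset.card_pos.mp (by omega)
        have : s = {χ} := Finset.eq_singleton_iff_unique_mem.mpr ⟨hχ, fun ψ hψ => hn ψ hψ χ hχ⟩
        rw [this, Finset.sum_singleton] at h1 h2
        exact ⟨χ, f χ, hf χ, h1, h2⟩
  have hfm' : ∑ χ ∈ f.support, f χ = m := hfm
  exact key _ f.support rfl f hf (hfm'.symm ▸ hm) (hfm'.symm ▸ hmN)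

end Diagonal

/-! ### Triangular bases of Yetter-Drinfeld modules -/

section Triangular

variable {k : Type u} [Field k] {H : Type w} [Ring H] [HopfAlgebra k H] {M : Type v}
  [AddCommGroup M] [Module k M] (V : YetterDrinfeld k H M)

/-- For grouplike g the Yetter-Drinfeld condition becomes δ(gm) = g m₍₋₁₎ g⁻¹ ⊗ g m₍₀₎. -/
lemma YetterDrinfeld.op_act {g : H} (hg : IsGroupLikeElem k g) (φ : H →ₗ[k] k) (m : M) :
    V.op φ (V.act g m) = V.act g (V.op (φ ∘ₗ LinearMap.mulLeft k g ∘ₗ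
      LinearMap.mulRight k (HopfAlgebra.antipode k g)) m) := by
  set S := HopfAlgebra.antipode k g
  have h1 := congr($(V.compat) (g ⊗ₜ m))
  have hL : ydLeft V.act V.coact (g ⊗ₜ m) =
      (LinearMap.mulRight k g).rTensor M (V.coact (V.act g m)) := by
    simp only [ydLeft, LinearMap.comp_apply, LinearMap.rTensor_tmul, hg.comul_eq_tmul_self,
      LinearEquiv.coe_coe, TensorProduct.comm_tmul, assoc_tmul, LinearMap.lTensor_tmul]
    change _ = (LinearMap.mulRight k g).rTensor M (V.coact (actMap V.act (g ⊗ₜ m)))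
    induction V.coact (actMap V.act (g ⊗ₜ m)) with
    | zero => simp
    | add x y hx hy => simp only [tmul_add, map_add, hx, hy]
    | tmul x y => simp
  have hR : ydRight V.act V.coact (g ⊗ₜ m) =
      TensorProduct.map (LinearMap.mulLeft k g) (V.act g) (V.coact m) := by
    simp only [ydRight, LinearMap.comp_apply, TensorProduct.map_tmul, hg.comul_eq_tmul_self]
    induction V.coact m with
    | zero => simp
    | add x y hx hy => simp only [tmul_add, map_add, hx, hy]
    | tmul x y =>
      simp only [LinearEquiv.coe_coe, tensorTensorTensorComm_tmul, TensorProduct.map_tmul]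
      rfl
  rw [hL, hR] at h1
  have h2 := congr(TensorProduct.lid k M ((φ ∘ₗ LinearMap.mulRight k S).rTensor M $h1))
  have hgS : g * S = 1 := hg.mul_antipode_cancel
  have e1 : (φ ∘ₗ LinearMap.mulRight k S) ∘ₗ LinearMap.mulRight k g = φ := by
    ext x
    simp [mul_assoc, hgS]
  rw [← LinearMap.comp_apply (LinearMap.rTensor M _), ← LinearMap.rTensor_comp, e1] at h2
  refine h2.trans ?_
  simp only [evalCoact, LinearMap.comp_apply]
  induction V.coact m with
  | zero => simp
  | add x y hx hy => simp only [map_add, hx, hy]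
  | tmul x y => simp [mul_assoc]

variable [FiniteDimensional k M]

/-- Existence of the next vector of a triangular basis. -/
lemma YetterDrinfeld.exists_eigenvector (hp : IsPointed k H) (ha : HasAbelianCoradical k H)
    (hd : ActsDiagonally (groupLikeAction V.act)) {N : Submodule k M} (hN : V.IsSub N)
    (hN' : N ≠ ⊤) (hNG : ∀ g, ∀ m ∈ N, groupLikeAction V.act g m ∈ N) :
    ∃ g : GroupLike k H, ∃ χ : GroupLike k H →* k, ∃ m ∉ N,
      m ∈ simultaneousEigenspace (groupLikeAction V.act) χ ∧
      ∀ φ : H →ₗ[k] k, V.op φ m - φ g.val • m ∈ N := by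
  obtain ⟨g, hg, m, hm, h⟩ := V.exists_isGroupLikeElem hp hN hN'
  -- The vectors with label g modulo N. Acting by a grouplike h conjugates the label to hgh⁻¹, which
  -- is g since the coradical is abelian; so `P` is G(H)-stable.
  let P : Submodule k M := ⨅ φ : H →ₗ[k] k, N.comap (V.op φ - φ g • LinearMap.id)
  have hP : ∀ x, x ∈ P ↔ ∀ φ : H →ₗ[k] k, V.op φ x - φ g • x ∈ N := fun x => by
    simp [P, Submodule.mem_iInf]
  have hPG : ∀ g, ∀ m ∈ P, groupLikeAction V.act g m ∈ P := fun h x hx => by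
    rw [hP] at hx ⊢
    intro φ
    have e1 : groupLikeAction V.act h = V.act h.val := rfl
    rw [e1, V.op_act h.isGroupLikeElem_val, ← map_smul, ← map_sub, ← e1]
    refine hNG h _ ?_
    have h2 := hx (φ ∘ₗ LinearMap.mulLeft k h.val ∘ₗ
      LinearMap.mulRight k (HopfAlgebra.antipode k h.val))
    have h3 : h.val * (g * HopfAlgebra.antipode k h.val) = g := by
      rw [← mul_assoc, ha _ (mem_coradical h.isGroupLikeElem_val) _ (mem_coradical hg), mul_assoc,
        h.isGroupLikeElem_val.mul_antipode_cancel, mul_one]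
    simpa [h3] using h2
  obtain ⟨χ, v, hv, hvP, hvN⟩ := hd.exists_mem_simultaneousEigenspace hPG ((hP m).mpr h) hm
  exact ⟨⟨g, hg⟩, χ, v, hvN, hv, (hP v).mp hvP⟩

/-- Existence of partial triangular bases. -/
lemma YetterDrinfeld.exists_triangular (hp : IsPointed k H) (ha : HasAbelianCoradical k H)
    (hd : ActsDiagonally (groupLikeAction V.act)) (n : ℕ) (hn : n ≤ finrank k M) :
    ∃ (v : Fin n → M) (g : Fin n → GroupLike k H) (χ : Fin n → (GroupLike k H →* k)),
      LinearIndependent k v ∧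
      (∀ x, v x ∈ simultaneousEigenspace (groupLikeAction V.act) (χ x)) ∧
      ∀ x, ∀ φ : H →ₗ[k] k, V.op φ (v x) - φ (g x).val • v x ∈
        Submodule.span k (v '' Set.Ioi x) := by
  induction n with
  | zero => exact ⟨Fin.elim0, Fin.elim0, Fin.elim0, linearIndependent_empty_type, fun x => x.elim0,
      fun x => x.elim0⟩
  | succ n ih =>
    obtain ⟨v, g, χ, hv, hχ, hg⟩ := ih (by omega)
    set N := Submodule.span k (Set.range v) with hNdef
    have hN : V.IsSub N := fun φ => by
      suffices N ≤ N.comap (V.op φ) from this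
      rw [hNdef, Submodule.span_le]
      rintro _ ⟨x, rfl⟩
      change V.op φ (v x) ∈ N
      rw [← sub_add_cancel (V.op φ (v x)) (φ (g x).val • v x)]
      exact N.add_mem (Submodule.span_mono (Set.image_subset_range _ _) (hg x φ))
        (N.smul_mem _ (Submodule.subset_span ⟨x, rfl⟩))
    have hNG : ∀ g, ∀ m ∈ N, groupLikeAction V.act g m ∈ N := fun g => by
      suffices N ≤ N.comap (groupLikeAction V.act g) from this
      rw [hNdef, Submodule.span_le]
      rintro _ ⟨x, rfl⟩
      change groupLikeAction V.act g (v x) ∈ N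
      rw [hχ x g]
      exact N.smul_mem _ (Submodule.subset_span ⟨x, rfl⟩)
    have hN' : N ≠ ⊤ := fun h => by
      have h1 : finrank k N ≤ n := by
        have := finrank_range_le_card (R := k) v
        rwa [Fintype.card_fin] at this
      rw [h, finrank_top] at h1
      omega
    obtain ⟨g', χ', m, hmN, hm, hg'⟩ := V.exists_eigenvector hp ha hd hN hN' hNG
    -- The new vector gets index 0: its error terms lie in the span of the vectors already chosen,
    -- which must be the larger ones in the order.
    refine ⟨Fin.cons m v, Fin.cons g' g, Fin.cons χ' χ, linearIndependent_finCons.mpr ⟨hv, hmN⟩,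
      fun x => ?_, fun x => ?_⟩
    · refine Fin.cases ?_ (fun x => ?_) x
      · simpa using hm
      · simpa using hχ x
    · refine Fin.cases (fun φ => ?_) (fun x φ => ?_) x
      · simp only [Fin.cons_zero]
        refine Submodule.span_mono ?_ (hg' φ)
        rintro _ ⟨y, rfl⟩
        exact ⟨y.succ, Fin.succ_pos y, Fin.cons_succ _ _ _⟩
      · simp only [Fin.cons_succ]
        refine Submodule.span_mono ?_ (hg x φ)
        rintro _ ⟨y, hy, rfl⟩
        exact ⟨y.succ, Fin.succ_lt_succ_iff.mpr hy, Fin.cons_succ _ _ _⟩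

/-- In the triangular basis T_xz vanishes for z < x and T_xx = g_x, so c(b_x ⊗ b_y) = ∑_z T_xz b_y ⊗
b_z has the required shape with β_xy = χ_y(g_x), nonzero because g_x is invertible. -/
theorem YetterDrinfeld.isRightTriangular {c : M ⊗[k] M ≃ₗ[k] M ⊗[k] M}
    (hV : V.braiding = c.toLinearMap) (hp : IsPointed k H) (ha : HasAbelianCoradical k H)
    (hd : ActsDiagonally (groupLikeAction V.act)) : IsRightTriangular c := by
  obtain ⟨v, g, χ, hv, hχ, hg⟩ := V.exists_triangular hp ha hd _ le_rfl
  have hspan := hv.span_eq_top_of_card_eq_finrank' (by simp)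
  let b := Basis.mk hv hspan.ge
  have hb : ∀ x, b x = v x := fun x => Basis.mk_apply _ _ _
  set T := coactMat b V.toLeftComodule with hT
  have hop : ∀ x φ, V.op φ (b x) = ∑ z, φ (T x z) • b z := fun x φ => by
    simp only [evalCoact, LinearMap.comp_apply, coact_basis b, map_sum, LinearMap.rTensor_tmul,
      LinearEquiv.coe_coe, lid_tmul, hT]
  have hrepr : ∀ x, ∀ z ≤ x, ∀ y ∈ Submodule.span k (v '' Set.Ioi x), b.repr y z = 0 := by
    intro x z hz y hy
    induction hy using Submodule.span_induction with
    | mem y hy =>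
      obtain ⟨i, hi, rfl⟩ := hy
      rw [← hb, Basis.repr_self, Finsupp.single_apply, if_neg]
      rintro rfl
      exact absurd hi (not_lt.mpr hz)
    | zero => simp
    | add y y' _ _ h h' => simp [h, h']
    | smul a y _ h => simp [h]
  have hTx : ∀ x z, z ≤ x → T x z = if z = x then (g x).val else 0 := fun x z hz =>
    eq_of_forall_dual fun φ => by
      have h1 := hrepr x z hz _ (hg x φ)
      rw [← hb, hop] at h1
      simp only [map_sub, map_sum, map_smul, Basis.repr_self] at h1
      simp only [Finsupp.sub_apply, Finsupp.coe_finsetSum, Finset.sum_apply, Finsupp.smul_apply,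
        Finsupp.single_apply, smul_eq_mul, mul_ite, mul_one, mul_zero, Finset.sum_ite_eq',
        Finset.mem_univ, if_true, sub_eq_zero] at h1
      rw [h1]
      simp only [eq_comm (a := x)]
      split_ifs <;> simp
  refine ⟨_, b, fun x y => χ y (g x), fun x y z => V.act (T x z) (b y), fun x y h0 => ?_,
    fun x y => ?_⟩
  · have h1 : χ y (g x) * χ y (g x)⁻¹ = 1 := by rw [← map_mul, mul_inv_cancel, map_one]
    exact left_ne_zero_of_mul_eq_one h1 h0
  · have h1 := congr($hV (b x ⊗ₜ b y))
    rw [LinearEquiv.coe_coe] at h1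
    rw [← h1, V.braiding_basis b, ← hT, ← Finset.sum_filter_add_sum_filter_not _ (· ≤ x)]
    congr 1
    · rw [Finset.sum_eq_single x]
      · rw [hTx x x le_rfl, if_pos rfl, smul_tmul']
        congr 1
        rw [hb]
        exact hχ y (g x)
      · intro z hz hne
        rw [hTx x z (Finset.mem_filter.mp hz).2, if_neg hne]
        simp
      · simp
    · refine Finset.sum_congr ?_ fun _ _ => rfl
      ext z
      simp

end Triangular

/-! ### Bialgebras generated by triangular families -/

section Words

variable {k : Type u} [Field k] {R : Type*} [Ring R]

/-- Products of generators of total weight `l`. -/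
inductive WeightedWord (𝒢 : ℕ → Set R) : ℕ → R → Prop
  | one : WeightedWord 𝒢 0 1
  | mul {d m : ℕ} {x a : R} : x ∈ 𝒢 d → WeightedWord 𝒢 m a → WeightedWord 𝒢 (d + m) (x * a)

/-- The span of the products of weight at most `m`. -/
def weightFiltration (k : Type u) [Field k] [Algebra k R] (𝒢 : ℕ → Set R) (m : ℕ) :
    Submodule k R :=
  Submodule.span k {x | ∃ l ≤ m, WeightedWord 𝒢 l x}

lemma WeightedWord.mem_submonoid {𝒢 : ℕ → Set R} {Γ : Submonoid R} (h0 : 𝒢 0 ⊆ Γ) {l : ℕ} {x : R}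
    (hx : WeightedWord 𝒢 l x) (hl : l = 0) : x ∈ Γ := by
  induction hx with
  | one => exact Γ.one_mem
  | mul hx _ ih =>
    obtain ⟨rfl, rfl⟩ := Nat.add_eq_zero_iff.mp hl
    exact Γ.mul_mem (h0 hx) (ih rfl)

lemma mem_weightFiltration [Algebra k R] {𝒢 : ℕ → Set R}
    (hgen : Algebra.adjoin k (⋃ d, 𝒢 d) = ⊤) (x : R) : ∃ m, x ∈ weightFiltration k 𝒢 m := by
  have hx : x ∈ Submodule.span k (Submonoid.closure (⋃ d, 𝒢 d) : Set R) := by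
    rw [← Algebra.adjoin_eq_span, hgen]
    trivial
  have mono : ∀ {m n : ℕ}, m ≤ n → weightFiltration k 𝒢 m ≤ weightFiltration k 𝒢 n := fun h =>
    Submodule.span_mono fun x ⟨l, hl, hx⟩ => ⟨l, hl.trans h, hx⟩
  induction hx using Submodule.span_induction with
  | mem x hx =>
    have : ∃ l, WeightedWord 𝒢 l x := by
      induction hx using Submonoid.closure_induction_left with
      | one => exact ⟨0, .one⟩
      | mul_left x hx y _ ih =>
        obtain ⟨d, hd⟩ := Set.mem_iUnion.mp hx
        obtain ⟨l, hl⟩ := ih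
        exact ⟨d + l, .mul hd hl⟩
    obtain ⟨l, hl⟩ := this
    exact ⟨l, Submodule.subset_span ⟨l, le_rfl, hl⟩⟩
  | zero => exact ⟨0, zero_mem _⟩
  | add x y _ _ hx hy =>
    obtain ⟨m, hm⟩ := hx
    obtain ⟨n, hn⟩ := hy
    exact ⟨max m n, add_mem (mono (le_max_left m n) hm) (mono (le_max_right m n) hn)⟩
  | smul a x _ hx =>
    obtain ⟨m, hm⟩ := hx
    exact ⟨m, Submodule.smul_mem _ a hm⟩

variable [Bialgebra k R] {𝒢 : ℕ → Set R}

lemma WeightedWord.comul_mem (hΔ : ∀ d, ∀ x ∈ 𝒢 d, comul (R := k) x ∈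
      Submodule.span k {z | ∃ p q a b, p + q = d ∧ a ∈ 𝒢 p ∧ b ∈ 𝒢 q ∧ z = a ⊗ₜ[k] b})
    {l : ℕ} {x : R} (hx : WeightedWord 𝒢 l x) : comul (R := k) x ∈ Submodule.span k
      {z | ∃ p q a b, p + q = l ∧ WeightedWord 𝒢 p a ∧ WeightedWord 𝒢 q b ∧ z = a ⊗ₜ[k] b} := by
  induction hx with
  | one => exact Submodule.subset_span ⟨0, 0, 1, 1, rfl, .one, .one, Bialgebra.comul_one⟩
  | mul hx _ ih =>
    rw [Bialgebra.comul_mul]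
    have h1 := Submodule.mul_mem_mul (hΔ _ _ hx) ih
    rw [Submodule.span_mul_span] at h1
    refine Submodule.span_mono ?_ h1
    rintro _ ⟨_, ⟨p, q, a, b, h, ha, hb, rfl⟩, _, ⟨p', q', a', b', h', ha', hb', rfl⟩, rfl⟩
    exact ⟨p + p', q + q', a * a', b * b', by omega, .mul ha ha', .mul hb hb', by simp⟩

/-- In Δ of a word, φ kills the terms whose right factor has weight 0; in the others the left factor
has lost weight. -/
lemma contrRight_mem_weightFiltration (hΔ : ∀ d, ∀ x ∈ 𝒢 d, comul (R := k) x ∈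
      Submodule.span k {z | ∃ p q a b, p + q = d ∧ a ∈ 𝒢 p ∧ b ∈ 𝒢 q ∧ z = a ⊗ₜ[k] b})
    {φ : R →ₗ[k] k} (hφ : ∀ x ∈ weightFiltration k 𝒢 0, φ x = 0) {m : ℕ} {x : R}
    (hx : x ∈ weightFiltration k 𝒢 (m + 1)) : contrRight φ x ∈ weightFiltration k 𝒢 m := by
  refine (?_ : weightFiltration k 𝒢 (m + 1) ≤ (weightFiltration k 𝒢 m).comap (contrRight φ)) hx
  clear hx x
  refine Submodule.span_le.mpr ?_
  rintro x ⟨l, hl, hx⟩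
  have h1 := hx.comul_mem hΔ
  suffices Submodule.span k {z | ∃ p q a b, p + q = l ∧ WeightedWord 𝒢 p a ∧ WeightedWord 𝒢 q b ∧
      z = a ⊗ₜ[k] b} ≤ (weightFiltration k 𝒢 m).comap
      ((TensorProduct.rid k R).toLinearMap ∘ₗ φ.lTensor R) from this h1
  refine Submodule.span_le.mpr ?_
  rintro _ ⟨p, q, a, b, h, ha, hb, rfl⟩
  have e : ((TensorProduct.rid k R).toLinearMap ∘ₗ φ.lTensor R) (a ⊗ₜ b) = φ b • a := by simp
  change ((TensorProduct.rid k R).toLinearMap ∘ₗ φ.lTensor R) (a ⊗ₜ b) ∈ weightFiltration k 𝒢 m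
  rw [e]
  rcases Nat.eq_zero_or_pos q with rfl | hq
  · rw [hφ b (Submodule.subset_span ⟨0, le_rfl, hb⟩), zero_smul]
    exact zero_mem _
  · exact Submodule.smul_mem _ _ (Submodule.subset_span ⟨p, by omega, ha⟩)

/-- Grouplikes are linearly independent, so a coordinate functional at γ exists; slicing Δ(x) with
it isolates the γ-term of x, and slices stay in E. -/
lemma exists_mem_of_mem_span_isGroupLikeElem {Γ : Set R} (hΓ : ∀ γ ∈ Γ, IsGroupLikeElem k γ)
    {E : Submodule k R} (hE : IsSubcoalgebra k E) {x : R} (hxE : x ∈ E)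
    (hx : x ∈ Submodule.span k Γ) (hx0 : x ≠ 0) : ∃ γ ∈ Γ, γ ∈ E := by
  classical
  have hli : LinearIndepOn k id Γ := linearIndepOn_isGroupLikeElem.mono hΓ
  let B := Basis.extend hli
  have hB : ∀ i, B i = i := Basis.extend_apply_self hli
  by_contra! h
  refine hx0 (B.repr.map_eq_zero_iff.mp (Finsupp.ext fun i => ?_))
  by_cases hi : (i : R) ∈ Γ
  · by_contra hne
    refine h i hi ?_
    have h1 : contrLeft (B.coord i) x = B.coord i x • (i : R) := by
      clear hxE hx0 hne
      induction hx using Submodule.span_induction with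
      | mem y hy =>
        rw [contrLeft_of_isGroupLikeElem (hΓ y hy)]
        have hy' : y = B ⟨y, Basis.subset_extend hli hy⟩ := (hB ⟨y, Basis.subset_extend hli hy⟩).symm
        by_cases hyi : y = i
        · rw [hyi]
        · have : B.coord i y = 0 := by
            rw [hy', Basis.coord_apply, Basis.repr_self, Finsupp.single_apply, if_neg]
            rintro rfl
            exact hyi rfl
          rw [this, zero_smul, zero_smul]
      | zero => simp
      | add y z _ _ hy hz => simp only [map_add, hy, hz, add_smul]
      | smul a y _ hy => simp only [map_smul, hy, smul_assoc]
    have h2 := ((isSubcoalgebra_iff E).mp hE x hxE (B.coord i)).1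
    rw [h1] at h2
    exact (E.smul_mem_iff hne).mp h2
  · clear hxE hx0
    rw [Finsupp.coe_zero, Pi.zero_apply]
    induction hx using Submodule.span_induction with
    | mem y hy =>
      have hy' : y = B ⟨y, Basis.subset_extend hli hy⟩ := (hB ⟨y, Basis.subset_extend hli hy⟩).symm
      rw [hy', Basis.repr_self, Finsupp.single_apply, if_neg]
      rintro rfl
      exact hi hy
    | zero => simp
    | add y z _ _ hy hz => simp [hy, hz]
    | smul a y _ hy => simp [hy]

/-- If a bialgebra is generated by a weighted family whose comultiplication respects the weights
and whose weight zero part consists of grouplike elements, then every nonzero subcoalgebra contains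
a product of these. -/
theorem exists_mem_of_weightedGenerators {Γ : Submonoid R} (hΓ : ∀ γ ∈ Γ, IsGroupLikeElem k γ)
    (h0 : 𝒢 0 ⊆ Γ) (hΔ : ∀ d, ∀ x ∈ 𝒢 d, comul (R := k) x ∈
      Submodule.span k {z | ∃ p q a b, p + q = d ∧ a ∈ 𝒢 p ∧ b ∈ 𝒢 q ∧ z = a ⊗ₜ[k] b})
    (hgen : Algebra.adjoin k (⋃ d, 𝒢 d) = ⊤) {E : Submodule k R} (hE : IsSubcoalgebra k E)
    (hE0 : E ≠ ⊥) : ∃ γ ∈ Γ, γ ∈ E := by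
  classical
  -- The least such m is 0. Otherwise choose φ vanishing in weight 0 with φ(x) ≠ 0: the element
  -- x₍₁₎φ(x₍₂₎) of E has a smaller filtration degree, and it is nonzero because its counit is φ(x).
  have hex : ∃ m, ∃ x ∈ E, x ≠ 0 ∧ x ∈ weightFiltration k 𝒢 m := by
    obtain ⟨x, hx, hx0⟩ := Submodule.exists_mem_ne_zero_of_ne_bot hE0
    obtain ⟨m, hm⟩ := mem_weightFiltration (k := k) hgen x
    exact ⟨m, x, hx, hx0, hm⟩
  obtain ⟨x, hxE, hx0, hx⟩ := Nat.find_spec hex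
  have hmin : x ∈ weightFiltration k 𝒢 0 := by
    rcases hm : Nat.find hex with _ | m
    · rwa [hm] at hx
    · rw [hm] at hx
      by_contra hx'
      obtain ⟨φ, hφx, hφ⟩ := Submodule.exists_le_ker_of_notMem hx'
      refine Nat.find_min hex (m := m) (by omega) ⟨contrRight φ x, ?_, fun hc => hφx ?_, ?_⟩
      · exact ((isSubcoalgebra_iff E).mp hE x hxE φ).2
      · have h1 : counit (R := k) (contrRight φ x) = φ x := by
          rw [apply_contrRight, ← (ℛ k x).eq, map_sum, map_sum]
          simp only [TensorProduct.map_tmul, LinearMap.mul'_apply]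
          have := congr(φ $(sum_counit_smul (ℛ k x)))
          simpa using this
        rw [← h1, hc, map_zero]
      · exact contrRight_mem_weightFiltration hΔ (fun y hy => hφ hy) hx
  refine exists_mem_of_mem_span_isGroupLikeElem hΓ hE hxE ?_ hx0
  refine Submodule.span_mono ?_ hmin
  rintro y ⟨l, hl, hy⟩
  exact hy.mem_submonoid h0 (Nat.le_zero.mp hl)

end Words

/-! ### Coalgebras whose nonzero subcoalgebras all meet a set of grouplikes -/

section GroupLike

variable {k : Type u} [Field k] {C : Type*} [AddCommGroup C] [Module k C] [Coalgebra k C]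
  {Γ : Set C}

lemma IsSimpleSubcoalgebra.eq_span_singleton (hΓ : ∀ γ ∈ Γ, IsGroupLikeElem k γ)
    (h : ∀ E : Submodule k C, IsSubcoalgebra k E → E ≠ ⊥ → ∃ γ ∈ Γ, γ ∈ E) {D : Submodule k C}
    (hD : IsSimpleSubcoalgebra k D) : ∃ γ ∈ Γ, D = Submodule.span k {γ} := by
  obtain ⟨γ, hγ, hγD⟩ := h D hD.1 hD.2.1
  refine ⟨γ, hγ, ?_⟩
  rcases hD.2.2 _ (isSubcoalgebra_span_singleton (hΓ γ hγ)) (by simpa using hγD) with h1 | h1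
  · exact absurd h1 (isSimpleSubcoalgebra_span_singleton (hΓ γ hγ)).2.1
  · exact h1.symm

lemma isPointed_of_forall_exists_mem (hΓ : ∀ γ ∈ Γ, IsGroupLikeElem k γ)
    (h : ∀ E : Submodule k C, IsSubcoalgebra k E → E ≠ ⊥ → ∃ γ ∈ Γ, γ ∈ E) : IsPointed k C := by
  intro D hD
  obtain ⟨γ, hγ, rfl⟩ := hD.eq_span_singleton hΓ h
  exact finrank_span_singleton (hΓ γ hγ).ne_zero

lemma coradical_le_span (hΓ : ∀ γ ∈ Γ, IsGroupLikeElem k γ)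
    (h : ∀ E : Submodule k C, IsSubcoalgebra k E → E ≠ ⊥ → ∃ γ ∈ Γ, γ ∈ E) :
    coradical k C ≤ Submodule.span k Γ := by
  refine sSup_le fun D hD => ?_
  obtain ⟨γ, hγ, rfl⟩ := IsSimpleSubcoalgebra.eq_span_singleton hΓ h hD
  exact Submodule.span_mono (by simpa using hγ)

/-- The line kg meets Γ, and the counit forces the scalar to be 1. -/
lemma mem_of_isGroupLikeElem (hΓ : ∀ γ ∈ Γ, IsGroupLikeElem k γ)
    (h : ∀ E : Submodule k C, IsSubcoalgebra k E → E ≠ ⊥ → ∃ γ ∈ Γ, γ ∈ E) {g : C}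
    (hg : IsGroupLikeElem k g) : g ∈ Γ := by
  obtain ⟨γ, hγ, hγg⟩ := h _ (isSubcoalgebra_span_singleton hg)
    (isSimpleSubcoalgebra_span_singleton hg).2.1
  obtain ⟨a, rfl⟩ := Submodule.mem_span_singleton.mp hγg
  have h1 := (hΓ _ hγ).counit_eq_one
  rw [map_smul, hg.counit_eq_one, smul_eq_mul, mul_one] at h1
  rwa [h1, one_smul] at hγ

lemma commute_of_mem_span {R : Type*} [Ring R] [Algebra k R] {Γ : Set R}
    (h : ∀ x ∈ Γ, ∀ y ∈ Γ, x * y = y * x) {x y : R} (hx : x ∈ Submodule.span k Γ)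
    (hy : y ∈ Submodule.span k Γ) : x * y = y * x := by
  induction hx, hy using Submodule.span_induction₂ with
  | mem_mem x y hx hy => exact h x hx y hy
  | zero_left => simp
  | zero_right => simp
  | add_left x y z _ _ _ h1 h2 => rw [add_mul, mul_add, h1, h2]
  | add_right x y z _ _ _ h1 h2 => rw [add_mul, mul_add, h1, h2]
  | smul_left a x y _ _ h => rw [smul_mul_assoc, mul_smul_comm, h]
  | smul_right a x y _ _ h => rw [smul_mul_assoc, mul_smul_comm, h]

end GroupLike

/-! ### Diagonal actions from eigenbases -/

section Diagonal

variable {k : Type u} [Field k] {M : Type v} [AddCommGroup M] [Module k M] {G : Type*} [Monoid G]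

lemma iSupIndep_simultaneousEigenspace {ρ : G →* Module.End k M}
    (hρ : ∀ g h, Commute (ρ g) (ρ h)) :
    iSupIndep fun χ : G →* k => simultaneousEigenspace ρ χ := by
  have h1 := Module.End.independent_iInf_maxGenEigenspace_of_forall_mapsTo (fun g => ρ g)
    fun g h μ => Module.End.mapsTo_maxGenEigenspace_of_comm (hρ h g) μ
  refine (h1.comp (f := fun χ : G →* k => (χ : G → k)) DFunLike.coe_injective).mono fun χ => ?_
  refine le_iInf fun g m hm => ?_
  refine (Module.End.mem_maxGenEigenspace _ _ _).mpr ⟨1, ?_⟩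
  rw [pow_one, LinearMap.sub_apply, hm g]
  exact sub_self _

lemma actsDiagonally_of_basis {ι : Type*} (b : Basis ι k M) {ρ : G →* Module.End k M}
    (χ : ι → G →* k) (h : ∀ i g, ρ g (b i) = χ i g • b i) : ActsDiagonally ρ := by
  classical
  refine (DirectSum.isInternal_submodule_iff_iSupIndep_and_iSup_eq_top _).mpr
    ⟨iSupIndep_simultaneousEigenspace fun g g' => b.ext fun i => ?_, ?_⟩
  · simp only [Module.End.mul_apply, h, map_smul]
    exact smul_comm _ _ _
  · rw [eq_top_iff, ← b.span_eq, Submodule.span_le]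
    rintro _ ⟨i, rfl⟩
    exact Submodule.mem_iSup_of_mem (χ i) (h i)

end Diagonal

/-! ### From triangular braidings to pointed Hopf algebras -/

section TriangularCoaction

variable {k : Type u} [Field k] {H : Type w} [Ring H] [HopfAlgebra k H] {M : Type v}
  [AddCommGroup M] [Module k M] {n : ℕ} (b : Basis (Fin n) k M)

/-- The coefficients on the `d`-th diagonal of a triangular coaction and their antipodes. -/
def diagonalCoefs (V : LeftComodule k H M) (d : ℕ) : Set H :=
  {a | ∃ x z : Fin n, (z : ℕ) = x + d ∧
    (a = coactMat b V x z ∨ a = HopfAlgebra.antipode k (coactMat b V x z))}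

variable {b} {V : LeftComodule k H M}

/-- Only x ≤ l ≤ z contribute to Δ(T_xz) = ∑ T_xl ⊗ T_lz, and the distances l - x and z - l add up
to z - x. -/
lemma comul_mem_of_mem_diagonalCoefs (hT : ∀ x z, z < x → coactMat b V x z = 0) (d : ℕ) (a : H)
    (ha : a ∈ diagonalCoefs b V d) :
    comul (R := k) a ∈ Submodule.span k {z | ∃ p q a b', p + q = d ∧ a ∈ diagonalCoefs b V p ∧
      b' ∈ diagonalCoefs b V q ∧ z = a ⊗ₜ[k] b'} := by
  obtain ⟨x, z, hxz, rfl | rfl⟩ := ha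
  · rw [comul_coactMat]
    refine Submodule.sum_mem _ fun l _ => ?_
    by_cases hxl : l < x
    · simp [hT x l hxl]
    by_cases hlz : z < l
    · simp [hT l z hlz]
    exact Submodule.subset_span ⟨l - x, z - l, _, _, by omega, ⟨x, l, by omega, .inl rfl⟩,
      ⟨l, z, by omega, .inl rfl⟩, rfl⟩
  · rw [← (antipodeRepr (coactRepr b V x z)).eq]
    refine Submodule.sum_mem _ fun l _ => ?_
    change HopfAlgebra.antipode k (coactMat b V l z) ⊗ₜ
      HopfAlgebra.antipode k (coactMat b V x l) ∈ _
    by_cases hxl : l < x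
    · simp [hT x l hxl]
    by_cases hlz : z < l
    · simp [hT l z hlz]
    exact Submodule.subset_span ⟨z - l, l - x, _, _, by omega, ⟨l, z, by omega, .inr rfl⟩,
      ⟨x, l, by omega, .inr rfl⟩, rfl⟩

lemma isGroupLikeElem_coactMat (hT : ∀ x z, z < x → coactMat b V x z = 0) (x : Fin n) :
    IsGroupLikeElem k (coactMat b V x x) where
  counit_eq_one := by simp [counit_coactMat]
  comul_eq_tmul_self := by
    rw [comul_coactMat, Finset.sum_eq_single x _ (by simp)]
    intro l _ hl
    rcases lt_or_gt_of_ne hl with h | h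
    · simp [hT x l h]
    · simp [hT l x h]

lemma adjoin_iUnion_diagonalCoefs (hT : ∀ x z, z < x → coactMat b V x z = 0)
    (hgen : Algebra.adjoin k {a | ∃ i j, a = coactMat b V i j ∨
      a = HopfAlgebra.antipode k (coactMat b V i j)} = ⊤) :
    Algebra.adjoin k (⋃ d, diagonalCoefs b V d) = ⊤ := by
  rw [eq_top_iff, ← hgen]
  refine Algebra.adjoin_le ?_
  rintro a ⟨i, j, ha⟩
  by_cases h : j < i
  · have : a = 0 := by rcases ha with rfl | rfl <;> simp [hT i j h]
    rw [this]
    exact zero_mem _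
  · exact Algebra.subset_adjoin (Set.mem_iUnion.mpr ⟨j - i, i, j, by omega, ha⟩)

end TriangularCoaction

/-! ### Grouplike elements acting by diagonal matrices -/

section DiagonalAction

variable {k : Type u} [Field k] {H : Type w} [Ring H] [HopfAlgebra k H] {M : Type v}
  [AddCommGroup M] [Module k M] {ι : Type} [Fintype ι] [DecidableEq ι] (b : Basis ι k M)

/-- The grouplike elements which act by diagonal matrices. -/
def diagonalGroupLike (ρ : H →ₐ[k] Module.End k M) : Submonoid H where
  carrier := {g | IsGroupLikeElem k g ∧ (actMat b ρ g).IsDiag}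
  one_mem' := ⟨.one, by rw [map_one]; exact isDiag_one⟩
  mul_mem' {g h} hg hh := ⟨hg.1.mul hh.1, by
    rw [map_mul, ← hg.2.diagonal_diag, ← hh.2.diagonal_diag, diagonal_mul_diagonal]
    exact isDiag_diagonal _⟩

lemma antipode_mem_diagonalGroupLike {ρ : H →ₐ[k] Module.End k M} {g : H}
    (hg : g ∈ diagonalGroupLike b ρ) : HopfAlgebra.antipode k g ∈ diagonalGroupLike b ρ := by
  refine ⟨hg.1.antipode, fun q y hqy => ?_⟩
  have h1 := congr(actMat b ρ $(hg.1.antipode_mul_cancel))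
  rw [map_mul, map_one, ← hg.2.diagonal_diag] at h1
  have h2 := congr($h1 q y)
  have h3 := congr($h1 y y)
  rw [mul_diagonal] at h2 h3
  rw [one_apply_eq] at h3
  rw [one_apply_ne hqy] at h2
  exact (mul_eq_zero.mp h2).resolve_right (right_ne_zero_of_mul_eq_one h3)

lemma actsDiagonally_of_isDiag {ρ : H →ₐ[k] Module.End k M}
    (h : ∀ g, IsGroupLikeElem k g → (actMat b ρ g).IsDiag) :
    ActsDiagonally (groupLikeAction ρ) := by
  refine actsDiagonally_of_basis b (fun i =>
    { toFun := fun g => actMat b ρ g.val i i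
      map_one' := by simp
      map_mul' := fun g g' => by
        rw [GroupLike.val_mul, map_mul, ← (h _ g.isGroupLikeElem_val).diagonal_diag,
          diagonal_mul, diagonal_apply_eq, diag_apply] }) fun i g => ?_
  change ρ g.val (b i) = actMat b ρ g.val i i • b i
  rw [act_basis b, Finset.sum_eq_single i _ (by simp)]
  intro p _ hp
  rw [h _ g.isGroupLikeElem_val hp, zero_smul]

end DiagonalAction

/-! ### Pointedness from a triangular coaction -/

section

variable {k : Type u} [Field k] {H : Type w} [Ring H] [HopfAlgebra k H] {M : Type v}
  [AddCommGroup M] [Module k M] {n : ℕ} (b : Basis (Fin n) k M) (V : YetterDrinfeld k H M)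

/-- Let Γ be the monoid of grouplikes acting diagonally. It contains the weight-zero generators, so
every nonzero subcoalgebra meets Γ; this gives pointedness and shows that Γ contains all grouplikes.
Diagonal matrices commute, so gh and hg act alike, and `hinj` makes them equal. -/
theorem YetterDrinfeld.isPointed_of_triangular
    (hT : ∀ x z, z < x → coactMat b V.toLeftComodule x z = 0)
    (hgen : Algebra.adjoin k {a | ∃ i j, a = coactMat b V.toLeftComodule i j ∨
      a = HopfAlgebra.antipode k (coactMat b V.toLeftComodule i j)} = ⊤)
    (hdiag : ∀ x, (actMat b V.act (coactMat b V.toLeftComodule x x)).IsDiag)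
    (hinj : ∀ g h, IsGroupLikeElem k g → IsGroupLikeElem k h → V.act g = V.act h → g = h) :
    IsPointed k H ∧ HasAbelianCoradical k H ∧ ActsDiagonally (groupLikeAction V.act) := by
  set Γ := diagonalGroupLike b V.act
  have hΓ : ∀ γ ∈ (Γ : Set H), IsGroupLikeElem k γ := fun γ h => h.1
  have h0 : diagonalCoefs b V.toLeftComodule 0 ⊆ Γ := by
    rintro a ⟨x, z, hxz, ha⟩
    obtain rfl : z = x := Fin.ext hxz
    have hz : coactMat b V.toLeftComodule z z ∈ Γ := ⟨isGroupLikeElem_coactMat hT z, hdiag z⟩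
    rcases ha with rfl | rfl
    · exact hz
    · exact antipode_mem_diagonalGroupLike b hz
  have hmeet : ∀ E : Submodule k H, IsSubcoalgebra k E → E ≠ ⊥ → ∃ γ ∈ (Γ : Set H), γ ∈ E :=
    fun E hE hE0 => exists_mem_of_weightedGenerators hΓ h0 (comul_mem_of_mem_diagonalCoefs hT)
      (adjoin_iUnion_diagonalCoefs hT hgen) hE hE0
  have hcomm : ∀ g ∈ (Γ : Set H), ∀ h ∈ (Γ : Set H), g * h = h * g := fun g hg h hh => by
    refine hinj _ _ (hg.1.mul hh.1) (hh.1.mul hg.1) ?_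
    refine (LinearMap.toMatrixAlgEquiv b).injective ?_
    change actMat b V.act (g * h) = actMat b V.act (h * g)
    rw [map_mul, map_mul, ← hg.2.diagonal_diag, ← hh.2.diagonal_diag, diagonal_mul_diagonal,
      diagonal_mul_diagonal]
    simp only [mul_comm]
  refine ⟨isPointed_of_forall_exists_mem hΓ hmeet, fun x hx y hy => ?_, ?_⟩
  · exact commute_of_mem_span hcomm (coradical_le_span hΓ hmeet hx) (coradical_le_span hΓ hmeet hy)
  · exact actsDiagonally_of_isDiag b fun g hg => (mem_of_isGroupLikeElem hΓ hmeet hg).2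

end

/-! ### Triangularity of the reduced FRT Hopf algebra -/

section Radical

variable {k : Type u} [Field k] {M : Type v} [AddCommGroup M] [Module k M]

section
variable {H : Type*} [Ring H] [HopfAlgebra k H] {r : H ⊗[k] H →ₗ[k] k} (hr : IsCoquasitriangular r)

/-- The projection onto the reduced bialgebra. -/
def reducedMk : H →ₐc[k] Reduced hr := Bialgebra.Quotient.mkBialgHom (rightRadical hr)

lemma reducedMk_surjective : Function.Surjective (reducedMk hr) := Ideal.Quotient.mk_surjective

/-- The linear form `r(a ⊗ -)` on the reduced bialgebra. -/
def reducedForm (a : H) : Reduced hr →ₗ[k] k :=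
  ((rightRadical hr).restrictScalars k).liftQ (curry r a) fun _ hx => hx a

lemma reducedForm_mk (a h : H) :
    reducedForm hr a (reducedMk hr h) = r (a ⊗ₜ h) := rfl

lemma reducedForm_ext {g h : Reduced hr} (H : ∀ a, reducedForm hr a g = reducedForm hr a h) :
    g = h := by
  obtain ⟨g, rfl⟩ := reducedMk_surjective hr g
  obtain ⟨h, rfl⟩ := reducedMk_surjective hr h
  refine Ideal.Quotient.eq.mpr fun a => ?_
  rw [tmul_sub, map_sub]
  exact sub_eq_zero.mpr (H a)

lemma reducedForm_mul (a b : H) (q : Reduced hr) : reducedForm hr (a * b) q =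
    LinearMap.mul' k k (TensorProduct.map (reducedForm hr a) (reducedForm hr b) (comul q)) := by
  obtain ⟨q, rfl⟩ := reducedMk_surjective hr q
  rw [reducedForm_mk, hr.mul_left_repr _ _ (ℛ k q), ← ((ℛ k q).induced _).eq, map_sum, map_sum]
  rfl

/-- The character `r(- ⊗ g)` for a grouplike element `g` of the reduced bialgebra. -/
def reducedFormHom {g : Reduced hr} (hg : IsGroupLikeElem k g) : H →ₐ[k] k :=
  AlgHom.ofLinearMap
    { toFun := fun a => reducedForm hr a g
      map_add' := fun a b => by
        obtain ⟨q, rfl⟩ := reducedMk_surjective hr g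
        simp only [reducedForm_mk, add_tmul, map_add]
      map_smul' := fun c a => by
        obtain ⟨q, rfl⟩ := reducedMk_surjective hr g
        simp only [reducedForm_mk, ← smul_tmul', map_smul, RingHom.id_apply] }
    (by
      have h1 := hg.counit_eq_one
      obtain ⟨q, rfl⟩ := reducedMk_surjective hr g
      change r (1 ⊗ₜ q) = 1
      rw [hr.one_tmul]
      exact h1)
    (fun a b => by
      change reducedForm hr (a * b) g = reducedForm hr a g * reducedForm hr b g
      rw [reducedForm_mul, hg.comul_eq_tmul_self]
      simp)

lemma reducedFormHom_apply {g : Reduced hr} (hg : IsGroupLikeElem k g) (a : H) :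
    reducedFormHom hr hg a = reducedForm hr a g := rfl

lemma reducedForm_coactMat {ι : Type} [Fintype ι] [DecidableEq ι] (b : Basis ι k M)
    (V : LeftComodule k H M) (i p : ι) (g : Reduced hr) :
    reducedForm hr (coactMat b V i p) g = actMat b (reducedAction hr V) g p i := by
  obtain ⟨g, rfl⟩ := reducedMk_surjective hr g
  exact (actMat_formAction b hr V g p i).symm

lemma reducedFormHom_coactMat_eq {ι : Type} [Fintype ι] [DecidableEq ι] (b : Basis ι k M)
    (V : LeftComodule k H M) {g h : Reduced hr} (hg : IsGroupLikeElem k g)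
    (hh : IsGroupLikeElem k h) (hgh : reducedAction hr V g = reducedAction hr V h) (i p : ι) :
    reducedFormHom hr hg (coactMat b V i p) = reducedFormHom hr hh (coactMat b V i p) := by
  rw [reducedFormHom_apply, reducedFormHom_apply, reducedForm_coactMat, reducedForm_coactMat]
  exact congr(LinearMap.toMatrixAlgEquiv b $hgh p i)

end

variable [FiniteDimensional k M] {c : M ⊗[k] M ≃ₗ[k] M ⊗[k] M}

/-- Grouplike elements of the reduced FRT Hopf algebra are determined by their action. -/
lemma FRTHopfAlgebra.eq_of_redAction_eq (hc : IsBraiding c) (hr : IsRigid c)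
    (F : FRTHopfAlgebra.{u, v, w} c) {g h : F.Red} (hg : IsGroupLikeElem k g)
    (hh : IsGroupLikeElem k h) (H : F.redAction g = F.redAction h) : g = h := by
  obtain ⟨R, G, G', hG, ψ, hψ, hψt, -⟩ := exists_presentation (finBasis k M) hc hr F
  -- For grouplike g the form r(- ⊗ g) is a character, determined by its values on T, which are the
  -- matrix entries of the action of g. Modulo J this character determines g.
  have key : (reducedFormHom F.isCoquasitriangular hg).comp (AlgHomClass.toAlgHom ψ) =
      (reducedFormHom F.isCoquasitriangular hh).comp (AlgHomClass.toAlgHom ψ) := by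
    refine FRTAlg.algHom_ext fun i j => ?_
    have h1 := reducedFormHom_coactMat_eq F.isCoquasitriangular (finBasis k M) F.comodule hg hh H i j
    rw [← hψt] at h1
    exact h1
  refine reducedForm_ext _ fun a => ?_
  obtain ⟨a, rfl⟩ := hψ a
  exact congr($key a)

section
variable {n : ℕ} (b : Basis (Fin n) k M)

lemma form_coactMat_coactMat {ι : Type} [Fintype ι] [DecidableEq ι] (b : Basis ι k M)
    (F : FRTHopfAlgebra.{u, v, w} c) (i j x z : ι) :
    F.form (coactMat b F.comodule i j ⊗ₜ coactMat b F.comodule x z) = braidCoef c b x z j i := by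
  rw [← actMat_formAction b F.isCoquasitriangular]
  exact congr($((formYD b F.isCoquasitriangular F.comodule).actMat_coactMat b
    ((formYD_braiding b _ _).trans F.formBraiding_eq) x z) j i)

/-- The vanishing of r(a ⊗ T_xz) for all z < x says that a acts triangularly through r. It is given
for a in T, passes to S(T) as the inverse of a block triangular matrix, and is preserved by
products, since in ∑_l r(a ⊗ T_xl) r(a' ⊗ T_lz) either l < x or z < l. -/
lemma coactMat_mem_radical (hc : IsBraiding c) (hr : IsRigid c)
    (hbr : ∀ x z q y, z < x → braidCoef c b x z q y = 0)
    (F : FRTHopfAlgebra.{u, v, w} c) {x z : Fin n} (hxz : z < x) :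
    coactMat b F.comodule x z ∈ F.radical := by
  obtain ⟨R, G, G', hG, ψ, hψ, hψt, hψu⟩ := exists_presentation b hc hr F
  set T := coactMat b F.comodule with hT
  let 𝓡 (x z : Fin n) : Coalgebra.Repr k (T x z) (Fin n) := coactRepr b F.comodule x z
  let X : Matrix (Fin n × Fin n) (Fin n × Fin n) k :=
    Matrix.of fun a a' => F.form (T a.2 a'.2 ⊗ₜ T a.1 a'.1)
  let Y : Matrix (Fin n × Fin n) (Fin n × Fin n) k :=
    Matrix.of fun a a' => F.form (HopfAlgebra.antipode k (T a.2 a'.2) ⊗ₜ T a.1 a'.1)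
  have hXY : X * Y = 1 := by
    ext ⟨x, i⟩ ⟨y, l⟩
    rw [Matrix.mul_apply, Fintype.sum_prod_type, Finset.sum_comm]
    have h1 := congr(F.form ($(coactMat_mul_map_antipode b F.comodule) i l ⊗ₜ T x y))
    rw [Matrix.mul_apply] at h1
    simp only [sum_tmul, map_sum, F.isCoquasitriangular.mul_left_repr _ _
      (𝓡 x y)] at h1
    refine Eq.trans h1 ?_
    by_cases hil : i = l
    · subst hil
      rw [one_apply_eq, F.isCoquasitriangular.one_tmul, hT, counit_coactMat]
      simp [one_apply]
    · rw [one_apply_ne hil, zero_tmul, map_zero, one_apply_ne (by simp [hil])]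
  have hX : X.BlockTriangular Prod.fst := fun a a' h => by
    change F.form _ = 0
    rw [form_coactMat_coactMat, hbr _ _ _ _ h]
  have hY : Y.BlockTriangular Prod.fst := by
    let _ : Invertible X := invertibleOfRightInverse X Y hXY
    rw [← Matrix.inv_eq_right_inv hXY]
    exact blockTriangular_inv_of_blockTriangular hX
  have key : ∀ a, ∀ x z : Fin n, z < x → F.form (ψ a ⊗ₜ T x z) = 0 := fun a => by
    induction a using FRTAlg.induction with
    | ht i j =>
      intro x z h
      rw [hψt]
      exact hX (i := (x, i)) (j := (z, j)) h
    | hu i j =>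
      intro x z h
      rw [hψu]
      exact hY (i := (x, i)) (j := (z, j)) h
    | hc a =>
      intro x z h
      rw [AlgHomClass.commutes, Algebra.algebraMap_eq_smul_one, ← smul_tmul', map_smul,
        F.isCoquasitriangular.one_tmul, hT, counit_coactMat, one_apply_ne h.ne', smul_zero]
    | hadd a a' h h' =>
      intro x z hxz
      rw [map_add, add_tmul, map_add, h x z hxz, h' x z hxz, add_zero]
    | hmul a a' h h' =>
      intro x z hxz
      rw [map_mul, F.isCoquasitriangular.mul_left_repr _ _ (𝓡 x z)]
      refine Finset.sum_eq_zero fun l _ => ?_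
      rcases lt_or_ge l x with hl | hl
      · exact mul_eq_zero_of_left (h x l hl) _
      · exact mul_eq_zero_of_right _ (h' l z (hxz.trans_le hl))
  intro a
  obtain ⟨a, rfl⟩ := hψ a
  exact key a x z hxz

/-- Right triangularity makes the blocks C_xz below the diagonal vanish and the blocks C_xx diagonal
matrices. Hence T is triangular modulo J, its diagonal entries act diagonally, and grouplikes are
determined by their action. -/
theorem FRTHopfAlgebra.isPointed_red (hc : IsBraiding c) (hr : IsRigid c)
    (ht : IsRightTriangular c) (F : FRTHopfAlgebra.{u, v, w} c) :
    IsPointed k F.Red ∧ HasAbelianCoradical k F.Red ∧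
      ActsDiagonally (groupLikeAction F.redAction) := by
  obtain ⟨n, b, β, w, -, ht⟩ := ht
  have hcoef : ∀ x z q y, z ≤ x → braidCoef c b x z q y =
      if z = x ∧ q = y then β x y else 0 := fun x z q y hzx => by
    rw [braidCoef_apply, ht, map_add, map_smul, map_sum, Finsupp.add_apply, Finsupp.smul_apply,
      Basis.tensorProduct_repr_tmul_apply, Finsupp.finsetSum_apply, Finset.sum_eq_zero, add_zero]
    · simp only [Basis.repr_self, Finsupp.single_apply, smul_eq_mul, mul_ite, mul_one, mul_zero,
        eq_comm (a := x), eq_comm (a := y)]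
      split_ifs <;> simp_all
    · intro z' hz'
      rw [Basis.tensorProduct_repr_tmul_apply, Basis.repr_self, Finsupp.single_apply, if_neg]
      · exact zero_smul _ _
      rintro rfl
      exact absurd (Finset.mem_Ioi.mp hz') (not_lt.mpr hzx)
  have : F.radical.IsHopfIdeal k := F.isHopfIdeal_radical hc hr
  have hmap : ∀ i j, coactMat b (F.redYD b).toLeftComodule i j =
      reducedMk F.isCoquasitriangular (coactMat b F.comodule i j) := fun i j =>
    coactMat_map b _ _ _ _
  refine YetterDrinfeld.isPointed_of_triangular b (F.redYD b) (fun x z h => ?_) ?_ (fun x q y h => ?_)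
    fun g h hg hh H => F.eq_of_redAction_eq hc hr hg hh H
  · rw [hmap]
    refine Ideal.Quotient.eq_zero_iff_mem.mpr (coactMat_mem_radical b hc hr (fun x z q y h => ?_) F h)
    rw [hcoef _ _ _ _ h.le, if_neg (fun h' => h.ne h'.1)]
  · rw [eq_top_iff]
    rintro a -
    obtain ⟨a, rfl⟩ := reducedMk_surjective _ a
    obtain ⟨R, G, G', hG, ψ, hψ, hψt, hψu⟩ := exists_presentation b hc hr F
    obtain ⟨a, rfl⟩ := hψ a
    induction a using FRTAlg.induction with
    | ht i j =>
      rw [hψt, ← hmap]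
      exact Algebra.subset_adjoin ⟨i, j, .inl rfl⟩
    | hu i j =>
      rw [hψu, map_antipode, ← hmap]
      exact Algebra.subset_adjoin ⟨i, j, .inr rfl⟩
    | hc a =>
      rw [AlgHomClass.commutes, AlgHomClass.commutes]
      exact Subalgebra.algebraMap_mem _ a
    | hadd a a' h h' =>
      rw [map_add, map_add]
      exact add_mem h h'
    | hmul a a' h h' =>
      rw [map_mul, map_mul]
      exact mul_mem h h'
  · change actMat b (F.redYD b).act _ q y = 0
    rw [YetterDrinfeld.actMat_coactMat b _ (F.redYD_braiding b), hcoef _ _ _ _ le_rfl,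
      if_neg (fun h' => h h'.2)]

end
end Radical

end

end BraidedHopf

theorem mainTheorem1 {k : Type u} [Field k] {M : Type v} [AddCommGroup M] [Module k M]
    [FiniteDimensional k M] (c : M ⊗[k] M ≃ₗ[k] M ⊗[k] M) (hc : IsBraiding c)
    (hrigid : IsRigid c) :
    Nonempty (FRTHopfAlgebra.{u, v, w} c) ∧
    ∀ F : FRTHopfAlgebra.{u, v, w} c,
      F.radical.IsHopfIdeal k ∧
      [IsRightTriangular c,
        IsPointed k F.Red ∧ HasAbelianCoradical k F.Red ∧
          ActsDiagonally (groupLikeAction F.redAction),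
        ∃ (H : Type (max u w)) (_ : Ring H) (_ : HopfAlgebra k H) (V : YetterDrinfeld k H M),
          IsPointed k H ∧ HasAbelianCoradical k H ∧ V.braiding = c.toLinearMap ∧
            ActsDiagonally (groupLikeAction V.act)].TFAE := by
  refine ⟨nonempty_frtHopfAlgebra hc hrigid, fun F => ⟨F.isHopfIdeal_radical hc hrigid, ?_⟩⟩
  tfae_have 1 → 2 := fun h => F.isPointed_red hc hrigid h
  tfae_have 2 → 3 := fun ⟨hp, ha, hd⟩ => by
    have : F.radical.IsHopfIdeal k := F.isHopfIdeal_radical hc hrigid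
    -- The reduced algebra is itself the witness: J acts as zero on M, so the Yetter-Drinfeld
    -- structure descends with the same braiding.
    exact ⟨F.Red, inferInstance, inferInstance, F.redYD (Module.finBasis k M), hp, ha,
      F.redYD_braiding _, hd⟩
  tfae_have 3 → 1 := fun ⟨H, _, _, V, hp, ha, hV, hd⟩ => V.isRightTriangular hV hp ha hd
  tfae_finish
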